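/- **Definitions.** Write $\mathbb C^+=\{z:\operatorname{Im}z\ge 0\}$. A *chart* with values in $H$ ($H=\mathbb C$ or $\mathbb C^+$) on a Hausdorff space is a homeomorphism from an open set onto (I) an open subset of $H$, or (II) a space $V_1\sqcup_a V_2$ obtained from two open subsets $V_1,V_2$ of $H$ by identifying the two copies of a point $a\in V_1\cap V_2$. In case (II) the point corresponding to $a$ is called a *conic node* if $a$ is interior to $H$, and a *boundary node* if $a\in\partial H$. A *Klein surface with nodes* is a Hausdorff space $X$ with a closed discrete set $N(X,2)$ of distinguished points (*inessential nodes*), each having a neighbourhood homeomorphic to an open subset of $\mathbb C$, and a maximal atlas of charts with values in $\mathbb C^+$ whose transition maps are dianalytic (locally analytic or antianalytic) away from the nodes. $N(X,1)$, $N(X,3)$ denote its sets of conic and boundary nodes, and $N(X)=N(X,1)\cup N(X,2)\cup N(X,3)$. A *Riemann surface with nodes* is defined likewise with $H=\mathbb C$, analytic transition maps and no distinguished points. The *normalization* $p:\widehat X\to X$ separates the two branches at each conic and each boundary node; $\widehat X$ is a surface without nodes. A *map* $f:X_1\to X_2$ of surfaces with nodes is a continuous map with $f^{-1}(N(X_2,i))\subset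 N(X_1,i)\cup N(X_1,1)$ for $i=1,2,3$ and $f(\partial X_1)\subset\partial X_2$; its *lifting* is the unique continuous $\widehat f:\widehat X_1\to\widehat X_2$ with $p_2\circ\widehat f=f\circ p_1$; $f$ is *complete* if $\widehat f(p_1^{-1}(x))=p_2^{-1}(f(x))$ for all $x$. A *morphism* is a complete map which away from the nodes is analytic (Riemann case), respectively a dianalytic morphism of Klein surfaces, i.e. locally of the form $\phi\circ F$ with $F$ analytic and $\phi(x+iy)=x+i|y|$ (Klein case). It is an *unbranched double cover* if its lifting is one; for a Riemann surface covering a Klein surface this means that $F'\neq0$ in these local forms, that interior points have exactly two preimages and that boundary points have exactly one. A *complex double* of a Klein surface with nodes $X$ is a triple $(Y,\pi,\sigma)$, where $Y$ is a Riemann surface with nodes, $\sigma:Y\to Y$ is an antianalytic involution, and $\pi:Y\to X$ is an unbranched double cover with $\pi\circ\sigma=\pi$ and $\pi(N(Y))=N(X)$. An *isomorphism* $(Y_1,\pi_1,\sigma_1)\to(Y_2,\pi_2,\sigma_2)$ is an isomorphism $f:Y_1\to Y_2$ of Riemann surfaces with nodes with $f\circ\sigma_1=\sigma_2\circ f$ and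 $\pi_2\circ f=\pi_1$. **Construction.** Let $(\widehat X_c,\widehat\pi_c,\widehat\sigma_c)$ be a complex double of the Klein surface $\widehat X$. Form $X_c=\widehat X_c/\!\sim$ by identifying the two points of $\widehat X_c$ over each boundary node and over each inessential node of $X$ and, for each conic node $z$ with $p^{-1}(z)=\{z_1,z_2\}$, the two points $\widehat\pi_c^{-1}(z_1)$ with the two points $\widehat\pi_c^{-1}(z_2)$ by one of the two bijections between these sets. Let $\pi_c:X_c\to X$ and $\sigma_c:X_c\to X_c$ be induced by $p\circ\widehat\pi_c$ and $\widehat\sigma_c$. **Theorem.** Let $X$ be a Klein surface with nodes. Then its normalization $\widehat X$ has a complex double, and for every complex double $(\widehat X_c,\widehat\pi_c,\widehat\sigma_c)$ of $\widehat X$: 1. there are exactly $2^{\#N(X,1)}$ identifications as above; for each of them $\sigma_c$ is well defined and $(X_c,\pi_c,\sigma_c)$ is a complex double of $X$; 2. every complex double $(Y,\pi,\sigma)$ of $X$ is isomorphic to $(X_c,\pi_c,\sigma_c)$ for exactly one of these identifications, and the isomorphism is unique. Consequently isomorphism is an equivalence relation on the complex doubles of $X$ with exactly $2^{\#N(X,1)}$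 classes (as a cardinal number if $N(X,1)$ is infinite), and if $N(X,1)\neq\emptyset$ then $X$ has two non-isomorphic complex doubles. -/

import Mathlib

open Filter Topology Set

universe u

noncomputable section

/-- The two kinds of surfaces: Riemann surfaces with nodes (charts in `ℂ`, analytic transitions)
and Klein surfaces with nodes (charts in `ℂ⁺`, dianalytic transitions). -/
inductive SurfaceKind : Type
  | riemann : SurfaceKind
  | klein : SurfaceKind

/-- The space `ℂ`, resp. `ℂ⁺ = {z | 0 ≤ Im z}`, in which coordinates take their values. -/
def SurfaceKind.model : SurfaceKind → Set ℂ
  | .riemann => Set.univ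
  | .klein => {z : ℂ | 0 ≤ z.im}

/-- Near `x`, the function `s` is an analytic function of the function `t`. At a boundary point of
`ℂ⁺` this means, as usual, that the function extends analytically to a neighbourhood in `ℂ`. -/
def AnalyticRel {X : Type*} [TopologicalSpace X] (t s : X → ℂ) (x : X) : Prop :=
  ∃ F : ℂ → ℂ, AnalyticAt ℂ F (t x) ∧ ∀ᶠ y in 𝓝 x, s y = F (t y)

/-- Near `x`, the function `s` is an antianalytic function of the function `t`. -/
def AntianalyticRel {X : Type*} [TopologicalSpace X] (t s : X → ℂ) (x : X) : Prop :=
  ∃ F : ℂ → ℂ, AnalyticAt ℂ F (t x) ∧ ∀ᶠ y in 𝓝 x, s y = (starRingEnd ℂ) (F (t y))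

/-- The requirement on changes of coordinates: analytic, resp. dianalytic. -/
def SurfaceKind.Rel {X : Type*} [TopologicalSpace X] :
    SurfaceKind → (X → ℂ) → (X → ℂ) → X → Prop
  | .riemann, t, s, x => AnalyticRel t s x
  | .klein, t, s, x => AnalyticRel t s x ∨ AntianalyticRel t s x

/-- Two copies of `H` glued at the point `a`, realised as `H × {a} ∪ {a} × H`. Its open subsets
containing the node `(a, a)` are the spaces `V₁ ⊔_a V₂` with `V₁, V₂` open in `H`. -/
abbrev Wedge (H : Set ℂ) (a : H) : Type := {q : H × H // q.1 = a ∨ q.2 = a}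

def Wedge.node {H : Set ℂ} (a : H) : Wedge H a := ⟨(a, a), Or.inl rfl⟩

/-- The two branches of the wedge, both containing the node. -/
def Wedge.branch {H : Set ℂ} (a : H) : Bool → Set (Wedge H a)
  | true => {q | q.1.2 = a}
  | false => {q | q.1.1 = a}

/-- The coordinate on a wedge: it sends `(z, a)` to `z` and `(a, w)` to `w`. -/
def Wedge.coord {H : Set ℂ} {a : H} (q : Wedge H a) : ℂ := (q.1.1 : ℂ) + (q.1.2 : ℂ) - (a : ℂ)

/-- Charts: homeomorphisms from an open subset of `X` onto an open subset of `H` (type I), or onto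
`V₁ ⊔_a V₂` with `V₁, V₂` open in `H` and `a ∈ V₁ ∩ V₂` (type II). -/
inductive NodalChart (H : Set ℂ) (X : Type u) [TopologicalSpace X] : Type u
  | plane (φ : OpenPartialHomeomorph X H) : NodalChart H X
  | node (a : H) (φ : OpenPartialHomeomorph X (Wedge H a)) (h : Wedge.node a ∈ φ.target) :
      NodalChart H X

namespace NodalChart

variable {H : Set ℂ} {X : Type u} [TopologicalSpace X]

def source : NodalChart H X → Set X
  | plane φ => φ.source
  | node _ φ _ => φ.source

/-- The complex coordinate given by a chart. -/
def coord : NodalChart H X → X → ℂ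
  | plane φ, x => (φ x : ℂ)
  | node _ φ _, x => (φ x).coord

end NodalChart

/-- The data of a surface with nodes of a given kind on the space `X`: a set of charts and the set
of distinguished points. The axioms are in `NodalSurfaceData.IsSurface`. -/
structure NodalSurfaceData (κ : SurfaceKind) (X : Type u) [TopologicalSpace X] : Type u where
  atlas : Set (NodalChart κ.model X)
  distinguished : Set X

namespace NodalSurfaceData

variable {κ : SurfaceKind} {X : Type u} [TopologicalSpace X]

/-- `N(X,1)`: centres of type II charts whose gluing point is interior. -/
def conicNodes (S : NodalSurfaceData κ X) : Set X :=
  {x | ∃ a φ h, NodalChart.node a φ h ∈ S.atlas ∧ (a : ℂ) ∈ interior κ.model ∧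
    φ.symm (Wedge.node a) = x}

/-- `N(X,2)`: the distinguished points. -/
def inessentialNodes (S : NodalSurfaceData κ X) : Set X := S.distinguished

/-- `N(X,3)`: centres of type II charts whose gluing point is on the boundary of the model. -/
def boundaryNodes (S : NodalSurfaceData κ X) : Set X :=
  {x | ∃ a φ h, NodalChart.node a φ h ∈ S.atlas ∧ (a : ℂ) ∉ interior κ.model ∧
    φ.symm (Wedge.node a) = x}

def nodes (S : NodalSurfaceData κ X) : Set X :=
  S.conicNodes ∪ S.inessentialNodes ∪ S.boundaryNodes

def boundary (S : NodalSurfaceData κ X) : Set X :=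
  {x | ∃ c ∈ S.atlas, x ∈ c.source ∧ c.coord x ∉ interior κ.model}

/-- The transition between two charts is analytic, resp. dianalytic, away from the nodes. -/
def Compatible (S : NodalSurfaceData κ X) (c c' : NodalChart κ.model X) : Prop :=
  ∀ x ∈ c.source ∩ c'.source, x ∉ S.nodes →
    κ.Rel c.coord c'.coord x ∧ κ.Rel c'.coord c.coord x

/-- `S` is a Riemann surface with nodes, resp. a Klein surface with nodes. -/
structure IsSurface (S : NodalSurfaceData κ X) : Prop where
  t2 : T2Space X
  covers : ∀ x : X, ∃ c ∈ S.atlas, x ∈ c.source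
  compatible : ∀ c ∈ S.atlas, ∀ c' ∈ S.atlas, S.Compatible c c'
  maximal : ∀ c, (∀ c' ∈ S.atlas, S.Compatible c c') → c ∈ S.atlas
  distinguished_closed : IsClosed S.distinguished
  distinguished_discrete : DiscreteTopology S.distinguished
  /-- distinguished points have a neighbourhood homeomorphic to an open subset of `ℂ` -/
  distinguished_interior : ∀ x ∈ S.distinguished, ∃ φ, NodalChart.plane φ ∈ S.atlas ∧
    x ∈ φ.source ∧ (φ x : ℂ) ∈ interior κ.model
  /-- Riemann surfaces with nodes have no distinguished points -/
  distinguished_riemann : κ = SurfaceKind.riemann → S.distinguished = ∅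

/-- The branches of the surface at `x`, as germs of subsets at `x`: one branch (a whole
neighbourhood) if `x` is not a conic or boundary node, and two branches if it is. -/
def IsBranch (S : NodalSurfaceData κ X) (x : X) (B : Filter X) : Prop :=
  (x ∉ S.conicNodes ∪ S.boundaryNodes ∧ B = 𝓝 x) ∨
  ∃ a φ h i, NodalChart.node a φ h ∈ S.atlas ∧ φ.symm (Wedge.node a) = x ∧
    B = 𝓝[φ.source ∩ φ ⁻¹' Wedge.branch a i] x

/-- The points of the normalization: a point of the surface together with a branch there. -/
def Normalization (S : NodalSurfaceData κ X) : Type u := {q : X × Filter X // S.IsBranch q.1 q.2}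

/-- The projection of the normalization onto the surface. -/
def p (S : NodalSurfaceData κ X) (q : S.Normalization) : X := q.1.1

/-- A set is open if together with `(x, B)` it contains all points lying over `A \ {x}`, for some
subset `A` belonging to the branch `B`. -/
instance (S : NodalSurfaceData κ X) : TopologicalSpace S.Normalization where
  IsOpen O := ∀ q ∈ O, ∀ᶠ y in q.1.2, ∀ r : S.Normalization, S.p r = y → y ≠ S.p q → r ∈ O
  isOpen_univ := fun _ _ => Eventually.of_forall fun _ _ _ _ => trivial
  isOpen_inter := fun _ _ hs ht q hq => by
    filter_upwards [hs q hq.1, ht q hq.2] with y h1 h2 r hr hy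
    exact ⟨h1 r hr hy, h2 r hr hy⟩
  isOpen_sUnion := fun _ hs q hq => by
    obtain ⟨t, ht, hqt⟩ := hq
    filter_upwards [hs t ht q hqt] with y h r hr hy
    exact ⟨t, ht, h r hr hy⟩

/-- The normalization: its charts are the type I charts that are analytically, resp. dianalytically,
compatible with the coordinates of the original charts along the branches. -/
def normalization (S : NodalSurfaceData κ X) : NodalSurfaceData κ S.Normalization where
  atlas := {c | ∃ ψ, c = NodalChart.plane ψ ∧ ∀ q ∈ ψ.source, ∀ d ∈ S.atlas, S.p q ∈ d.source →
    κ.Rel (fun r => d.coord (S.p r)) (fun r => (ψ r : ℂ)) q ∧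
    κ.Rel (fun r => (ψ r : ℂ)) (fun r => d.coord (S.p r)) q}
  distinguished := ∅

end NodalSurfaceData

section Maps

variable {κ κ' : SurfaceKind} {X X' : Type u} [TopologicalSpace X] [TopologicalSpace X']

/-- Maps between surfaces with nodes. -/
structure IsNodalMap (S : NodalSurfaceData κ X) (S' : NodalSurfaceData κ' X') (f : X → X') :
    Prop where
  continuous : Continuous f
  conic : f ⁻¹' S'.conicNodes ⊆ S.conicNodes
  inessential : f ⁻¹' S'.inessentialNodes ⊆ S.inessentialNodes ∪ S.conicNodes
  boundaryNode : f ⁻¹' S'.boundaryNodes ⊆ S.boundaryNodes ∪ S.conicNodes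
  boundary : f '' S.boundary ⊆ S'.boundary

/-- `g` is the lifting of `f` to the normalizations. -/
def IsLifting (S : NodalSurfaceData κ X) (S' : NodalSurfaceData κ' X') (f : X → X')
    (g : S.Normalization → S'.Normalization) : Prop :=
  Continuous g ∧ ∀ q, S'.p (g q) = f (S.p q)

/-- `f`, with lifting `g`, is complete. -/
def IsCompleteLifting (S : NodalSurfaceData κ X) (S' : NodalSurfaceData κ' X') (f : X → X')
    (g : S.Normalization → S'.Normalization) : Prop :=
  ∀ x, g '' (S.p ⁻¹' {x}) = S'.p ⁻¹' {f x}

/-- Analytic maps between Riemann surfaces with nodes. -/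
def IsAnalyticMap (R : NodalSurfaceData .riemann X) (R' : NodalSurfaceData .riemann X')
    (f : X → X') : Prop :=
  IsNodalMap R R' f ∧ ∀ x ∉ R.nodes, ∃ c ∈ R.atlas, ∃ c' ∈ R'.atlas,
    x ∈ c.source ∧ f x ∈ c'.source ∧ AnalyticRel c.coord (fun y => c'.coord (f y)) x

/-- Antianalytic maps between Riemann surfaces with nodes. -/
def IsAntianalyticMap (R : NodalSurfaceData .riemann X) (R' : NodalSurfaceData .riemann X')
    (f : X → X') : Prop :=
  IsNodalMap R R' f ∧ ∀ x ∉ R.nodes, ∃ c ∈ R.atlas, ∃ c' ∈ R'.atlas,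
    x ∈ c.source ∧ f x ∈ c'.source ∧ AntianalyticRel c.coord (fun y => c'.coord (f y)) x

/-- Morphisms of Riemann surfaces with nodes: complete analytic maps. -/
def IsRiemannMorphism (R : NodalSurfaceData .riemann X) (R' : NodalSurfaceData .riemann X')
    (f : X → X') : Prop :=
  IsAnalyticMap R R' f ∧ ∃ g, IsLifting R R' f g ∧ IsCompleteLifting R R' f g

/-- The folding map `x + iy ↦ x + i|y|` of `ℂ` onto `ℂ⁺`. -/
def halfPlaneFold (z : ℂ) : ℂ := ⟨z.re, |z.im|⟩

/-- `f` is a dianalytic morphism into a Klein surface near `x`: in suitable charts it is the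
composition of the folding map with an analytic function (as the folding is invariant under conjugation,
antianalytic functions are included). -/
def IsDianalyticAt (S : NodalSurfaceData κ X) (S' : NodalSurfaceData .klein X') (f : X → X')
    (x : X) : Prop :=
  ∃ c ∈ S.atlas, ∃ c' ∈ S'.atlas, x ∈ c.source ∧ f x ∈ c'.source ∧ ∃ F : ℂ → ℂ,
    AnalyticAt ℂ F (c.coord x) ∧ ∀ᶠ y in 𝓝 x, c'.coord (f y) = halfPlaneFold (F (c.coord y))

/-- The same, with ramification index one at `x`. -/
def IsUnbranchedAt (S : NodalSurfaceData κ X) (S' : NodalSurfaceData .klein X') (f : X → X')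
    (x : X) : Prop :=
  ∃ c ∈ S.atlas, ∃ c' ∈ S'.atlas, x ∈ c.source ∧ f x ∈ c'.source ∧ ∃ F : ℂ → ℂ,
    AnalyticAt ℂ F (c.coord x) ∧ deriv F (c.coord x) ≠ 0 ∧
    ∀ᶠ y in 𝓝 x, c'.coord (f y) = halfPlaneFold (F (c.coord y))

/-- Unbranched double covers of a Klein surface (without nodes) by a Riemann surface (without
nodes). Over the boundary the map is a folding, so a boundary point has one preimage, which counts
twice; any other point has two. -/
structure IsUnbranchedDoubleCover (R : NodalSurfaceData .riemann X)
    (S : NodalSurfaceData .klein X') (f : X → X') : Prop where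
  continuous : Continuous f
  unbranched : ∀ x, IsUnbranchedAt R S f x
  interior_fiber : ∀ z ∉ S.boundary, (f ⁻¹' {z}).encard = 2
  boundary_fiber : ∀ z ∈ S.boundary, (f ⁻¹' {z}).encard = 1

/-- Morphisms from a Riemann surface with nodes to a Klein surface with nodes (complete dianalytic
maps) that are unbranched double covers, i.e. whose lifting is one. -/
def IsNodalUnbranchedDoubleCover (R : NodalSurfaceData .riemann X)
    (S : NodalSurfaceData .klein X') (f : X → X') : Prop :=
  IsNodalMap R S f ∧ (∀ x ∉ R.nodes, IsDianalyticAt R S f x) ∧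
  ∃ g, IsLifting R S f g ∧ IsCompleteLifting R S f g ∧
    IsUnbranchedDoubleCover R.normalization S.normalization g

end Maps

/-- The data `(Y, π, σ)` of a complex double of a surface on `X`. -/
structure DoubleData {X : Type u} [TopologicalSpace X] (S : NodalSurfaceData .klein X) :
    Type (u + 1) where
  Y : Type u
  [top : TopologicalSpace Y]
  surface : NodalSurfaceData .riemann Y
  π : Y → X
  σ : Y → Y

attribute [instance] DoubleData.top

namespace DoubleData

variable {X : Type u} [TopologicalSpace X] {S : NodalSurfaceData .klein X}

/-- The surface `Y` with `σ` is a symmetric Riemann surface with nodes. -/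
def IsSymmetric (W : DoubleData S) : Prop :=
  W.surface.IsSurface ∧ IsAntianalyticMap W.surface W.surface W.σ ∧ ∀ y, W.σ (W.σ y) = y

/-- Complex doubles of a Klein surface (without nodes). -/
structure IsSmoothComplexDouble (W : DoubleData S) : Prop where
  symmetric : W.IsSymmetric
  nodes_empty : W.surface.nodes = ∅
  cover : IsUnbranchedDoubleCover W.surface S W.π
  comp : ∀ y, W.π (W.σ y) = W.π y

/-- Complex doubles of a Klein surface with nodes. -/
structure IsComplexDouble (W : DoubleData S) : Prop where
  symmetric : W.IsSymmetric
  cover : IsNodalUnbranchedDoubleCover W.surface S W.π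
  comp : ∀ y, W.π (W.σ y) = W.π y
  nodes_image : W.π '' W.surface.nodes = S.nodes

/-- Isomorphisms of double covers. -/
structure IsIso (W W' : DoubleData S) (f : W.Y ≃ W'.Y) : Prop where
  morphism : IsRiemannMorphism W.surface W'.surface f
  morphism_symm : IsRiemannMorphism W'.surface W.surface f.symm
  comm : ∀ y, f (W.σ y) = W'.σ (f y)
  proj : ∀ y, W'.π (f y) = W.π y

/-- The admissible identifications on the complex double `(X̂_c, π̂_c, σ̂_c)` of the normalization:
points are only identified over the nodes of `X`; over an inessential or a boundary node all points
(there are two of them) are identified; over a conic node, with preimages `z₁, z₂` in the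
normalization, the points over `z₁` are identified one-to-one with those over `z₂`. -/
structure IsGluing (T : DoubleData S.normalization) (r : Setoid T.Y) : Prop where
  same_image : ∀ a b, r a b → S.p (T.π a) = S.p (T.π b)
  off_nodes : ∀ a b, S.p (T.π a) ∉ S.nodes → r a b → a = b
  two_three : ∀ a b, S.p (T.π a) = S.p (T.π b) →
    S.p (T.π a) ∈ S.inessentialNodes ∪ S.boundaryNodes → r a b
  conic_inj : ∀ a b, S.p (T.π a) ∈ S.conicNodes → r a b → T.π a = T.π b → a = b
  conic_match : ∀ a, S.p (T.π a) ∈ S.conicNodes → ∃ b, T.π b ≠ T.π a ∧ r a b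

/-- The set of admissible identifications. -/
def Gluing (T : DoubleData S.normalization) : Type u := {r : Setoid T.Y // T.IsGluing r}

/-- The triple `(X_c, π_c, σ_c)`, with `X_c` the quotient of `X̂_c` by the identifications (with the
quotient topology); the charts are those in which the projection from `X̂_c` is analytic along
the branches, and `π_c`, `σ_c` are induced by `π̂_c`, `σ̂_c`. -/
def glue (T : DoubleData S.normalization) (g : T.Gluing) : DoubleData S where
  Y := Quotient g.1
  surface :=
    { atlas := {c | ∀ w : T.Y, Quotient.mk g.1 w ∈ c.source → ∀ d ∈ T.surface.atlas,
        w ∈ d.source →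
          AnalyticRel d.coord (fun y => c.coord (Quotient.mk g.1 y)) w ∧
          AnalyticRel (fun y => c.coord (Quotient.mk g.1 y)) d.coord w}
      distinguished := ∅ }
  π := Quotient.lift (fun w => S.p (T.π w)) g.2.same_image
  σ := fun x => Quotient.mk g.1 (T.σ x.out)

end DoubleData

/-- The complex doubles of a Klein surface with nodes. -/
def ComplexDouble {X : Type u} [TopologicalSpace X] (S : NodalSurfaceData .klein X) :
    Type (u + 1) :=
  {W : DoubleData S // W.IsComplexDouble}

/-- Isomorphism of complex doubles. -/
def ComplexDouble.Isomorphic {X : Type u} [TopologicalSpace X] {S : NodalSurfaceData .klein X}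
    (W W' : ComplexDouble S) : Prop :=
  ∃ f, DoubleData.IsIso W.1 W'.1 f

end

/-! A complex double is bookkeeping of local orientations. On a Klein surface without nodes, a point
of the double over an interior point is a choice of one of the two local orientations; over a
boundary point there is nothing to choose. If `c` is a chart below, the function equal to `c` at
positively oriented points and to the conjugate of `c` at the others is an analytic coordinate above
that folds to `c` (`doubleCoord`). Taking oriented points as the definition gives existence
(`OrientedPoint.isSmoothComplexDouble_double`). Since the two points over an interior point carry
opposite orientations, equality of `doubleCoord` matches the points of any two doubles and gives
uniqueness (`IsOrientedDouble.exists_homeomorph`).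

Now let `T` be a complex double of the normalization. Identifying points of `T` in pairs produces a
Riemann surface with nodes whose normalization is again `T` (`IsPairing.homeomorph`), and the
projection and the involution descend, so each admissible identification yields a complex double
(`isComplexDouble_glue`). Conversely, for an arbitrary complex double `W` the lifting to the
normalizations is again an oriented double (`IsComplexDouble.isOrientedDouble`). So the
normalization of `W` is `T`, and `W` is the quotient of `T` by the fibres of a map, which form an
admissible identification (`IsComparison.isGluing_ker`). Two quotients of `T` by the same
identification are isomorphic (`IsQuotientOf.exists_isIso`). An isomorphism over the base is
analytic, hence preserves orientations, hence is forced (`IsIso.apply_p`); this makes both the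
identification and the isomorphism unique.

For the count, inessential and boundary nodes leave no freedom. Over a conic node two conjugate
pairs have to be matched; there are two bijections, both commute with the involution, and the
choices at different nodes are independent (`mk_gluing`).

Two local facts support all this. A punctured neighbourhood of an ordinary point is connected, while
at a node it splits into two connected germs; so the branches at a node do not depend on the chart
(`IsGermConnected.decomposition_unique`). Compatibility of charts is assumed only off the nodes, and
extends across them along each branch by removable singularities, combined with Schwarz reflection
at boundary points (`SurfaceKind.Rel.of_punctured`). -/

open scoped ComplexConjugate

noncomputable section

/-! ### Calculus of analytic and antianalytic dependence between functions. -/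

section RelCalculus

variable {X Y : Type*} [TopologicalSpace X] [TopologicalSpace Y] {s t v : X → ℂ} {x : X}

/-- Complex analyticity is differentiability nearby, and conjugating both source and target
preserves complex differentiability. -/
theorem AnalyticAt.conj_conj' {F : ℂ → ℂ} {z : ℂ} (h : AnalyticAt ℂ F (conj z)) :
    AnalyticAt ℂ (fun w => conj (F (conj w))) z := by
  rw [Complex.analyticAt_iff_eventually_differentiableAt] at h ⊢
  have hc : Tendsto (fun w : ℂ => conj w) (𝓝 z) (𝓝 (conj z)) :=
    Complex.continuous_conj.continuousAt
  filter_upwards [hc.eventually h] with w hw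
  exact differentiableAt_conj_conj_iff.2 hw

namespace AnalyticRel

theorem refl (t : X → ℂ) (x : X) : AnalyticRel t t x :=
  ⟨id, analyticAt_id, Eventually.of_forall fun _ => rfl⟩

theorem trans (h : AnalyticRel t s x) (h' : AnalyticRel s v x) : AnalyticRel t v x := by
  obtain ⟨F, hF, hs⟩ := h
  obtain ⟨G, hG, hv⟩ := h'
  refine ⟨G ∘ F, AnalyticAt.comp (hs.self_of_nhds ▸ hG) hF, ?_⟩
  filter_upwards [hs, hv] with y h1 h2
  simp [h2, h1]

theorem conj_conj (h : AnalyticRel t s x) :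
    AnalyticRel (fun y => conj (t y)) (fun y => conj (s y)) x := by
  obtain ⟨F, hF, hs⟩ := h
  refine ⟨fun w => conj (F (conj w)), AnalyticAt.conj_conj' (by simpa using hF), ?_⟩
  filter_upwards [hs] with y h1
  simp [h1]

theorem congr {t' s' : X → ℂ} (h : AnalyticRel t s x) (ht : t =ᶠ[𝓝 x] t') (hs : s =ᶠ[𝓝 x] s') :
    AnalyticRel t' s' x := by
  obtain ⟨F, hF, h⟩ := h
  refine ⟨F, ht.self_of_nhds ▸ hF, ?_⟩
  filter_upwards [h, ht, hs] with y h1 h2 h3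
  rw [← h3, ← h2, h1]

theorem comp {f : Y → X} {y : Y} (h : AnalyticRel t s (f y)) (hf : ContinuousAt f y) :
    AnalyticRel (fun y => t (f y)) (fun y => s (f y)) y := by
  obtain ⟨F, hF, h⟩ := h
  exact ⟨F, hF, hf.eventually h⟩

/-- Analytic dependence is an open condition; this is what makes orientation a locally constant
property. -/
theorem eventually (h : AnalyticRel t s x) (ht : ContinuousAt t x) :
    ∀ᶠ y in 𝓝 x, AnalyticRel t s y := by
  obtain ⟨F, hF, h⟩ := h
  filter_upwards [ht.eventually hF.eventually_analyticAt, h.eventually_nhds] with y h1 h2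
  exact ⟨F, h1, h2⟩

theorem continuousAt (h : AnalyticRel t s x) (ht : ContinuousAt t x) : ContinuousAt s x := by
  obtain ⟨F, hF, h⟩ := h
  exact (ContinuousAt.comp (g := F) hF.continuousAt ht).congr (h.mono fun _ hy => hy.symm)

end AnalyticRel

/-- Reduces the antianalytic calculus to the analytic one. -/
theorem antianalyticRel_iff : AntianalyticRel t s x ↔ AnalyticRel t (fun y => conj (s y)) x := by
  constructor <;> rintro ⟨F, hF, h⟩ <;> refine ⟨F, hF, ?_⟩ <;> filter_upwards [h] with y hy
  · simp [hy]
  · simp [← hy]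

theorem antianalyticRel_conj_iff :
    AntianalyticRel t (fun y => conj (s y)) x ↔ AnalyticRel t s x := by
  rw [antianalyticRel_iff]; simp

theorem AnalyticRel.trans_anti (h : AnalyticRel t s x) (h' : AntianalyticRel s v x) :
    AntianalyticRel t v x :=
  antianalyticRel_iff.2 (h.trans (antianalyticRel_iff.1 h'))

theorem AntianalyticRel.trans (h : AntianalyticRel t s x) (h' : AnalyticRel s v x) :
    AntianalyticRel t v x :=
  antianalyticRel_iff.2 ((antianalyticRel_iff.1 h).trans h'.conj_conj)

theorem AntianalyticRel.trans_anti (h : AntianalyticRel t s x) (h' : AntianalyticRel s v x) :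
    AnalyticRel t v x := by
  simpa using (antianalyticRel_iff.1 h).trans (antianalyticRel_iff.1 h').conj_conj

theorem AntianalyticRel.congr {t' s' : X → ℂ} (h : AntianalyticRel t s x) (ht : t =ᶠ[𝓝 x] t')
    (hs : s =ᶠ[𝓝 x] s') : AntianalyticRel t' s' x :=
  antianalyticRel_iff.2 ((antianalyticRel_iff.1 h).congr ht (hs.fun_comp _))

theorem AntianalyticRel.comp {f : Y → X} {y : Y} (h : AntianalyticRel t s (f y))
    (hf : ContinuousAt f y) : AntianalyticRel (fun y => t (f y)) (fun y => s (f y)) y := by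
  obtain ⟨F, hF, h⟩ := h
  exact ⟨F, hF, hf.eventually h⟩

theorem AntianalyticRel.eventually (h : AntianalyticRel t s x) (ht : ContinuousAt t x) :
    ∀ᶠ y in 𝓝 x, AntianalyticRel t s y :=
  ((antianalyticRel_iff.1 h).eventually ht).mono fun _ => antianalyticRel_iff.2

namespace SurfaceKind.Rel

variable {κ : SurfaceKind}

theorem trans (h : κ.Rel t s x) (h' : κ.Rel s v x) : κ.Rel t v x := by
  cases κ
  · exact AnalyticRel.trans h h'
  · rcases h with h | h <;> rcases h' with h' | h'
    exacts [Or.inl (h.trans h'), Or.inr (h.trans_anti h'), Or.inr (h.trans h'),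
      Or.inl (h.trans_anti h')]

theorem congr {t' s' : X → ℂ} (h : κ.Rel t s x) (ht : t =ᶠ[𝓝 x] t') (hs : s =ᶠ[𝓝 x] s') :
    κ.Rel t' s' x := by
  cases κ
  · exact AnalyticRel.congr h ht hs
  · exact h.imp (fun h => h.congr ht hs) fun h => h.congr ht hs

theorem comp {f : Y → X} {y : Y} (h : κ.Rel t s (f y)) (hf : ContinuousAt f y) :
    κ.Rel (fun y => t (f y)) (fun y => s (f y)) y := by
  cases κ
  · exact AnalyticRel.comp h hf
  · exact h.imp (fun h => h.comp hf) fun h => h.comp hf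

end SurfaceKind.Rel

end RelCalculus

/-! ### Coordinates as injective functions that carry neighbourhood filters to neighbourhood filters
of the model. -/

section Coordinates

variable {X Y : Type*} [TopologicalSpace X] [TopologicalSpace Y] {H : Set ℂ} {s t : X → ℂ} {x : X}

/-- `s` is a coordinate on the open set `U`: an open embedding of `U` into `H`. -/
structure IsCoordOn (H : Set ℂ) (s : X → ℂ) (U : Set X) : Prop where
  isOpen : IsOpen U
  injOn : InjOn s U
  map_nhds : ∀ x ∈ U, map s (𝓝 x) = 𝓝[H] (s x)

/-- `s` is a coordinate on some neighbourhood of `x`. -/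
def IsCoordAt (H : Set ℂ) (s : X → ℂ) (x : X) : Prop := ∃ U, x ∈ U ∧ IsCoordOn H s U

theorem IsCoordOn.isCoordAt {U : Set X} (h : IsCoordOn H s U) (hx : x ∈ U) : IsCoordAt H s x :=
  ⟨U, hx, h⟩

theorem IsCoordOn.mono {U V : Set X} (h : IsCoordOn H s U) (hV : IsOpen V) (hVU : V ⊆ U) :
    IsCoordOn H s V :=
  ⟨hV, h.injOn.mono hVU, fun x hx => h.map_nhds x (hVU hx)⟩

namespace IsCoordAt

theorem map_nhds (h : IsCoordAt H s x) : map s (𝓝 x) = 𝓝[H] (s x) := by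
  obtain ⟨U, hx, hU⟩ := h
  exact hU.map_nhds x hx

theorem continuousAt (h : IsCoordAt H s x) : ContinuousAt s x :=
  (h.map_nhds.le.trans nhdsWithin_le_nhds : Tendsto s (𝓝 x) (𝓝 (s x)))

theorem mem (h : IsCoordAt H s x) : s x ∈ H := by
  have h1 : ∀ᶠ y in 𝓝 x, s y ∈ H := by
    have : H ∈ map s (𝓝 x) := h.map_nhds ▸ self_mem_nhdsWithin
    exact this
  exact h1.self_of_nhds

theorem eventually (h : IsCoordAt H s x) : ∀ᶠ y in 𝓝 x, IsCoordAt H s y := by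
  obtain ⟨U, hx, hU⟩ := h
  filter_upwards [hU.isOpen.mem_nhds hx] with y hy using ⟨U, hy, hU⟩

theorem eventually_ne (h : IsCoordAt H s x) : ∀ᶠ y in 𝓝[≠] x, s y ≠ s x := by
  obtain ⟨U, hx, hU⟩ := h
  filter_upwards [nhdsWithin_le_nhds (hU.isOpen.mem_nhds hx), self_mem_nhdsWithin] with y hy hne he
  exact hne (hU.injOn hy hx he)

/-- A local inverse of a coordinate. -/
theorem exists_inverse (h : IsCoordAt H s x) : ∃ j : ℂ → X, j (s x) = x ∧
    (∀ᶠ y in 𝓝 x, j (s y) = y) ∧ (∀ᶠ z in 𝓝[H] (s x), s (j z) = z) ∧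
    (∀ᶠ z in 𝓝[H] (s x), map j (𝓝[H] z) = 𝓝 (j z)) := by
  obtain ⟨U, hx, hU⟩ := h
  have : Nonempty X := ⟨x⟩
  have hj : ∀ y ∈ U, Function.invFunOn s U (s y) = y := fun y hy =>
    hU.injOn.leftInvOn_invFunOn hy
  have hm : ∀ y ∈ U, map (Function.invFunOn s U) (𝓝[H] (s y)) = 𝓝 y := fun y hy => by
    rw [← hU.map_nhds y hy, map_map]
    have : Function.invFunOn s U ∘ s =ᶠ[𝓝 y] id :=
      mem_of_superset (hU.isOpen.mem_nhds hy) hj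
    rw [map_congr this, map_id]
  have him : s '' U ∈ 𝓝[H] (s x) := by
    rw [← hU.map_nhds x hx]; exact image_mem_map (hU.isOpen.mem_nhds hx)
  refine ⟨Function.invFunOn s U, hj x hx, mem_of_superset (hU.isOpen.mem_nhds hx) hj, ?_, ?_⟩
  · filter_upwards [him]
    rintro _ ⟨y, hy, rfl⟩
    rw [hj y hy]
  · filter_upwards [him]
    rintro _ ⟨y, hy, rfl⟩
    rw [hm y hy, hj y hy]

theorem tendsto_nhdsNE (h : IsCoordAt H s x) : Tendsto s (𝓝[≠] x) (𝓝[H \ {s x}] (s x)) := by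
  refine tendsto_nhdsWithin_iff.2 ⟨h.continuousAt.mono_left nhdsWithin_le_nhds, ?_⟩
  filter_upwards [h.eventually_ne, nhdsWithin_le_nhds h.eventually] with y h1 h2
  exact ⟨h2.mem, h1⟩

/-- Lets statements about punctured neighbourhoods of `x` be proved in the punctured model. -/
theorem map_inverse_nhdsNE (h : IsCoordAt H s x) {j : ℂ → X} (hj1 : ∀ᶠ y in 𝓝 x, j (s y) = y)
    (hj2 : ∀ᶠ z in 𝓝[H] (s x), s (j z) = z) (hj3 : map j (𝓝[H] (s x)) = 𝓝 x) :
    map j (𝓝[H \ {s x}] (s x)) = 𝓝[≠] x := by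
  apply le_antisymm
  · refine tendsto_nhdsWithin_iff.2 ⟨?_, ?_⟩
    · exact (map_mono (nhdsWithin_mono _ sdiff_subset)).trans hj3.le
    · filter_upwards [nhdsWithin_mono _ sdiff_subset hj2, self_mem_nhdsWithin] with z h1 h2 h3
      rw [mem_singleton_iff] at h3
      exact h2.2 (by rw [← h1, h3]; rfl)
  · have : map j (map s (𝓝[≠] x)) = 𝓝[≠] x := by
      rw [map_map]
      have : j ∘ s =ᶠ[𝓝[≠] x] id := nhdsWithin_le_nhds hj1
      rw [map_congr this, map_id]
    rw [← this]
    exact map_mono h.tendsto_nhdsNE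

end IsCoordAt

/-- Injectivity and the filter equality, which says continuous and open at once, are all that a
chart requires. Plane charts and charts at nodes are both built from this. -/
theorem exists_openPartialHomeomorph [Nonempty X] (f : X → Y) {U : Set X} (hU : IsOpen U)
    (hf : InjOn f U) (hmap : ∀ x ∈ U, map f (𝓝 x) = 𝓝 (f x)) :
    ∃ φ : OpenPartialHomeomorph X Y, φ.source = U ∧ ∀ x, φ x = f x := by
  refine ⟨{ toPartialEquiv := hf.toPartialEquiv f U, open_source := hU, open_target := ?_,
            continuousOn_toFun := ?_, continuousOn_invFun := ?_ }, rfl, fun x => rfl⟩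
  · intro x hx
    have : Tendsto f (𝓝 x) (𝓝 (f x)) := (hmap x hx).le
    exact this.mono_left nhdsWithin_le_nhds
  · rintro _ ⟨x, hx, rfl⟩
    refine Tendsto.mono_left ?_ nhdsWithin_le_nhds
    change Tendsto (Function.invFunOn f U) (𝓝 (f x)) (𝓝 (Function.invFunOn f U (f x)))
    rw [← hmap x hx, hf.leftInvOn_invFunOn hx, tendsto_map'_iff]
    refine tendsto_id.congr' (mem_of_superset (hU.mem_nhds hx) fun y hy => ?_)
    exact (hf.leftInvOn_invFunOn hy).symm
  · change IsOpen (f '' U)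
    rw [isOpen_iff_mem_nhds]
    rintro _ ⟨x, hx, rfl⟩
    rw [← hmap x hx]
    exact image_mem_map (hU.mem_nhds hx)

theorem IsCoordOn.exists_chart {U : Set X} (h : IsCoordOn H s U) (hx : x ∈ U) :
    ∃ φ : OpenPartialHomeomorph X H, φ.source = U ∧ ∀ y ∈ U, (φ y : ℂ) = s y := by
  classical
  have : Nonempty X := ⟨x⟩
  -- On `U` the values of `s` lie in `H`; elsewhere any point of `H` will do, and `s x` is at hand.
  let f : X → H := fun y => if hy : s y ∈ H then ⟨s y, hy⟩ else ⟨s x, (h.isCoordAt hx).mem⟩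
  have hf : ∀ y ∈ U, (f y : ℂ) = s y := fun y hy => by
    simp only [f, dif_pos (h.isCoordAt hy).mem]
  obtain ⟨φ, h1, h2⟩ := exists_openPartialHomeomorph f h.isOpen
    (fun y hy z hz hyz => h.injOn hy hz (by rw [← hf y hy, ← hf z hz, hyz])) fun y hy => by
      apply map_injective Subtype.val_injective
      rw [map_map, map_nhds_subtype_val, hf y hy, ← h.map_nhds y hy]
      exact map_congr (mem_of_superset (h.isOpen.mem_nhds hy) hf)
  exact ⟨φ, h1, fun y hy => by rw [h2, hf y hy]⟩

theorem OpenPartialHomeomorph.isCoordOn (φ : OpenPartialHomeomorph X H) :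
    IsCoordOn H (fun x => (φ x : ℂ)) φ.source := by
  refine ⟨φ.open_source, fun x hx y hy h => φ.injOn hx hy (Subtype.ext h), fun x hx => ?_⟩
  rw [← map_nhds_subtype_val, ← φ.map_nhds_eq hx, map_map]
  rfl

/-- Properties that are locally constant near the filter are eventually constant. -/
def IsGermConnected (F : Filter X) : Prop :=
  ∀ P : X → Prop, (∀ᶠ y in F, (∀ᶠ z in 𝓝 y, P z) ∨ ∀ᶠ z in 𝓝 y, ¬ P z) →
    (∀ᶠ y in F, P y) ∨ ∀ᶠ y in F, ¬ P y

end Coordinates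

/-! ### Connectedness of punctured neighbourhoods in the plane and the half plane. -/

section Model

variable {κ : SurfaceKind} {a : ℂ}

theorem SurfaceKind.interior_riemann : interior SurfaceKind.riemann.model = univ := interior_univ

theorem SurfaceKind.interior_klein : interior SurfaceKind.klein.model = {z : ℂ | 0 < z.im} :=
  Complex.interior_setOfPred_le_im 0

/-- A vertical segment reaches `a` through interior points in either model, even when `a` is a
boundary point. It shows that the punctured filters are nontrivial. -/
theorem SurfaceKind.tendsto_up (ha : a ∈ κ.model) :
    Tendsto (fun r : ℝ => a + r * Complex.I) (𝓝[>] 0) (𝓝[interior κ.model \ {a}] a) := by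
  refine tendsto_nhdsWithin_iff.2 ⟨?_, ?_⟩
  · have : ContinuousAt (fun r : ℝ => a + r * Complex.I) 0 := by fun_prop
    have h := this.tendsto
    simp only [Complex.ofReal_zero, zero_mul, add_zero] at h
    exact h.mono_left nhdsWithin_le_nhds
  · filter_upwards [self_mem_nhdsWithin] with r hr
    have hr' : (0 : ℝ) < r := hr
    refine ⟨?_, ?_⟩
    · cases κ
      · simp [SurfaceKind.interior_riemann]
      · rw [SurfaceKind.interior_klein]
        have : 0 ≤ a.im := ha
        simp only [mem_ofPred_eq, Complex.add_im, Complex.mul_im, Complex.ofReal_re, Complex.I_im,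
          Complex.ofReal_im, Complex.I_re]
        linarith
    · simp [hr'.ne']

theorem SurfaceKind.neBot_interior (ha : a ∈ κ.model) : (𝓝[interior κ.model \ {a}] a).NeBot :=
  (SurfaceKind.tendsto_up ha).neBot

theorem SurfaceKind.neBot_diff (ha : a ∈ κ.model) : (𝓝[κ.model \ {a}] a).NeBot :=
  (SurfaceKind.neBot_interior ha).mono (nhdsWithin_mono _ (sdiff_subset_sdiff_left interior_subset))

/-- Polar coordinates present the punctured disc as a continuous image of a product of two connected
sets. -/
theorem isPreconnected_ball_diff_center (a : ℂ) (ε : ℝ) :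
    IsPreconnected (Metric.ball a ε \ {a}) := by
  have h : Metric.ball a ε \ {a} = (fun q : ℝ × ℝ => a + q.1 * Complex.exp (q.2 * Complex.I)) ''
      (Ioo 0 ε ×ˢ univ) := by
    ext z
    constructor
    · rintro ⟨h1, h2⟩
      refine ⟨(‖z - a‖, Complex.arg (z - a)), ⟨⟨?_, ?_⟩, trivial⟩, ?_⟩
      · exact norm_pos_iff.2 (sub_ne_zero.2 h2)
      · simpa [dist_eq_norm] using h1
      · simp [Complex.norm_mul_exp_arg_mul_I]
    · rintro ⟨⟨r, θ⟩, ⟨⟨h1, h2⟩, -⟩, rfl⟩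
      have h1 : 0 < r := h1
      have h2 : r < ε := h2
      refine ⟨?_, ?_⟩
      · simp [Complex.norm_exp_ofReal_mul_I, abs_of_pos h1, h2]
      · simp [h1.ne']
  rw [h]
  refine IsPreconnected.image ?_ _ (by fun_prop)
  exact isPreconnected_Ioo.prod isPreconnected_univ

/-- The open half disc is convex, and adding points of its closure keeps a set connected. -/
theorem isPreconnected_half_ball_diff_center (ha : a.im = 0) (ε : ℝ) :
    IsPreconnected (Metric.ball a ε ∩ ({z : ℂ | 0 ≤ z.im} \ {a})) := by
  have hc : IsPreconnected (Metric.ball a ε ∩ {z : ℂ | 0 < z.im}) :=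
    ((convex_ball a ε).inter (convex_halfSpace_im_gt 0)).isPreconnected
  refine hc.subset_closure ?_ ?_
  · rintro z ⟨h1, h2⟩
    have h2 : 0 < z.im := h2
    refine ⟨h1, h2.le, ?_⟩
    rintro rfl
    exact h2.ne' ha
  · rintro z ⟨h1, h2, -⟩
    have ht := SurfaceKind.tendsto_up (κ := .klein) (a := z) h2
    refine mem_closure_of_tendsto (ht.mono_right nhdsWithin_le_nhds) ?_
    filter_upwards [ht.eventually (nhdsWithin_le_nhds (Metric.isOpen_ball.mem_nhds h1)),
      ht.eventually self_mem_nhdsWithin] with r h3 h4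
    refine ⟨h3, ?_⟩
    have := h4.1
    rwa [SurfaceKind.interior_klein] at this

/-- A punctured disc at interior points, a punctured half disc at boundary points. All smaller radii
are included because the radius is shrunk again when a property is tested. -/
theorem SurfaceKind.exists_isPreconnected (ha : a ∈ κ.model) :
    ∃ ε > 0, ∀ δ ≤ ε, IsPreconnected (Metric.ball a δ ∩ (κ.model \ {a})) := by
  by_cases hi : a ∈ interior κ.model
  · obtain ⟨ε, hε, h⟩ := Metric.mem_nhds_iff.1 (mem_interior_iff_mem_nhds.1 hi)
    refine ⟨ε, hε, fun δ hδ => ?_⟩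
    convert isPreconnected_ball_diff_center a δ using 1
    ext z
    have : z ∈ Metric.ball a δ → z ∈ κ.model := fun hz => h (Metric.ball_subset_ball hδ hz)
    simp only [mem_inter_iff, Set.mem_sdiff]
    tauto
  · cases κ
    · simp [SurfaceKind.interior_riemann] at hi
    · refine ⟨1, one_pos, fun δ _ => isPreconnected_half_ball_diff_center ?_ δ⟩
      rw [SurfaceKind.interior_klein] at hi
      have : 0 ≤ a.im := ha
      exact le_antisymm (not_lt.1 hi) this

/-- Punctured neighbourhoods in the model are connected. -/
theorem SurfaceKind.eventually_const (ha : a ∈ κ.model) {P : ℂ → Prop}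
    (h : ∀ᶠ z in 𝓝[κ.model \ {a}] a,
      (∀ᶠ z' in 𝓝[κ.model] z, P z') ∨ ∀ᶠ z' in 𝓝[κ.model] z, ¬ P z') :
    (∀ᶠ z in 𝓝[κ.model \ {a}] a, P z) ∨ ∀ᶠ z in 𝓝[κ.model \ {a}] a, ¬ P z := by
  classical
  obtain ⟨ε, hε, hc⟩ := SurfaceKind.exists_isPreconnected ha
  obtain ⟨δ, hδ, hd⟩ := Metric.mem_nhdsWithin_iff.1 h
  have hS := hc (min ε δ) (min_le_left _ _)
  set S := Metric.ball a (min ε δ) ∩ (κ.model \ {a}) with hSdef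
  have hSmem : S ∈ 𝓝[κ.model \ {a}] a :=
    inter_mem (nhdsWithin_le_nhds (Metric.ball_mem_nhds a (lt_min hε hδ))) self_mem_nhdsWithin
  -- A locally constant property is a continuous map to a discrete space, hence constant on the
  -- connected set `S`.
  have hcont : ContinuousOn (fun z => decide (P z)) S := by
    intro z hz
    have hz' := hd ⟨Metric.ball_subset_ball (min_le_right _ _) hz.1, hz.2⟩
    have hle : 𝓝[S] z ≤ 𝓝[κ.model] z := nhdsWithin_mono _ fun w hw => hw.2.1
    have hev : ∀ᶠ w in 𝓝[S] z, decide (P w) = decide (P z) := by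
      rcases hz' with h' | h'
      · have h0 : P z := h'.self_of_nhdsWithin hz.2.1
        filter_upwards [hle h'] with w hw
        simp [h0, show P w from hw]
      · have h0 : ¬ P z := h'.self_of_nhdsWithin hz.2.1
        filter_upwards [hle h'] with w hw
        simp [h0, show ¬ P w from hw]
    exact tendsto_const_nhds.congr' (hev.mono fun _ hw => hw.symm)
  by_cases hP : ∃ z ∈ S, P z
  · obtain ⟨z, hz, hPz⟩ := hP
    left
    filter_upwards [hSmem] with w hw
    have := hS.constant hcont hw hz
    simpa [hPz] using this
  · right
    push Not at hP
    filter_upwards [hSmem] with w hw using hP w hw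

/-- Connectedness of the punctured model, carried over by a local inverse. It distinguishes ordinary
points from nodes, and prevents a transition from changing between analytic and antianalytic around
a point. -/
theorem IsCoordAt.isGermConnected {X : Type*} [TopologicalSpace X] {s : X → ℂ} {x : X}
    (h : IsCoordAt κ.model s x) : IsGermConnected (𝓝[≠] x) := by
  intro P hP
  obtain ⟨j, hjx, hj1, hj2, hj3⟩ := h.exists_inverse
  have hm := h.map_inverse_nhdsNE hj1 hj2 (by rw [hj3.self_of_nhdsWithin h.mem, hjx])
  rw [← hm] at hP ⊢
  simp only [eventually_map] at hP ⊢
  apply SurfaceKind.eventually_const h.mem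
  filter_upwards [hP, nhdsWithin_mono _ sdiff_subset hj3] with z h1 h2
  have h2' : Tendsto j (𝓝[κ.model] z) (𝓝 (j z)) := h2.le
  exact h1.imp (fun h => h2'.eventually h) fun h => h2'.eventually h

theorem IsCoordAt.neBot_nhdsNE {X : Type*} [TopologicalSpace X] {s : X → ℂ} {x : X}
    (h : IsCoordAt κ.model s x) : (𝓝[≠] x).NeBot := by
  obtain ⟨j, hjx, hj1, hj2, hj3⟩ := h.exists_inverse
  rw [← h.map_inverse_nhdsNE hj1 hj2 (by rw [hj3.self_of_nhdsWithin h.mem, hjx])]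
  exact (SurfaceKind.neBot_diff h.mem).map j

end Model
end

noncomputable section

/-! ### Reflection, removable singularities and invertibility for functions of a coordinate. -/

section ComplexAnalysis

variable {κ : SurfaceKind} {X : Type*} [TopologicalSpace X] {s t : X → ℂ} {x : X}

/-- The real derivative of conjugation is conjugation, which is not complex linear, as its values at
`1` and `I` show. -/
theorem Complex.not_differentiableAt_conj (z : ℂ) :
    ¬ DifferentiableAt ℂ (fun w : ℂ => conj w) z := by
  intro h
  have h1 : HasFDerivAt (fun w : ℂ => conj w)
      ((fderiv ℂ (fun w : ℂ => conj w) z).restrictScalars ℝ) z :=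
    h.hasFDerivAt.restrictScalars ℝ
  have h2 : HasFDerivAt (fun w : ℂ => conj w) (Complex.conjCLE : ℂ →L[ℝ] ℂ) z :=
    Complex.conjCLE.hasFDerivAt
  have h3 := h1.unique h2
  have e1 : fderiv ℂ (fun w : ℂ => conj w) z 1 = 1 := by
    simpa using DFunLike.congr_fun h3 1
  have e2 : fderiv ℂ (fun w : ℂ => conj w) z Complex.I = -Complex.I := by
    simpa using DFunLike.congr_fun h3 Complex.I
  have e3 : fderiv ℂ (fun w : ℂ => conj w) z Complex.I = Complex.I := by
    have := (fderiv ℂ (fun w : ℂ => conj w) z).map_smul Complex.I 1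
    simpa [e1] using this
  rw [e3] at e2
  have := congrArg Complex.im e2
  norm_num at this

/-- A coordinate is not an antianalytic function of itself. -/
theorem IsCoordAt.not_antianalyticRel_self (hs : IsCoordAt κ.model s x) :
    ¬ AntianalyticRel s s x := by
  rintro ⟨F, hF, h⟩
  have h1 : ∀ᶠ z in 𝓝[κ.model] (s x), z = conj (F z) := by
    rw [← hs.map_nhds]; exact h
  have hle : 𝓝[interior κ.model \ {s x}] (s x) ≤ 𝓝[interior κ.model] (s x) :=
    nhdsWithin_mono _ sdiff_subset
  -- At a boundary point the identity is known on one side only, so it is moved to nearby interior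
  -- points, where it holds on full neighbourhoods.
  have h2 : ∀ᶠ z in 𝓝[interior κ.model \ {s x}] (s x), ∀ᶠ z' in 𝓝 z, z' = conj (F z') := by
    have := eventually_eventually_nhdsWithin.2
      (nhdsWithin_mono (s x) (interior_subset (s := κ.model)) h1)
    filter_upwards [hle this, hle self_mem_nhdsWithin] with z hz hzi
    rwa [isOpen_interior.nhdsWithin_eq hzi] at hz
  have := SurfaceKind.neBot_interior hs.mem
  obtain ⟨z, hz1, hz2⟩ := (h2.and (nhdsWithin_le_nhds hF.eventually_analyticAt)).exists
  refine Complex.not_differentiableAt_conj z ?_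
  refine hz2.differentiableAt.congr_of_eventuallyEq ?_
  filter_upwards [hz1] with w hw
  conv_lhs => rw [hw]
  simp

/-- Composing with the dependence of `s` on `t`, of either type, with the relation of the suitable
parity would make `s` antianalytic in itself. -/
theorem IsCoordAt.not_analytic_and_antianalytic (hs : IsCoordAt κ.model s x)
    (hts : AnalyticRel t s x ∨ AntianalyticRel t s x) (h : AnalyticRel s t x) :
    ¬ AntianalyticRel s t x := by
  intro h'
  rcases hts with hts | hts
  · exact hs.not_antianalyticRel_self (h'.trans hts)
  · exact hs.not_antianalyticRel_self (h.trans_anti hts)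

/-- The inverse of an analytic change of coordinates cannot be antianalytic, or the composition
would make `s` antianalytic in itself. -/
theorem AnalyticRel.symm_of_rel (h : AnalyticRel s t x) (hs : IsCoordAt κ.model s x)
    (h' : κ.Rel t s x) : AnalyticRel t s x := by
  cases κ
  · exact h'
  · rcases h' with h' | h'
    · exact h'
    · exact (hs.not_antianalyticRel_self (h.trans_anti h')).elim

theorem AntianalyticRel.symm_of_rel (h : AntianalyticRel s t x) (hs : IsCoordAt κ.model s x)
    (h' : κ.Rel t s x) : AntianalyticRel t s x := by
  cases κ
  · exact (hs.not_antianalyticRel_self (h.trans h')).elim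
  · rcases h' with h' | h'
    · exact (hs.not_antianalyticRel_self (h.trans h')).elim
    · exact h'

/-- Open mapping theorem: the analytic function is locally constant or open at the point, and `hne`
excludes the former. The filter `N` is left free so that conjugates of half plane neighbourhoods are
also covered. -/
theorem AnalyticRel.mem_interior_of_map {v : X → ℂ} (hs : IsCoordAt κ.model s x)
    (hi : s x ∈ interior κ.model) (h : AnalyticRel s v x) {N : Filter ℂ}
    (hN : map v (𝓝 x) = N) (hne : ¬ N ≤ pure (v x)) : 𝓝 (v x) ≤ N := by
  obtain ⟨F, hF, h⟩ := h
  have hs' : map s (𝓝 x) = 𝓝 (s x) := by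
    rw [hs.map_nhds, nhdsWithin_eq_nhds.2 (mem_interior_iff_mem_nhds.1 hi)]
  have hm : map F (𝓝 (s x)) = N := by
    rw [← hs', map_map, ← hN]
    exact map_congr (h.mono fun y hy => hy.symm)
  have hv : v x = F (s x) := h.self_of_nhds
  rcases hF.eventually_constant_or_nhds_le_map_nhds with hc | hc
  · refine (hne ?_).elim
    rw [← hm, hv]
    exact tendsto_pure.2 hc
  · rwa [hm, ← hv] at hc

/-- Changes of coordinates preserve interior points. -/
theorem SurfaceKind.Rel.mem_interior (h : κ.Rel s t x) (hs : IsCoordAt κ.model s x)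
    (ht : IsCoordAt κ.model t x) (hi : s x ∈ interior κ.model) : t x ∈ interior κ.model := by
  cases κ
  · simp [SurfaceKind.interior_riemann]
  have hnb := SurfaceKind.neBot_diff ht.mem
  have hne : ¬ 𝓝[SurfaceKind.klein.model] (t x) ≤ pure (t x) := by
    intro hle
    have h1 : ∀ᶠ z in 𝓝[SurfaceKind.klein.model \ {t x}] (t x), z = t x :=
      (nhdsWithin_mono _ sdiff_subset).trans hle (mem_pure.2 rfl)
    obtain ⟨z, hz, hz'⟩ := (h1.and self_mem_nhdsWithin).exists
    exact hz'.2 hz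
  have key : 𝓝 (t x) ≤ 𝓝[SurfaceKind.klein.model] (t x) := by
    rcases h with h | h
    · exact h.mem_interior_of_map hs hi ht.map_nhds hne
    · have hcc : ∀ N : Filter ℂ, map (fun z : ℂ => conj z) (map (fun z : ℂ => conj z) N) = N := by
        intro N
        rw [map_map]
        have : (fun z : ℂ => conj z) ∘ (fun z : ℂ => conj z) = id := by funext z; simp
        rw [this, map_id]
      have h2 := (antianalyticRel_iff.1 h).mem_interior_of_map hs hi
        (N := map (fun z : ℂ => conj z) (𝓝[SurfaceKind.klein.model] (t x)))
        (by rw [← ht.map_nhds, map_map]; rfl) (fun hle => hne (by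
          have := map_mono (m := fun z : ℂ => conj z) hle
          rwa [hcc, map_pure, Complex.conj_conj] at this))
      have h3 := map_mono (m := fun z : ℂ => conj z) h2
      rw [hcc] at h3
      have h4 : map (fun z : ℂ => conj z) (𝓝 (conj (t x))) = 𝓝 (t x) := by
        have := Homeomorph.map_nhds_eq Complex.conjCLE.toHomeomorph (conj (t x))
        have e : Complex.conjCLE.toHomeomorph (conj (t x)) = t x := Complex.conj_conj _
        rwa [e] at this
      rwa [h4] at h3
  exact mem_interior_iff_mem_nhds.2 (key self_mem_nhdsWithin)

/-- A function that is real on the reals commutes with conjugation. -/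
theorem AnalyticAt.eventually_conj {F : ℂ → ℂ} {a : ℂ} (hF : AnalyticAt ℂ F a) (ha : a.im = 0)
    (hr : ∀ᶠ z in 𝓝[SurfaceKind.klein.model] a, z.im = 0 → (F z).im = 0) :
    ∀ᶠ z in 𝓝 a, F (conj z) = conj (F z) := by
  have hca : conj a = a := Complex.conj_eq_iff_im.2 ha
  have hG : AnalyticAt ℂ (fun w => conj (F (conj w))) a := AnalyticAt.conj_conj' (by rwa [hca])
  have htend : Tendsto (fun r : ℝ => a + r) (𝓝[≠] 0) (𝓝[≠] a) := by
    refine tendsto_nhdsWithin_iff.2 ⟨?_, ?_⟩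
    · have : ContinuousAt (fun r : ℝ => a + r) 0 := by fun_prop
      have h := this.tendsto
      simp only [Complex.ofReal_zero, add_zero] at h
      exact h.mono_left nhdsWithin_le_nhds
    · filter_upwards [self_mem_nhdsWithin] with r hr
      have hr : r ≠ 0 := hr
      simp [hr]
  -- The function and its reflection agree at real points, which accumulate at `a`; the identity
  -- theorem does the rest.
  have hfr : ∃ᶠ z in 𝓝[≠] a, F z = conj (F (conj z)) := by
    refine htend.frequently (Eventually.frequently ?_)
    have hm : ∀ᶠ r : ℝ in 𝓝[≠] 0, (a + r).im = 0 → (F (a + r)).im = 0 := by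
      refine Tendsto.eventually (f := fun r : ℝ => a + r)
        (tendsto_nhdsWithin_iff.2 ⟨htend.mono_right nhdsWithin_le_nhds, ?_⟩) hr
      exact Eventually.of_forall fun r => by simp [SurfaceKind.model, ha]
    filter_upwards [hm] with r hr
    have him : (a + r).im = 0 := by simp [ha]
    rw [Complex.conj_eq_iff_im.2 him, Complex.conj_eq_iff_im.2 (hr him)]
  have := (AnalyticAt.frequently_eq_iff_eventually_eq hF hG).1 hfr
  filter_upwards [this] with z hz
  rw [hz]; simp

theorem halfPlaneFold_of_nonneg {z : ℂ} (h : 0 ≤ z.im) : halfPlaneFold z = z :=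
  Complex.ext rfl (abs_of_nonneg h)

theorem halfPlaneFold_conj (z : ℂ) : halfPlaneFold (conj z) = halfPlaneFold z := by
  simp [halfPlaneFold]

theorem halfPlaneFold_of_nonpos {z : ℂ} (h : z.im ≤ 0) : halfPlaneFold z = conj z := by
  rw [← halfPlaneFold_conj, halfPlaneFold_of_nonneg]; simpa using h

theorem halfPlaneFold_im_nonneg (z : ℂ) : 0 ≤ (halfPlaneFold z).im := abs_nonneg _

theorem halfPlaneFold_eq_or (z : ℂ) : halfPlaneFold z = z ∨ halfPlaneFold z = conj z := by
  rcases le_total 0 z.im with h | h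
  exacts [Or.inl (halfPlaneFold_of_nonneg h), Or.inr (halfPlaneFold_of_nonpos h)]

theorem continuous_halfPlaneFold : Continuous halfPlaneFold := by
  have : halfPlaneFold = fun z : ℂ => (z.re : ℂ) + ((|z.im| : ℝ) : ℂ) * Complex.I := by
    funext z
    apply Complex.ext <;> simp [halfPlaneFold]
  rw [this]
  fun_prop

/-- Removable singularities, for functions of a coordinate; at a boundary point one uses the
reflection principle. -/
theorem AnalyticRel.of_punctured (hs : IsCoordAt κ.model s x) (ht : ContinuousAt t x)
    (hbd : ∀ᶠ y in 𝓝 x, s y ∉ interior κ.model → (t y).im = 0)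
    (h : ∀ᶠ y in 𝓝[≠] x, AnalyticRel s t y) : AnalyticRel s t x := by
  obtain ⟨j, hjx, hj1, hj2, hj3⟩ := hs.exists_inverse
  have hj0 : map j (𝓝[κ.model] (s x)) = 𝓝 x := by rw [hj3.self_of_nhdsWithin hs.mem, hjx]
  have hne := hs.map_inverse_nhdsNE hj1 hj2 hj0
  have hle : 𝓝[κ.model \ {s x}] (s x) ≤ 𝓝[κ.model] (s x) := nhdsWithin_mono _ sdiff_subset
  set T : ℂ → ℂ := fun z => t (j z) with hT
  have hfin : ∀ᶠ y in 𝓝 x, t y = T (s y) := hj1.mono fun y hy => by simp [hT, hy]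
  -- away from the point, `T` coincides with analytic functions
  have hloc : ∀ᶠ z in 𝓝[κ.model \ {s x}] (s x), ∃ F : ℂ → ℂ, AnalyticAt ℂ F z ∧
      ∀ᶠ z' in 𝓝[κ.model] z, T z' = F z' := by
    have h' : ∀ᶠ z in 𝓝[κ.model \ {s x}] (s x), AnalyticRel s t (j z) := by
      rw [← hne] at h; exact h
    filter_upwards [h', hle hj3, hle (eventually_eventually_nhdsWithin.2 hj2), hle hj2]
      with z hz hz3 hz2 hz0
    obtain ⟨F, hF, hF'⟩ := hz
    refine ⟨F, hz0 ▸ hF, ?_⟩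
    have h1 : ∀ᶠ z' in 𝓝[κ.model] z, t (j z') = F (s (j z')) := by
      rw [← hz3] at hF'; exact hF'
    filter_upwards [h1, hz2] with z' h1 h2
    rw [h2] at h1; exact h1
  have hTc : Tendsto T (𝓝[κ.model] (s x)) (𝓝 (t x)) := by
    have : Tendsto j (𝓝[κ.model] (s x)) (𝓝 x) := hj0.le
    exact ht.tendsto.comp this
  have hTx : T (s x) = t x := by simp [hT, hjx]
  by_cases hi : s x ∈ interior κ.model
  · have hnh : κ.model ∈ 𝓝 (s x) := mem_interior_iff_mem_nhds.1 hi
    rw [nhdsWithin_eq_nhds.2 hnh] at hTc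
    refine ⟨T, ?_, hfin⟩
    refine Complex.analyticAt_of_differentiable_on_punctured_nhds_of_continuousAt ?_ (by
      rw [ContinuousAt, hTx]; exact hTc)
    have e : 𝓝[κ.model \ {s x}] (s x) = 𝓝[≠] (s x) := by
      have : κ.model \ {s x} = {s x}ᶜ ∩ κ.model := by rw [inter_comm]; rfl
      rw [this, nhdsWithin_inter_of_mem' (nhdsWithin_le_nhds hnh)]
    rw [e] at hloc
    filter_upwards [hloc, nhdsWithin_le_nhds (isOpen_interior.mem_nhds hi)] with z hz hzi
    obtain ⟨F, hF, hF'⟩ := hz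
    rw [nhdsWithin_eq_nhds.2 (mem_interior_iff_mem_nhds.1 hzi)] at hF'
    exact hF.differentiableAt.congr_of_eventuallyEq hF'
  · cases κ
    · simp [SurfaceKind.interior_riemann] at hi
    simp only [SurfaceKind.interior_klein] at hi hbd
    have him : (s x).im = 0 := le_antisymm (not_lt.1 hi) hs.mem
    have hca : conj (s x) = s x := Complex.conj_eq_iff_im.2 him
    have htr : (t x).im = 0 := hbd.self_of_nhds hi
    have hreal : ∀ᶠ z in 𝓝[SurfaceKind.klein.model] (s x), z.im = 0 → (T z).im = 0 := by
      have : ∀ᶠ z in 𝓝[SurfaceKind.klein.model] (s x),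
          s (j z) ∉ {z : ℂ | 0 < z.im} → (t (j z)).im = 0 := by
        rw [← hj0] at hbd; exact hbd
      filter_upwards [this, hj2] with z h1 h2 h3
      refine h1 ?_
      rw [h2]
      exact fun h4 => (show 0 < z.im from h4).ne' h3
    -- Schwarz reflection of `T`. It fits together across the axis because `T` is real there near `s
    -- x`.
    set R : ℂ → ℂ := fun z => if 0 ≤ z.im then T z else conj (T (conj z)) with hR
    have hcT : Tendsto (fun z : ℂ => conj z) (𝓝 (s x)) (𝓝 (s x)) := by
      simpa [hca] using (Complex.continuous_conj.tendsto (s x))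
    -- the statement on `𝓝[klein]` transferred to the full neighbourhood by reflection
    refine ⟨R, ?_, ?_⟩
    · refine Complex.analyticAt_of_differentiable_on_punctured_nhds_of_continuousAt ?_ ?_
      · have hboth : ∀ᶠ z in 𝓝 (s x), z ≠ s x → 0 ≤ z.im → (∃ F : ℂ → ℂ, AnalyticAt ℂ F z ∧
            (∀ᶠ z' in 𝓝[SurfaceKind.klein.model] z, T z' = F z')) ∧
            ∀ᶠ z' in 𝓝[SurfaceKind.klein.model] z, z'.im = 0 → (T z').im = 0 := by
          have h1 := eventually_nhdsWithin_iff.1 hloc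
          have h2 := eventually_nhdsWithin_iff.1 (eventually_eventually_nhdsWithin.2 hreal)
          filter_upwards [h1, h2] with z h1 h2 hz hzi
          exact ⟨h1 ⟨hzi, hz⟩, h2 hzi⟩
        have hup : ∀ z : ℂ, 0 < z.im → (∃ F : ℂ → ℂ, AnalyticAt ℂ F z ∧
            (∀ᶠ z' in 𝓝[SurfaceKind.klein.model] z, T z' = F z')) → DifferentiableAt ℂ T z := by
          rintro z hz ⟨F, hF, hF'⟩
          have : SurfaceKind.klein.model ∈ 𝓝 z := by
            rw [← mem_interior_iff_mem_nhds, SurfaceKind.interior_klein]; exact hz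
          rw [nhdsWithin_eq_nhds.2 this] at hF'
          exact hF.differentiableAt.congr_of_eventuallyEq hF'
        filter_upwards [nhdsWithin_le_nhds hboth, nhdsWithin_le_nhds (hcT.eventually hboth),
          self_mem_nhdsWithin] with z h1 h2 hzne
        rcases lt_trichotomy z.im 0 with hz | hz | hz
        · have h3 := hup (conj z) (by simpa using hz)
            (h2 (fun he => hzne (by rw [← Complex.conj_conj z, he, hca]; rfl))
              (by simpa using hz.le)).1
          have h4 : DifferentiableAt ℂ (fun w => conj (T (conj w))) z :=
            differentiableAt_conj_conj_iff.2 h3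
          refine h4.congr_of_eventuallyEq ?_
          filter_upwards [(isOpen_lt Complex.continuous_im continuous_const).mem_nhds hz] with w hw
          have hw : w.im < 0 := hw
          simp [hR, not_le.2 hw]
        -- At a real point other than the centre, the local extension `F` is real on the axis, so it
        -- commutes with conjugation and agrees with `R` on both sides.
        · obtain ⟨⟨F, hF, hF'⟩, hr⟩ := h1 hzne hz.ge
          have hFr : ∀ᶠ z' in 𝓝[SurfaceKind.klein.model] z, z'.im = 0 → (F z').im = 0 := by
            filter_upwards [hF', hr] with w h1 h2
            rwa [← h1]
          have hFc := hF.eventually_conj hz hFr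
          refine hF.differentiableAt.congr_of_eventuallyEq ?_
          have hcz : Tendsto (fun z : ℂ => conj z) (𝓝 z) (𝓝 z) := by
            simpa [Complex.conj_eq_iff_im.2 hz] using (Complex.continuous_conj.tendsto z)
          have hF2 := eventually_nhdsWithin_iff.1 hF'
          filter_upwards [hF2, hcz.eventually hF2, hFc] with w h1 h2 h3
          by_cases hw : 0 ≤ w.im
          · simp only [hR, if_pos hw]
            exact h1 hw
          · simp only [hR, if_neg hw]
            have hw' : conj w ∈ SurfaceKind.klein.model := by
              simp only [SurfaceKind.model, mem_ofPred_eq, Complex.conj_im]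
              linarith
            rw [h2 hw', h3]; simp
        · refine (hup z hz (h1 hzne hz.le).1).congr_of_eventuallyEq ?_
          filter_upwards [(isOpen_lt continuous_const Complex.continuous_im).mem_nhds hz] with w hw
          have hw : 0 < w.im := hw
          simp [hR, hw.le]
      · have hRx : R (s x) = t x := by simp [hR, him, hTx]
        rw [ContinuousAt, hRx]
        have h1 : Tendsto R (𝓝[{z : ℂ | 0 ≤ z.im}] (s x)) (𝓝 (t x)) := by
          refine hTc.congr' ?_
          filter_upwards [self_mem_nhdsWithin] with z hz
          exact (if_pos hz).symm
        have h2 : Tendsto R (𝓝[{z : ℂ | 0 ≤ z.im}ᶜ] (s x)) (𝓝 (t x)) := by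
          have hc2 : Tendsto (fun z : ℂ => conj z) (𝓝[{z : ℂ | 0 ≤ z.im}ᶜ] (s x))
              (𝓝[SurfaceKind.klein.model] (s x)) := by
            refine tendsto_nhdsWithin_iff.2 ⟨hcT.mono_left nhdsWithin_le_nhds, ?_⟩
            filter_upwards [self_mem_nhdsWithin] with z hz
            have hz : ¬ (0 ≤ z.im) := hz
            simp only [SurfaceKind.model, mem_ofPred_eq, Complex.conj_im]
            linarith
          have h3 : Tendsto (fun z : ℂ => conj z) (𝓝 (t x)) (𝓝 (t x)) := by
            simpa [Complex.conj_eq_iff_im.2 htr] using (Complex.continuous_conj.tendsto (t x))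
          refine (h3.comp (hTc.comp hc2)).congr' ?_
          filter_upwards [self_mem_nhdsWithin] with z hz
          have hz : ¬ (0 ≤ z.im) := hz
          simp [hR, hz]
        have h3 := h1.sup h2
        rwa [← nhdsWithin_union, union_compl_self, nhdsWithin_univ] at h3
    · filter_upwards [hfin, hs.eventually] with y h1 h2
      have : 0 ≤ (s y).im := h2.mem
      simp [hR, this, h1]

/-- Coordinates that are compatible away from a point are compatible at that point. -/
theorem SurfaceKind.Rel.of_punctured (hs : IsCoordAt κ.model s x) (ht : IsCoordAt κ.model t x)
    (h : ∀ᶠ y in 𝓝[≠] x, κ.Rel s t y ∧ κ.Rel t s y) : κ.Rel s t x := by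
  cases κ
  · refine AnalyticRel.of_punctured hs ht.continuousAt ?_ (h.mono fun y hy => hy.1)
    simp [SurfaceKind.interior_riemann]
  have hsc : ∀ᶠ y in 𝓝[≠] x, IsCoordAt SurfaceKind.klein.model s y :=
    nhdsWithin_le_nhds hs.eventually
  have htc : ∀ᶠ y in 𝓝[≠] x, IsCoordAt SurfaceKind.klein.model t y :=
    nhdsWithin_le_nhds ht.eventually
  have hb0 : ∀ᶠ y in 𝓝[≠] x, s y ∉ interior SurfaceKind.klein.model → (t y).im = 0 := by
    filter_upwards [h, hsc, htc] with y h1 h2 h3 h4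
    by_contra h5
    refine h4 (SurfaceKind.Rel.mem_interior h1.2 h3 h2 ?_)
    rw [SurfaceKind.interior_klein]
    exact lt_of_le_of_ne h3.mem (Ne.symm h5)
  -- If `t x` were not real, `t` would be nonreal at all nearby points, while the points with real
  -- `s` near `x` must have real `t` by `hb0`.
  have hbx : s x ∉ interior SurfaceKind.klein.model → (t x).im = 0 := by
    intro hsx
    by_contra hne
    have hsx0 : (s x).im = 0 := by
      rw [SurfaceKind.interior_klein] at hsx
      exact le_antisymm (not_lt.1 hsx) hs.mem
    obtain ⟨j, hjx, hj1, hj2, hj3⟩ := hs.exists_inverse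
    have hj0 : map j (𝓝[SurfaceKind.klein.model] (s x)) = 𝓝 x := by
      rw [hj3.self_of_nhdsWithin hs.mem, hjx]
    have hm := hs.map_inverse_nhdsNE hj1 hj2 hj0
    have htend : Tendsto (fun r : ℝ => s x + r) (𝓝[≠] 0)
        (𝓝[SurfaceKind.klein.model \ {s x}] (s x)) := by
      refine tendsto_nhdsWithin_iff.2 ⟨?_, ?_⟩
      · have : ContinuousAt (fun r : ℝ => s x + r) 0 := by fun_prop
        have h := this.tendsto
        simp only [Complex.ofReal_zero, add_zero] at h
        exact h.mono_left nhdsWithin_le_nhds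
      · filter_upwards [self_mem_nhdsWithin] with r hr
        have hr : r ≠ 0 := hr
        exact ⟨by simp [SurfaceKind.model, hsx0], by simp [hr]⟩
    have hev : ∀ᶠ y in 𝓝 x, (t y).im ≠ 0 :=
      (Complex.continuous_im.continuousAt.comp ht.continuousAt).eventually_ne hne
    have h1 := htend.eventually (hm ▸ (hb0.and (nhdsWithin_le_nhds hev)) :
      ∀ᶠ z in 𝓝[SurfaceKind.klein.model \ {s x}] (s x), _)
    have h2 := htend.eventually (nhdsWithin_mono _ sdiff_subset hj2)
    obtain ⟨r, h3, h4⟩ := (h1.and h2).exists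
    refine h3.2 (h3.1 ?_)
    rw [SurfaceKind.interior_klein, h4]
    simp [hsx0]
  have hb : ∀ᶠ y in 𝓝 x, s y ∉ interior SurfaceKind.klein.model → (t y).im = 0 := by
    filter_upwards [eventually_nhdsWithin_iff.1 hb0] with y hy
    by_cases hyx : y = x
    · rwa [hyx]
    · exact hy hyx
  -- Analytic and antianalytic dependence are both open and exclude each other, so on the connected
  -- punctured neighbourhood only one of them occurs.
  have hdich : (∀ᶠ y in 𝓝[≠] x, AnalyticRel s t y) ∨ ∀ᶠ y in 𝓝[≠] x, ¬ AnalyticRel s t y := by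
    refine hs.isGermConnected _ ?_
    filter_upwards [h, hsc, htc] with y h1 h2 h3
    rcases h1.1 with h4 | h4
    · exact Or.inl (h4.eventually h2.continuousAt)
    · right
      have h5 := h4.symm_of_rel h2 h1.2
      filter_upwards [h4.eventually h2.continuousAt, h5.eventually h3.continuousAt, h2.eventually]
        with z h6 h7 h8 h9
      exact h8.not_analytic_and_antianalytic (Or.inr h7) h9 h6
  rcases hdich with hd | hd
  · exact Or.inl (AnalyticRel.of_punctured hs ht.continuousAt hb hd)
  · refine Or.inr (antianalyticRel_iff.2 (AnalyticRel.of_punctured hs ?_ ?_ ?_))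
    · exact Complex.continuous_conj.continuousAt.comp ht.continuousAt
    · filter_upwards [hb] with y hy h'
      simp [hy h']
    · filter_upwards [hd, h] with y h1 h2
      exact antianalyticRel_iff.1 (h2.1.resolve_left h1)

/-- Analytic functions with nonzero derivative are locally invertible. -/
theorem AnalyticAt.exists_local_inverse {F : ℂ → ℂ} {a : ℂ} (hF : AnalyticAt ℂ F a)
    (h : deriv F a ≠ 0) : ∃ G : ℂ → ℂ, AnalyticAt ℂ G (F a) ∧ ∀ᶠ z in 𝓝 a, G (F z) = z := by
  have hd : HasStrictFDerivAt F ((ContinuousLinearEquiv.unitsEquivAut ℂ (Units.mk0 _ h) :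
      ℂ ≃L[ℂ] ℂ) : ℂ →L[ℂ] ℂ) a :=
    hF.hasStrictDerivAt.hasStrictFDerivAt_equiv h
  refine ⟨(hd.toOpenPartialHomeomorph F).symm, ?_, ?_⟩
  · refine OpenPartialHomeomorph.analyticAt_symm' (hd.toOpenPartialHomeomorph F) (a := a)
      hd.mem_toOpenPartialHomeomorph_source (by simpa using hF)
        (by simpa using hd.hasFDerivAt.fderiv)
  · filter_upwards [(hd.toOpenPartialHomeomorph F).open_source.mem_nhds
      hd.mem_toOpenPartialHomeomorph_source] with z hz
    exact (hd.toOpenPartialHomeomorph F).left_inv hz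

theorem analyticRel_symm_of_deriv_ne_zero {F : ℂ → ℂ} (hF : AnalyticAt ℂ F (t x))
    (h : deriv F (t x) ≠ 0) (ht : ContinuousAt t x) (hs : ∀ᶠ y in 𝓝 x, s y = F (t y)) :
    AnalyticRel s t x := by
  obtain ⟨G, hG, hGF⟩ := hF.exists_local_inverse h
  refine ⟨G, hs.self_of_nhds ▸ hG, ?_⟩
  filter_upwards [hs, ht.eventually hGF] with y h1 h2
  rw [h1, h2]

/-- A function that is analytically equivalent to a coordinate with values in `ℂ` is a
coordinate. -/
theorem IsCoordAt.of_analyticRel (hs : IsCoordAt univ s x) (h : AnalyticRel s t x)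
    (h' : AnalyticRel t s x) : IsCoordAt univ t x := by
  -- Openness of `t` comes from the open mapping theorem; were `t` locally constant, its analytic
  -- function `s` would be so too.
  have key : ∀ y, IsCoordAt univ s y → AnalyticRel s t y → AnalyticRel t s y →
      map t (𝓝 y) = 𝓝[univ] (t y) := by
    intro y hs h h'
    have hc : Tendsto t (𝓝 y) (𝓝 (t y)) := h.continuousAt hs.continuousAt
    rw [nhdsWithin_univ]
    refine le_antisymm hc ?_
    refine h.mem_interior_of_map (κ := .riemann) hs (by simp [SurfaceKind.interior_riemann]) rfl ?_
    intro hle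
    have h1 : ∀ᶠ z in 𝓝 y, t z = t y := tendsto_pure.1 hle
    obtain ⟨G, hG, h2⟩ := h'
    have h3 : ∀ᶠ z in 𝓝 y, s z = s y := by
      filter_upwards [h1, h2] with z h3 h4
      rw [h4, h3, ← h2.self_of_nhds]
    have := IsCoordAt.neBot_nhdsNE (κ := .riemann) hs
    have h4 : ∀ᶠ z in 𝓝[≠] y, s z = s y := nhdsWithin_le_nhds h3
    obtain ⟨z, hz1, hz2⟩ := (h4.and hs.eventually_ne).exists
    exact hz2 hz1
  have hct := h.continuousAt hs.continuousAt
  obtain ⟨G, hG, h2⟩ := id h'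
  obtain ⟨U, hxU, hU⟩ := id hs
  have hev : ∀ᶠ y in 𝓝 x, y ∈ U ∧ s y = G (t y) ∧ AnalyticRel s t y ∧ AnalyticRel t s y := by
    filter_upwards [hU.isOpen.mem_nhds hxU, h2, h.eventually hs.continuousAt, h'.eventually hct]
      with y h1 h2 h3 h4 using ⟨h1, h2, h3, h4⟩
  obtain ⟨V, hV, hVo, hxV⟩ := eventually_nhds_iff.1 hev
  refine ⟨V, hxV, hVo, fun y hy z hz hyz => ?_, fun y hy => ?_⟩
  · refine hU.injOn (hV y hy).1 (hV z hz).1 ?_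
    rw [(hV y hy).2.1, (hV z hz).2.1, hyz]
  · exact key y ⟨U, (hV y hy).1, hU⟩ (hV y hy).2.2.1 (hV y hy).2.2.2

end ComplexAnalysis
end

noncomputable section

/-! ### Decomposing a punctured neighbourhood into connected germs. -/

section FilterLemmas

variable {X Y : Type*} [TopologicalSpace X] [TopologicalSpace Y]

theorem IsGermConnected.map {F : Filter Y} (hF : IsGermConnected F) {f : Y → X}
    (hf : ∀ᶠ y in F, ContinuousAt f y) : IsGermConnected (map f F) := by
  intro P hP
  simp only [eventually_map] at hP ⊢
  refine hF _ ?_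
  filter_upwards [hP, hf] with y h1 h2
  exact h1.imp (fun h => h2.eventually h) fun h => h2.eventually h

/-- Membership in `D₁` is locally constant on the disjoint union of the two open sets. -/
theorem IsGermConnected.mem_or_mem {F : Filter X} (hF : IsGermConnected F) {D₁ D₂ : Set X}
    (h₁ : IsOpen D₁) (h₂ : IsOpen D₂) (hd : Disjoint D₁ D₂) (h : D₁ ∪ D₂ ∈ F) :
    D₁ ∈ F ∨ D₂ ∈ F := by
  have := hF (· ∈ D₁) (by
    filter_upwards [h] with y hy
    rcases hy with hy | hy
    · exact Or.inl (h₁.mem_nhds hy)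
    · exact Or.inr (mem_of_superset (h₂.mem_nhds hy) fun z hz hz' => disjoint_left.1 hd hz' hz))
  refine this.imp id fun h' => ?_
  filter_upwards [h, h'] with y h1 h2 using h1.resolve_left h2

/-- `G₁` lives on `D₁`, where `F₂`, living on `D₂`, contributes nothing. -/
theorem le_of_sup_le_of_disjoint {Z : Type*} {F₁ F₂ G₁ : Filter Z} {D₁ D₂ : Set Z}
    (hd : Disjoint D₁ D₂) (hG : D₁ ∈ G₁) (hle : G₁ ≤ F₁ ⊔ F₂) (h₂ : D₂ ∈ F₂) : G₁ ≤ F₁ := by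
  intro A hA
  have h1 : A ∪ D₂ ∈ F₁ ⊔ F₂ :=
    mem_sup.2 ⟨mem_of_superset hA subset_union_left, mem_of_superset h₂ subset_union_right⟩
  filter_upwards [hle h1, hG] with y h1 h2
  exact h1.resolve_right fun h3 => disjoint_left.1 hd h2 h3

/-- Two decompositions of a filter into two connected pieces agree. -/
theorem IsGermConnected.decomposition_unique {F₁ F₂ G₁ G₂ : Filter X} {D₁ D₂ : Set X}
    (hF₁ : IsGermConnected F₁) (hF₂ : IsGermConnected F₂) [G₁.NeBot] [G₂.NeBot]
    (ho₁ : IsOpen D₁) (ho₂ : IsOpen D₂) (hd : Disjoint D₁ D₂) (h₁ : D₁ ∈ G₁) (h₂ : D₂ ∈ G₂)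
    (h : F₁ ⊔ F₂ = G₁ ⊔ G₂) : (F₁ = G₁ ∧ F₂ = G₂) ∨ (F₁ = G₂ ∧ F₂ = G₁) := by
  have hU : D₁ ∪ D₂ ∈ F₁ ⊔ F₂ := by
    rw [h]
    exact mem_sup.2 ⟨mem_of_superset h₁ subset_union_left, mem_of_superset h₂ subset_union_right⟩
  -- If one open set carried both `F₁` and `F₂`, the nontrivial filter on the other, disjoint set
  -- would have nowhere to live.
  have aux : ∀ {G : Filter X} {D D' : Set X} [G.NeBot], Disjoint D D' → D' ∈ G →
      G ≤ F₁ ⊔ F₂ → ¬ (D ∈ F₁ ∧ D ∈ F₂) := by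
    intro G D D' _ hd hD' hG hD
    have : D ∩ D' ∈ G := inter_mem (hG (mem_sup.2 hD)) hD'
    rw [disjoint_iff_inter_eq_empty.1 hd] at this
    exact empty_notMem G this
  have hG1 : G₁ ≤ F₁ ⊔ F₂ := h ▸ le_sup_left
  have hG2 : G₂ ≤ F₁ ⊔ F₂ := h ▸ le_sup_right
  have hF1 : F₁ ≤ G₁ ⊔ G₂ := h ▸ le_sup_left
  have hF2 : F₂ ≤ G₁ ⊔ G₂ := h ▸ le_sup_right
  rcases hF₁.mem_or_mem ho₁ ho₂ hd (mem_sup.1 hU).1 with a | a <;>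
    rcases hF₂.mem_or_mem ho₁ ho₂ hd (mem_sup.1 hU).2 with b | b
  · exact (aux hd h₂ hG2 ⟨a, b⟩).elim
  · left
    exact ⟨le_antisymm (le_of_sup_le_of_disjoint hd a hF1 h₂)
        (le_of_sup_le_of_disjoint hd h₁ hG1 b),
      le_antisymm (le_of_sup_le_of_disjoint hd.symm b (sup_comm G₁ G₂ ▸ hF2) h₁)
        (le_of_sup_le_of_disjoint hd.symm h₂ (sup_comm F₁ F₂ ▸ hG2) a)⟩
  · right
    exact ⟨le_antisymm (le_of_sup_le_of_disjoint hd.symm a (sup_comm G₁ G₂ ▸ hF1) h₁)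
        (le_of_sup_le_of_disjoint hd.symm h₂ hG2 b),
      le_antisymm (le_of_sup_le_of_disjoint hd b hF2 h₂)
        (le_of_sup_le_of_disjoint hd h₁ (sup_comm F₁ F₂ ▸ hG1) a)⟩
  · exact (aux hd.symm h₁ hG1 ⟨a, b⟩).elim

end FilterLemmas

/-! ### Topology of two glued copies of the model, and of charts at a node. -/

namespace Wedge

variable {H : Set ℂ} {a : H}

/-- The inclusion of a branch. -/
def emb (a : H) : Bool → H → Wedge H a
  | true, z => ⟨(z, a), Or.inr rfl⟩
  | false, z => ⟨(a, z), Or.inl rfl⟩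

/-- The coordinate of a branch. -/
def proj (a : H) : Bool → Wedge H a → H
  | true, q => q.1.1
  | false, q => q.1.2

theorem continuous_emb (i : Bool) : Continuous (emb a i) := by
  cases i <;> exact Continuous.subtype_mk (by fun_prop) _

theorem continuous_proj (i : Bool) : Continuous (proj a i) := by
  cases i
  exacts [continuous_snd.comp continuous_subtype_val, continuous_fst.comp continuous_subtype_val]

theorem proj_emb (i : Bool) (z : H) : proj a i (emb a i z) = z := by cases i <;> rfl

theorem isEmbedding_emb (i : Bool) : IsEmbedding (emb a i) :=
  IsEmbedding.of_leftInverse (f := proj a i) (proj_emb i) (continuous_proj i) (continuous_emb i)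

theorem range_emb (i : Bool) : range (emb a i) = branch a i := by
  ext q
  obtain ⟨⟨z, w⟩, hq⟩ := q
  cases i
  · exact ⟨by rintro ⟨z, h⟩; rw [← h]; rfl, fun h => ⟨w, by
      have : z = a := h
      subst this; rfl⟩⟩
  · exact ⟨by rintro ⟨z, h⟩; rw [← h]; rfl, fun h => ⟨z, by
      have : w = a := h
      subst this; rfl⟩⟩

theorem coord_emb (i : Bool) (z : H) : (emb a i z).coord = z := by
  cases i <;> simp [emb, coord]

theorem emb_self (i : Bool) : emb a i a = node a := by cases i <;> rfl

theorem emb_eq_node {i : Bool} {z : H} : emb a i z = node a ↔ z = a := by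
  rw [← emb_self i, (isEmbedding_emb i).injective.eq_iff]

theorem coord_node : (node a).coord = a := by rw [← emb_self true, coord_emb]

theorem mem_branch (q : Wedge H a) : q ∈ branch a true ∨ q ∈ branch a false :=
  q.2.symm

theorem node_mem_branch (i : Bool) : node a ∈ branch a i := by cases i <;> rfl

/-- A branch without the node. -/
def sheet (a : H) (i : Bool) : Set (Wedge H a) := branch a i \ {node a}

theorem sheet_eq (i : Bool) : sheet a i = {q | proj a i q ≠ a} := by
  ext ⟨⟨z, w⟩, hq⟩
  cases i
  · refine ⟨fun h h' => h.2 ?_, fun h => ⟨hq.resolve_right h, fun h' => h ?_⟩⟩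
    · have h1 : z = a := h.1
      have h2 : w = a := h'
      subst h1; subst h2; rfl
    · rw [mem_singleton_iff] at h'
      rw [h']; rfl
  · refine ⟨fun h h' => h.2 ?_, fun h => ⟨hq.resolve_left h, fun h' => h ?_⟩⟩
    · have h1 : w = a := h.1
      have h2 : z = a := h'
      subst h1; subst h2; rfl
    · rw [mem_singleton_iff] at h'
      rw [h']; rfl

theorem isOpen_sheet (i : Bool) : IsOpen (sheet a i) := by
  rw [sheet_eq]
  exact isOpen_ne_fun (continuous_proj i) continuous_const

theorem disjoint_sheet : Disjoint (sheet a true) (sheet a false) := by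
  rw [disjoint_left]
  rintro ⟨⟨z, w⟩, hq⟩ h1 h2
  refine h1.2 ?_
  have e1 : w = a := h1.1
  have e2 : z = a := h2.1
  subst e1; subst e2; rfl

theorem mem_sheet {q : Wedge H a} (h : q ≠ node a) : q ∈ sheet a true ∨ q ∈ sheet a false :=
  (mem_branch q).imp (fun h' => ⟨h', h⟩) fun h' => ⟨h', h⟩

theorem injOn_coord (i : Bool) : InjOn coord (branch a i) := by
  rw [← range_emb]
  rintro _ ⟨z, rfl⟩ _ ⟨w, rfl⟩ h
  rw [coord_emb, coord_emb] at h
  rw [Subtype.ext h]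

theorem map_coord_nhdsWithin_branch {q : Wedge H a} {i : Bool} (hq : q ∈ branch a i) :
    map coord (𝓝[branch a i] q) = 𝓝[H] q.coord := by
  rw [← range_emb] at hq ⊢
  obtain ⟨z, rfl⟩ := hq
  rw [← (isEmbedding_emb i).map_nhds_eq, map_map, coord_emb, ← map_nhds_subtype_val]
  congr 1
  funext w
  exact coord_emb i w

theorem map_coord_nhds {q : Wedge H a} {i : Bool} (hq : q ∈ sheet a i) :
    map coord (𝓝 q) = 𝓝[H] q.coord := by
  rw [← map_coord_nhdsWithin_branch hq.1, nhdsWithin_eq_nhds.2]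
  exact mem_of_superset ((isOpen_sheet i).mem_nhds hq) sdiff_subset

theorem map_emb_nhdsNE (i : Bool) : map (emb a i) (𝓝[≠] a) = 𝓝[sheet a i] (node a) := by
  rw [(isEmbedding_emb i).map_nhdsWithin_eq, emb_self]
  congr 1
  rw [sheet, ← range_emb]
  ext q
  constructor
  · rintro ⟨z, hz, rfl⟩
    exact ⟨⟨z, rfl⟩, fun h => hz (emb_eq_node.1 h)⟩
  · rintro ⟨⟨z, rfl⟩, hz⟩
    exact ⟨z, fun h => hz (emb_eq_node.2 h), rfl⟩

end Wedge

theorem isCoordAt_subtype_val {H : Set ℂ} (a : H) : IsCoordAt H (fun z : H => (z : ℂ)) a :=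
  (OpenPartialHomeomorph.refl H).isCoordOn.isCoordAt (mem_univ a)

namespace OpenPartialHomeomorph

variable {κ : SurfaceKind} {X : Type*} [TopologicalSpace X] {a : κ.model}
  (φ : OpenPartialHomeomorph X (Wedge κ.model a))

/-- The part of the domain of a chart at a node that corresponds to a branch without the node. -/
def sheet (i : Bool) : Set X := φ.source ∩ φ ⁻¹' Wedge.sheet a i

/-- The centre of a chart at a node. -/
def center : X := φ.symm (Wedge.node a)

theorem isOpen_sheet (i : Bool) : IsOpen (φ.sheet i) :=
  φ.isOpen_inter_preimage (Wedge.isOpen_sheet i)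

theorem disjoint_sheet : Disjoint (φ.sheet true) (φ.sheet false) :=
  disjoint_left.2 fun _ h1 h2 => disjoint_left.1 Wedge.disjoint_sheet h1.2 h2.2

variable {φ}

theorem apply_center (h : Wedge.node a ∈ φ.target) : φ φ.center = Wedge.node a := φ.right_inv h

theorem center_mem (h : Wedge.node a ∈ φ.target) : φ.center ∈ φ.source := φ.map_target h

theorem center_notMem_sheet (h : Wedge.node a ∈ φ.target) (i : Bool) : φ.center ∉ φ.sheet i :=
  fun h' => h'.2.2 (apply_center h)

theorem mem_sheet_of_ne {x : X} (hx : x ∈ φ.source) (hne : x ≠ φ.center) :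
    x ∈ φ.sheet true ∨ x ∈ φ.sheet false := by
  have : φ x ≠ Wedge.node a := fun h => hne (by rw [center, ← h, φ.left_inv hx])
  exact (Wedge.mem_sheet this).imp (fun h' => ⟨hx, h'⟩) fun h' => ⟨hx, h'⟩

theorem branch_eq_insert (h : Wedge.node a ∈ φ.target) (i : Bool) :
    φ.source ∩ φ ⁻¹' Wedge.branch a i = insert φ.center (φ.sheet i) := by
  ext x
  constructor
  · rintro ⟨hx, hb⟩
    by_cases hc : φ x = Wedge.node a
    · left; rw [center, ← hc, φ.left_inv hx]
    · exact Or.inr ⟨hx, hb, hc⟩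
  · rintro (rfl | hx)
    · refine ⟨center_mem h, ?_⟩
      rw [mem_preimage, apply_center h]
      exact Wedge.node_mem_branch i
    · exact ⟨hx.1, hx.2.1⟩

variable (φ) in
theorem isCoordOn_sheet (i : Bool) :
    IsCoordOn κ.model (fun x => (φ x).coord) (φ.sheet i) := by
  refine ⟨φ.isOpen_sheet i, fun x hx y hy h => ?_, fun x hx => ?_⟩
  · exact φ.injOn hx.1 hy.1 (Wedge.injOn_coord i hx.2.1 hy.2.1 h)
  · rw [← Wedge.map_coord_nhds hx.2, ← φ.map_nhds_eq hx.1, map_map]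
    rfl

theorem map_coord_branch (h : Wedge.node a ∈ φ.target) (i : Bool) :
    map (fun x => (φ x).coord) (𝓝[insert φ.center (φ.sheet i)] φ.center) =
      𝓝[κ.model] (a : ℂ) := by
  have h1 : map φ (𝓝[insert φ.center (φ.sheet i)] φ.center) =
      𝓝[Wedge.branch a i] (Wedge.node a) := by
    rw [← branch_eq_insert h, inter_comm, nhdsWithin_inter_of_mem'
      (nhdsWithin_le_nhds (φ.open_source.mem_nhds (center_mem h))),
      φ.map_nhdsWithin_preimage_eq (center_mem h), apply_center h]
  have h2 := Wedge.map_coord_nhdsWithin_branch (Wedge.node_mem_branch (a := a) i)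
  rw [Wedge.coord_node] at h2
  rw [← h2, ← h1, map_map]
  rfl

theorem map_sheet (h : Wedge.node a ∈ φ.target) (i : Bool) :
    map (fun z => φ.symm (Wedge.emb a i z)) (𝓝[≠] a) = 𝓝[φ.sheet i] φ.center := by
  have h1 : map φ (𝓝[φ.sheet i] φ.center) = 𝓝[Wedge.sheet a i] (Wedge.node a) := by
    rw [sheet, inter_comm, nhdsWithin_inter_of_mem'
      (nhdsWithin_le_nhds (φ.open_source.mem_nhds (center_mem h))),
      φ.map_nhdsWithin_preimage_eq (center_mem h), apply_center h]
  have h2 : map φ.symm (map φ (𝓝[φ.sheet i] φ.center)) = 𝓝[φ.sheet i] φ.center := by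
    rw [map_map]
    have : φ.symm ∘ φ =ᶠ[𝓝[φ.sheet i] φ.center] id :=
      nhdsWithin_le_nhds (mem_of_superset (φ.open_source.mem_nhds (center_mem h))
        fun x hx => φ.left_inv hx)
    rw [map_congr this, map_id]
  rw [← h2, h1, ← Wedge.map_emb_nhdsNE, map_map]
  rfl

/-- Under the chart, a sheet near the centre is the continuous image of a punctured neighbourhood in
the model. -/
theorem isGermConnected_sheet (h : Wedge.node a ∈ φ.target) (i : Bool) :
    IsGermConnected (𝓝[φ.sheet i] φ.center) := by
  rw [← map_sheet h]
  refine IsGermConnected.map (isCoordAt_subtype_val a).isGermConnected ?_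
  have h1 : ∀ᶠ z in 𝓝 a, Wedge.emb a i z ∈ φ.target :=
    (Wedge.continuous_emb i).continuousAt.eventually
      (φ.open_target.mem_nhds (by rwa [Wedge.emb_self]))
  filter_upwards [nhdsWithin_le_nhds h1] with z hz
  exact (φ.symm.continuousAt hz).comp (Wedge.continuous_emb i).continuousAt

theorem neBot_sheet (h : Wedge.node a ∈ φ.target) (i : Bool) :
    (𝓝[φ.sheet i] φ.center).NeBot := by
  rw [← map_sheet h]
  have := (isCoordAt_subtype_val a).neBot_nhdsNE
  infer_instance

theorem nhdsNE_center (h : Wedge.node a ∈ φ.target) :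
    𝓝[≠] φ.center = 𝓝[φ.sheet true] φ.center ⊔ 𝓝[φ.sheet false] φ.center := by
  rw [← nhdsWithin_union]
  apply le_antisymm
  · refine le_inf nhdsWithin_le_nhds ?_
    rw [le_principal_iff]
    filter_upwards [nhdsWithin_le_nhds (φ.open_source.mem_nhds (center_mem h)),
      self_mem_nhdsWithin] with x hx hne
    exact mem_sheet_of_ne hx hne
  · refine nhdsWithin_mono _ ?_
    rintro x (hx | hx) rfl
    exacts [center_notMem_sheet h _ hx, center_notMem_sheet h _ hx]

/-- A node has no neighbourhood homeomorphic to an open subset of the model. -/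
theorem not_isCoordAt_center (h : Wedge.node a ∈ φ.target) (κ' : SurfaceKind) (s : X → ℂ) :
    ¬ IsCoordAt κ'.model s φ.center := by
  intro hs
  -- A coordinate would make the punctured neighbourhood connected, hence contained in one sheet;
  -- but the other sheet also accumulates at the centre.
  have hU : φ.sheet true ∪ φ.sheet false ∈ 𝓝[≠] φ.center := by
    rw [nhdsNE_center h, ← nhdsWithin_union]
    exact self_mem_nhdsWithin
  have aux : ∀ i j, Disjoint (φ.sheet i) (φ.sheet j) → φ.sheet i ∉ 𝓝[≠] φ.center := by
    intro i j hd hi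
    have := neBot_sheet h j
    have hle : 𝓝[φ.sheet j] φ.center ≤ 𝓝[≠] φ.center :=
      nhdsWithin_mono _ fun x hx hxc => center_notMem_sheet h j (hxc ▸ hx)
    have h2 := inter_mem (hle hi) self_mem_nhdsWithin
    rw [disjoint_iff_inter_eq_empty.1 hd] at h2
    exact empty_notMem _ h2
  rcases hs.isGermConnected.mem_or_mem (φ.isOpen_sheet _) (φ.isOpen_sheet _) φ.disjoint_sheet hU
    with h1 | h1
  · exact aux _ _ φ.disjoint_sheet h1
  · exact aux _ _ φ.disjoint_sheet.symm h1

end OpenPartialHomeomorph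
end

noncomputable section

/-! ### Nodes and branches of a surface, independently of the chart. -/

namespace NodalChart

variable {κ : SurfaceKind} {X : Type u} [TopologicalSpace X]

/-- `x` is the centre of a chart at a node. -/
def IsCenter (c : NodalChart κ.model X) (x : X) : Prop :=
  ∃ a φ h, c = node a φ h ∧ φ.center = x

theorem isOpen_source (c : NodalChart κ.model X) : IsOpen c.source := by
  cases c with
  | plane φ => exact φ.open_source
  | node a φ h => exact φ.open_source

theorem isCenter_or_isCoordAt {c : NodalChart κ.model X} {x : X} (hx : x ∈ c.source) :
    c.IsCenter x ∨ IsCoordAt κ.model c.coord x := by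
  cases c with
  | plane φ => exact Or.inr (φ.isCoordOn.isCoordAt hx)
  | node a φ h =>
    by_cases hc : x = φ.center
    · exact Or.inl ⟨a, φ, h, rfl, hc.symm⟩
    · right
      rcases OpenPartialHomeomorph.mem_sheet_of_ne hx hc with hs | hs
      · exact (φ.isCoordOn_sheet true).isCoordAt hs
      · exact (φ.isCoordOn_sheet false).isCoordAt hs

theorem IsCenter.not_isCoordAt {c : NodalChart κ.model X} {x : X} (h : c.IsCenter x)
    (κ' : SurfaceKind) (s : X → ℂ) : ¬ IsCoordAt κ'.model s x := by
  obtain ⟨a, φ, h, rfl, rfl⟩ := h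
  exact OpenPartialHomeomorph.not_isCoordAt_center h κ' s

end NodalChart

namespace NodalSurfaceData

variable {κ : SurfaceKind} {X : Type u} [TopologicalSpace X] {S : NodalSurfaceData κ X}

/-- The nodes where two branches meet. -/
def crossing (S : NodalSurfaceData κ X) : Set X := S.conicNodes ∪ S.boundaryNodes

theorem mem_crossing {x : X} : x ∈ S.crossing ↔ ∃ c ∈ S.atlas, c.IsCenter x := by
  constructor
  · rintro (⟨a, φ, h, h1, -, h3⟩ | ⟨a, φ, h, h1, -, h3⟩) <;>
      exact ⟨_, h1, a, φ, h, rfl, h3⟩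
  · rintro ⟨c, hc, a, φ, h, rfl, h3⟩
    by_cases ha : (a : ℂ) ∈ interior κ.model
    · exact Or.inl ⟨a, φ, h, hc, ha, h3⟩
    · exact Or.inr ⟨a, φ, h, hc, ha, h3⟩

theorem crossing_subset_nodes : S.crossing ⊆ S.nodes := by
  rintro x (h | h)
  exacts [Or.inl (Or.inl h), Or.inr h]

theorem isCoordAt_of_notMem_crossing {x : X} (hx : x ∉ S.crossing) {c : NodalChart κ.model X}
    (hc : c ∈ S.atlas) (hxc : x ∈ c.source) : IsCoordAt κ.model c.coord x :=
  (NodalChart.isCenter_or_isCoordAt hxc).resolve_left fun h => hx (mem_crossing.2 ⟨c, hc, h⟩)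

theorem not_isCoordAt_of_mem_crossing {x : X} (hx : x ∈ S.crossing) (κ' : SurfaceKind)
    (s : X → ℂ) : ¬ IsCoordAt κ'.model s x := by
  obtain ⟨c, -, h⟩ := mem_crossing.1 hx
  exact h.not_isCoordAt κ' s

/-- Being a crossing is topological, so every chart around such a point is centred there, whether or
not it belongs to the atlas. -/
theorem isCenter_of_mem_crossing {x : X} (hx : x ∈ S.crossing) {c : NodalChart κ.model X}
    (hxc : x ∈ c.source) : c.IsCenter x :=
  (NodalChart.isCenter_or_isCoordAt hxc).resolve_right (not_isCoordAt_of_mem_crossing hx κ _)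

theorem exists_node_chart {x : X} (hx : x ∈ S.crossing) :
    ∃ a φ h, NodalChart.node a φ h ∈ S.atlas ∧ φ.center = x := by
  obtain ⟨c, hc, a, φ, h, rfl, h3⟩ := mem_crossing.1 hx
  exact ⟨a, φ, h, hc, h3⟩

/-- A single chart has at most one centre. -/
theorem eventually_notMem_crossing (hS : S.IsSurface) (x : X) :
    ∀ᶠ y in 𝓝[≠] x, y ∉ S.crossing := by
  obtain ⟨c, hc, hx⟩ := hS.covers x
  rcases NodalChart.isCenter_or_isCoordAt hx with h | h
  · obtain ⟨a, φ, h, rfl, rfl⟩ := h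
    filter_upwards [nhdsWithin_le_nhds (φ.open_source.mem_nhds hx), self_mem_nhdsWithin]
      with y hy hne hcr
    obtain ⟨a', φ', h', e, hc'⟩ := isCenter_of_mem_crossing hcr (c := .node a φ h) hy
    cases e
    exact hne hc'.symm
  · filter_upwards [nhdsWithin_le_nhds h.eventually] with y hy hcr
    exact not_isCoordAt_of_mem_crossing hcr κ _ hy

theorem eventually_notMem_nodes (hS : S.IsSurface) (x : X) : ∀ᶠ y in 𝓝[≠] x, y ∉ S.nodes := by
  have h1 : ∀ᶠ y in 𝓝[≠] x, y ∉ S.distinguished := by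
    by_cases hx : x ∈ S.distinguished
    · have := hS.distinguished_discrete
      have h2 := (discreteTopology_subtype_iff.1 this) x hx
      rw [← disjoint_iff, disjoint_principal_right] at h2
      exact h2
    · exact nhdsWithin_le_nhds (hS.distinguished_closed.isOpen_compl.mem_nhds hx)
  filter_upwards [h1, eventually_notMem_crossing hS x] with y h1 h2
  rintro ((h | h) | h)
  exacts [h2 (Or.inl h), h1 h, h2 (Or.inr h)]

theorem disjoint_distinguished_crossing (hS : S.IsSurface) :
    Disjoint S.distinguished S.crossing := by
  refine disjoint_left.2 fun x hx hc => ?_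
  obtain ⟨φ, -, h, -⟩ := hS.distinguished_interior x hx
  exact not_isCoordAt_of_mem_crossing hc κ _ (φ.isCoordOn.isCoordAt h)

/-- Suppose charts of both kinds are centred at `x`. Off the nodes, changes of coordinates preserve
interior points, so near its centre the boundary chart would take only interior values apart from
`a'`. But its branch covers the real points near `a'`. -/
theorem disjoint_conic_boundaryNodes (hS : S.IsSurface) :
    Disjoint S.conicNodes S.boundaryNodes := by
  refine disjoint_left.2 ?_
  rintro x ⟨a, φ, h, hc, ha, hx⟩ ⟨a', φ', h', hc', ha', hx'⟩
  change φ.center = x at hx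
  change φ'.center = x at hx'
  cases κ
  · simp [SurfaceKind.interior_riemann] at ha'
  have hmap : map (fun y => (φ' y).coord) (𝓝[insert x (φ'.sheet true)] x) =
      𝓝[SurfaceKind.klein.model] (a' : ℂ) := by
    have := OpenPartialHomeomorph.map_coord_branch h' true
    rwa [hx'] at this
  have hcoord : ∀ᶠ y in 𝓝 x, (φ y).coord ∈ interior SurfaceKind.klein.model := by
    have hcont : ContinuousAt (fun y => (φ y).coord) x := by
      have h1 : Continuous (Wedge.coord : Wedge SurfaceKind.klein.model a → ℂ) := by
        unfold Wedge.coord; fun_prop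
      exact h1.continuousAt.comp (φ.continuousAt (hx ▸ OpenPartialHomeomorph.center_mem h))
    refine hcont.eventually (isOpen_interior.mem_nhds ?_)
    simp only [← hx]
    rw [OpenPartialHomeomorph.apply_center h, Wedge.coord_node]
    exact ha
  have hinter : ∀ᶠ y in 𝓝[insert x (φ'.sheet true)] x,
      y ≠ x → (φ' y).coord ∈ interior SurfaceKind.klein.model := by
    have h1 := eventually_nhdsWithin_iff.1 (eventually_notMem_nodes hS x)
    have s1 := φ.open_source.mem_nhds (OpenPartialHomeomorph.center_mem h)
    have s2 := φ'.open_source.mem_nhds (OpenPartialHomeomorph.center_mem h')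
    rw [hx] at s1
    rw [hx'] at s2
    filter_upwards [nhdsWithin_le_nhds h1, nhdsWithin_le_nhds hcoord, nhdsWithin_le_nhds s1,
      nhdsWithin_le_nhds s2] with y h1 h2 h3 h4 hne
    have hn := h1 hne
    have hn' : y ∉ S.crossing := fun h => hn (crossing_subset_nodes h)
    exact SurfaceKind.Rel.mem_interior (κ := .klein) (x := y)
      (s := (NodalChart.node a φ h).coord) (t := (NodalChart.node a' φ' h').coord)
      (hS.compatible _ hc _ hc' y ⟨h3, h4⟩ hn).1
      (isCoordAt_of_notMem_crossing hn' hc h3) (isCoordAt_of_notMem_crossing hn' hc' h4) h2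
  have h5 : ∀ᶠ y in 𝓝[insert x (φ'.sheet true)] x, (φ' y).coord ≠ a' →
      (φ' y).coord ∈ interior SurfaceKind.klein.model := by
    filter_upwards [hinter] with y hy hne
    refine hy ?_
    rintro rfl
    rw [← hx', OpenPartialHomeomorph.apply_center h', Wedge.coord_node] at hne
    exact hne rfl
  have h6 : ∀ᶠ z : ℂ in 𝓝[SurfaceKind.klein.model] (a' : ℂ), z ≠ (a' : ℂ) →
      z ∈ interior SurfaceKind.klein.model := by
    rw [← hmap]; exact h5
  have ha0 : (a' : ℂ).im = 0 := by
    rw [SurfaceKind.interior_klein] at ha'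
    exact le_antisymm (not_lt.1 ha') a'.2
  have htend : Tendsto (fun r : ℝ => (a' : ℂ) + r) (𝓝[≠] 0)
      (𝓝[SurfaceKind.klein.model] (a' : ℂ)) := by
    refine tendsto_nhdsWithin_iff.2 ⟨?_, ?_⟩
    · have : ContinuousAt (fun r : ℝ => (a' : ℂ) + r) 0 := by fun_prop
      have h := this.tendsto
      simp only [Complex.ofReal_zero, add_zero] at h
      exact h.mono_left nhdsWithin_le_nhds
    · exact Eventually.of_forall fun r => by simp [SurfaceKind.model, ha0]
  obtain ⟨r, hr, hr0⟩ := ((htend.eventually h6).and self_mem_nhdsWithin).exists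
  have hr0 : r ≠ 0 := hr0
  have := hr (by simp [hr0])
  rw [SurfaceKind.interior_klein] at this
  simp [ha0] at this

/-- The filter of the branch `i` at the centre of a chart at a node. -/
def branchFilter {a : κ.model} (φ : OpenPartialHomeomorph X (Wedge κ.model a)) (i : Bool) :
    Filter X := 𝓝[insert φ.center (φ.sheet i)] φ.center

theorem isBranch_of_notMem_crossing {x : X} {B : Filter X} (hx : x ∉ S.crossing) :
    S.IsBranch x B ↔ B = 𝓝 x := by
  constructor
  · rintro (h | ⟨a, φ, h, i, hc, hx', -⟩)
    · exact h.2
    · exact (hx (mem_crossing.2 ⟨_, hc, a, φ, h, rfl, hx'⟩)).elim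
  · exact fun h => Or.inl ⟨hx, h⟩

theorem IsBranch.exists_node_chart {x : X} {B : Filter X} (hB : S.IsBranch x B)
    (hx : x ∈ S.crossing) : ∃ a φ h i, NodalChart.node a φ h ∈ S.atlas ∧ φ.center = x ∧
      B = branchFilter φ i := by
  rcases hB with h | ⟨a, φ, h, i, hc, hx', hB⟩
  · exact (h.1 hx).elim
  · change φ.center = x at hx'
    refine ⟨a, φ, h, i, hc, hx', ?_⟩
    rw [hB, OpenPartialHomeomorph.branch_eq_insert h, branchFilter, hx']

theorem isBranch_branchFilter {a : κ.model} {φ : OpenPartialHomeomorph X (Wedge κ.model a)}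
    {h : Wedge.node a ∈ φ.target} (hc : NodalChart.node a φ h ∈ S.atlas) (i : Bool) :
    S.IsBranch φ.center (branchFilter φ i) :=
  Or.inr ⟨a, φ, h, i, hc, rfl, by rw [OpenPartialHomeomorph.branch_eq_insert h, branchFilter]⟩

theorem branchFilter_injective {a : κ.model} {φ : OpenPartialHomeomorph X (Wedge κ.model a)}
    (h : Wedge.node a ∈ φ.target) : branchFilter φ true ≠ branchFilter φ false := by
  intro he
  have h1 : insert φ.center (φ.sheet true) ∈ 𝓝[φ.sheet false] φ.center := by
    have : insert φ.center (φ.sheet true) ∈ branchFilter φ false := he ▸ self_mem_nhdsWithin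
    exact nhdsWithin_mono _ (subset_insert _ _) this
  have := OpenPartialHomeomorph.neBot_sheet h false
  obtain ⟨y, hy1, hy2⟩ := Filter.nonempty_of_mem (inter_mem h1 self_mem_nhdsWithin)
  rcases hy1 with rfl | hy1
  · exact OpenPartialHomeomorph.center_notMem_sheet h _ hy2
  · exact disjoint_left.1 φ.disjoint_sheet hy1 hy2

/-- The branches at a node are the two branches of any chart at the node. -/
theorem isBranch_iff_of_node_chart {a : κ.model} {φ : OpenPartialHomeomorph X (Wedge κ.model a)}
    {h : Wedge.node a ∈ φ.target} (hc : NodalChart.node a φ h ∈ S.atlas) {B : Filter X} :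
    S.IsBranch φ.center B ↔ B = branchFilter φ true ∨ B = branchFilter φ false := by
  constructor
  · intro hB
    obtain ⟨a', φ', h', i, -, hx, rfl⟩ :=
      hB.exists_node_chart (mem_crossing.2 ⟨_, hc, a, φ, h, rfl, rfl⟩)
    have e1 := OpenPartialHomeomorph.nhdsNE_center h
    have e2 := OpenPartialHomeomorph.nhdsNE_center h'
    rw [hx] at e2
    have n1 := OpenPartialHomeomorph.neBot_sheet h true
    have n2 := OpenPartialHomeomorph.neBot_sheet h false
    have g1 := OpenPartialHomeomorph.isGermConnected_sheet h' true
    have g2 := OpenPartialHomeomorph.isGermConnected_sheet h' false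
    rw [hx] at g1 g2
    -- Each of the two charts splits the punctured neighbourhood into two connected germs, and such
    -- a splitting is unique up to order.
    have key := IsGermConnected.decomposition_unique g1 g2 (φ.isOpen_sheet true)
      (φ.isOpen_sheet false) φ.disjoint_sheet self_mem_nhdsWithin self_mem_nhdsWithin
      (e2.symm.trans e1)
    simp only [branchFilter, nhdsWithin_insert, hx]
    rcases key with ⟨k1, k2⟩ | ⟨k1, k2⟩ <;> cases i <;> simp [k1, k2]
  · rintro (rfl | rfl) <;> exact isBranch_branchFilter hc _

/-- A common description of branches at nodes and at ordinary points: an open set without crossings,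
with `x` added. The topology of the normalization can then be studied without distinguishing cases.
-/
theorem IsBranch.exists_open (hS : S.IsSurface) {x : X} {B : Filter X} (hB : S.IsBranch x B) :
    ∃ D, IsOpen D ∧ x ∉ D ∧ (∀ y ∈ D, y ∉ S.crossing) ∧ B = 𝓝[insert x D] x := by
  have := hS.t2
  by_cases hx : x ∈ S.crossing
  · obtain ⟨a, φ, h, i, hc, rfl, rfl⟩ := hB.exists_node_chart hx
    refine ⟨φ.sheet i, φ.isOpen_sheet i, OpenPartialHomeomorph.center_notMem_sheet h i, ?_, rfl⟩
    intro y hy hcr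
    exact not_isCoordAt_of_mem_crossing hcr κ _ ((φ.isCoordOn_sheet i).isCoordAt hy)
  · rw [isBranch_of_notMem_crossing hx] at hB
    obtain ⟨U, hU, hUo, hxU⟩ :=
      eventually_nhds_iff.1 (eventually_nhdsWithin_iff.1 (eventually_notMem_crossing hS x))
    refine ⟨U \ {x}, hUo.sdiff isClosed_singleton, fun h => h.2 rfl, fun y hy => hU y hy.1 hy.2, ?_⟩
    rw [insert_sdiff_singleton, insert_eq_of_mem hxU, hUo.nhdsWithin_eq hxU, hB]

theorem IsBranch.le_nhds {x : X} {B : Filter X} (hB : S.IsBranch x B) : B ≤ 𝓝 x := by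
  rcases hB with h | ⟨a, φ, h, i, hc, hx', hB⟩
  · exact h.2.le
  · rw [hB]; exact nhdsWithin_le_nhds

/-! ### The topology and the coordinates of the normalization. -/

section Normalization

theorem p_surjective (S : NodalSurfaceData κ X) : Function.Surjective S.p := by
  intro x
  by_cases hx : x ∈ S.crossing
  · obtain ⟨a, φ, h, hc, rfl⟩ := exists_node_chart hx
    exact ⟨⟨(_, _), isBranch_branchFilter hc true⟩, rfl⟩
  · exact ⟨⟨(x, 𝓝 x), (isBranch_of_notMem_crossing hx).2 rfl⟩, rfl⟩

theorem p_inj {q r : S.Normalization} (h : S.p q = S.p r) (hq : S.p q ∉ S.crossing) : q = r := by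
  have h1 := (isBranch_of_notMem_crossing hq).1 q.2
  have hr : S.p r ∉ S.crossing := h ▸ hq
  have h2 := (isBranch_of_notMem_crossing hr).1 r.2
  refine Subtype.ext (Prod.ext h ?_)
  rw [h1, h2]
  exact congrArg 𝓝 h

theorem isOpen_normalization_iff {O : Set S.Normalization} : IsOpen O ↔
    ∀ q ∈ O, ∀ᶠ y in q.1.2, ∀ r : S.Normalization, S.p r = y → y ≠ S.p q → r ∈ O := Iff.rfl

theorem continuous_p (S : NodalSurfaceData κ X) : Continuous S.p := by
  refine continuous_def.2 fun U hU => isOpen_normalization_iff.2 fun q hq => ?_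
  filter_upwards [q.2.le_nhds (hU.mem_nhds hq)] with y hy r hr _
  rwa [mem_preimage, hr]

/-- The basic neighbourhoods of `q`: the point itself and everything over the open set that, with
the image of `q` added, carries its branch. -/
theorem isOpen_insert_preimage {q : S.Normalization} {D : Set X} (hD : IsOpen D)
    (hq : q.1.2 ≤ 𝓟 (insert (S.p q) D)) : IsOpen (insert q (S.p ⁻¹' D)) := by
  refine isOpen_normalization_iff.2 fun r hr => ?_
  rcases hr with rfl | hr
  · filter_upwards [le_principal_iff.1 hq] with y hy r' hr' hne
    exact Or.inr (show S.p r' ∈ D from hr' ▸ hy.resolve_left hne)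
  · filter_upwards [r.2.le_nhds (hD.mem_nhds hr)] with y hy r' hr' _
    exact Or.inr (show S.p r' ∈ D from hr' ▸ hy)

/-- Near `q` the projection sees exactly the branch of `q`. This replaces the explicit definition of
open sets by a filter identity. -/
theorem map_p_nhds (hS : S.IsSurface) (q : S.Normalization) : map S.p (𝓝 q) = q.1.2 := by
  obtain ⟨D, hDo, hxD, -, hB⟩ := q.2.exists_open hS
  apply le_antisymm
  · intro A hA
    rw [hB, mem_nhdsWithin] at hA
    obtain ⟨V, hVo, hxV, hVA⟩ := hA
    have ho : IsOpen (insert q (S.p ⁻¹' (D ∩ V))) := by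
      refine isOpen_insert_preimage (hDo.inter hVo) ?_
      rw [le_principal_iff, hB]
      filter_upwards [self_mem_nhdsWithin, nhdsWithin_le_nhds (hVo.mem_nhds hxV)] with y h1 h2
      exact h1.imp id fun h => ⟨h, h2⟩
    refine mem_map.2 (mem_of_superset (ho.mem_nhds (mem_insert _ _)) ?_)
    rintro r (rfl | hr)
    · exact hVA ⟨hxV, mem_insert _ _⟩
    · exact hVA ⟨hr.2, Or.inr hr.1⟩
  · intro A hA
    obtain ⟨O, hOA, hO, hqO⟩ := mem_nhds_iff.1 (mem_map.1 hA)
    filter_upwards [isOpen_normalization_iff.1 hO q hqO] with y hy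
    by_cases hyx : y = S.p q
    · rw [hyx]; exact hOA hqO
    · obtain ⟨r, rfl⟩ := S.p_surjective y
      exact hOA (hy r rfl hyx)

theorem eventually_p_ne (hS : S.IsSurface) (q : S.Normalization) :
    ∀ᶠ r in 𝓝[≠] q, S.p r ≠ S.p q := by
  obtain ⟨D, hDo, hxD, -, hB⟩ := q.2.exists_open hS
  have ho : IsOpen (insert q (S.p ⁻¹' D)) :=
    isOpen_insert_preimage hDo (le_principal_iff.2 (by rw [hB]; exact self_mem_nhdsWithin))
  filter_upwards [nhdsWithin_le_nhds (ho.mem_nhds (mem_insert _ _)), self_mem_nhdsWithin]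
    with r hr hne he
  have h1 : S.p r ∈ D := hr.resolve_left hne
  exact hxD (by rw [he] at h1; exact h1)

theorem tendsto_p_nhdsNE (hS : S.IsSurface) (q : S.Normalization) :
    Tendsto S.p (𝓝[≠] q) (𝓝[≠] S.p q) :=
  tendsto_nhdsWithin_iff.2 ⟨(S.continuous_p.tendsto q).mono_left nhdsWithin_le_nhds,
    eventually_p_ne hS q⟩

theorem eventually_p_notMem_nodes (hS : S.IsSurface) (q : S.Normalization) :
    ∀ᶠ r in 𝓝[≠] q, S.p r ∉ S.nodes :=
  (tendsto_p_nhdsNE hS q).eventually (eventually_notMem_nodes hS _)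

/-- The coordinates of the surface are coordinates of the normalization. -/
theorem isCoordAt_p (hS : S.IsSurface) {q : S.Normalization} {c : NodalChart κ.model X}
    (hc : c ∈ S.atlas) (hq : S.p q ∈ c.source) :
    IsCoordAt κ.model (fun r => c.coord (S.p r)) q := by
  have key : ∀ r : S.Normalization, S.p r ∉ S.crossing → IsCoordAt κ.model c.coord (S.p r) →
      map (fun r => c.coord (S.p r)) (𝓝 r) = 𝓝[κ.model] (c.coord (S.p r)) := by
    intro r hr hcr
    rw [← hcr.map_nhds, ← show r.1.2 = 𝓝 (S.p r) from (isBranch_of_notMem_crossing hr).1 r.2,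
      ← map_p_nhds hS, map_map]
    rfl
  by_cases hx : S.p q ∈ S.crossing
  · obtain ⟨a, φ, h, rfl, hce⟩ := isCenter_of_mem_crossing hx hq
    have hB := q.2
    change S.IsBranch (S.p q) _ at hB
    rw [← hce, isBranch_iff_of_node_chart hc] at hB
    obtain ⟨i, hi⟩ : ∃ i, q.1.2 = branchFilter φ i := by
      rcases hB with h | h
      exacts [⟨true, h⟩, ⟨false, h⟩]
    have hnc : ∀ y ∈ φ.sheet i, y ∉ S.crossing := fun y hy hcr =>
      not_isCoordAt_of_mem_crossing hcr κ _ ((φ.isCoordOn_sheet i).isCoordAt hy)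
    have hqa : (φ (S.p q)).coord = a := by
      rw [← hce, OpenPartialHomeomorph.apply_center h, Wedge.coord_node]
    -- The wedge coordinate is injective on a single branch, so only the node takes the value `a`.
    have hne : ∀ y ∈ φ.sheet i, (φ y).coord ≠ a := fun y hy he => by
      refine hy.2.2 (Wedge.injOn_coord i hy.2.1 (Wedge.node_mem_branch i) ?_)
      rw [he, Wedge.coord_node]
    refine ⟨insert q (S.p ⁻¹' φ.sheet i), mem_insert _ _, ?_, ?_, ?_⟩
    · refine isOpen_insert_preimage (φ.isOpen_sheet i) (le_principal_iff.2 ?_)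
      rw [hi, ← hce]; exact self_mem_nhdsWithin
    · rintro r (rfl | hr) r' (rfl | hr') he
      · rfl
      · exact (hne _ hr' (he.symm.trans hqa)).elim
      · exact (hne _ hr (Eq.trans he hqa)).elim
      · exact p_inj ((φ.isCoordOn_sheet i).injOn hr hr' he) (hnc _ hr)
    · rintro r (rfl | hr)
      · change map ((fun y => (φ y).coord) ∘ S.p) (𝓝 r) = 𝓝[κ.model] ((φ (S.p r)).coord)
        rw [hqa, ← OpenPartialHomeomorph.map_coord_branch h i, ← map_map, map_p_nhds hS, hi]
        rfl
      · exact key r (hnc _ hr) ((φ.isCoordOn_sheet i).isCoordAt hr)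
  · obtain ⟨U, hxU, hU⟩ := isCoordAt_of_notMem_crossing hx hc hq
    have hUc : ∀ y ∈ U, y ∉ S.crossing := fun y hy hcr =>
      not_isCoordAt_of_mem_crossing hcr κ _ (hU.isCoordAt hy)
    refine ⟨S.p ⁻¹' U, hxU, hU.isOpen.preimage S.continuous_p, ?_, ?_⟩
    · intro r hr r' hr' he
      exact p_inj (hU.injOn hr hr' he) (hUc _ hr)
    · exact fun r hr => key r (hUc _ hr) (hU.isCoordAt hr)

/-- The changes of coordinates are dianalytic, resp. analytic, along the branches. -/
theorem rel_p (hS : S.IsSurface) {q : S.Normalization} {c c' : NodalChart κ.model X}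
    (hc : c ∈ S.atlas) (hc' : c' ∈ S.atlas) (hq : S.p q ∈ c.source) (hq' : S.p q ∈ c'.source) :
    κ.Rel (fun r => c.coord (S.p r)) (fun r => c'.coord (S.p r)) q := by
  -- The atlas is compatible only off the nodes; along one branch both coordinates extend across the
  -- node, and so does their dependence.
  refine SurfaceKind.Rel.of_punctured (isCoordAt_p hS hc hq) (isCoordAt_p hS hc' hq') ?_
  have h1 : ∀ᶠ r in 𝓝 q, S.p r ∈ c.source ∩ c'.source :=
    S.continuous_p.continuousAt.eventually
      ((c.isOpen_source.inter c'.isOpen_source).mem_nhds ⟨hq, hq'⟩)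
  filter_upwards [nhdsWithin_le_nhds h1, eventually_p_notMem_nodes hS q] with r h1 h2
  have := hS.compatible c hc c' hc' _ h1 h2
  exact ⟨this.1.comp S.continuous_p.continuousAt, this.2.comp S.continuous_p.continuousAt⟩

end Normalization

/-- Surfaces without nodes. -/
structure IsSmooth (A : NodalSurfaceData κ X) : Prop where
  covers : ∀ x : X, ∃ c ∈ A.atlas, x ∈ c.source
  coordOn : ∀ c ∈ A.atlas, IsCoordOn κ.model c.coord c.source
  rel : ∀ c ∈ A.atlas, ∀ c' ∈ A.atlas, ∀ x, x ∈ c.source → x ∈ c'.source →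
    κ.Rel c.coord c'.coord x

theorem IsSmooth.coord {A : NodalSurfaceData κ X} (hA : A.IsSmooth) (c : NodalChart κ.model X)
    (hc : c ∈ A.atlas) (x : X) (hx : x ∈ c.source) : IsCoordAt κ.model c.coord x :=
  (hA.coordOn c hc).isCoordAt hx

theorem IsSmooth.mem_boundary_iff {A : NodalSurfaceData κ X} (hA : A.IsSmooth) {x : X}
    {c : NodalChart κ.model X} (hc : c ∈ A.atlas) (hx : x ∈ c.source) :
    x ∈ A.boundary ↔ c.coord x ∉ interior κ.model := by
  refine ⟨?_, fun h => ⟨c, hc, hx, h⟩⟩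
  rintro ⟨c', hc', hx', h⟩ hi
  exact h ((hA.rel c hc c' hc' x hx hx').mem_interior (hA.coord c hc x hx)
    (hA.coord c' hc' x hx') hi)

theorem IsSurface.isSmooth_of_nodes_eq_empty (hS : S.IsSurface) (hn : S.nodes = ∅) :
    S.IsSmooth where
  covers := hS.covers
  coordOn c hc := by
    cases c with
    | plane φ => exact φ.isCoordOn
    | node a φ h =>
      have h1 : φ.center ∈ S.nodes :=
        crossing_subset_nodes (mem_crossing.2 ⟨_, hc, a, φ, h, rfl, rfl⟩)
      simp [hn] at h1
  rel c hc c' hc' x hx hx' := (hS.compatible c hc c' hc' x ⟨hx, hx'⟩ (by simp [hn])).1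

/-- A chart of the surface composed with the projection, shrunk until it is injective. It lies in
the atlas because `rel_p` compares it with every original chart. -/
theorem exists_normalization_chart (hS : S.IsSurface) {q : S.Normalization}
    {c : NodalChart κ.model X} (hc : c ∈ S.atlas) (hq : S.p q ∈ c.source) :
    ∃ d ∈ S.normalization.atlas, q ∈ d.source ∧
      ∀ r ∈ d.source, S.p r ∈ c.source ∧ d.coord r = c.coord (S.p r) := by
  obtain ⟨U, hqU, hU⟩ := isCoordAt_p hS hc hq
  have hV : IsOpen (U ∩ S.p ⁻¹' c.source) :=
    hU.isOpen.inter (c.isOpen_source.preimage S.continuous_p)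
  have hUV := hU.mono hV inter_subset_left
  obtain ⟨ψ, hψ, hψc⟩ := hUV.exists_chart ⟨hqU, hq⟩
  have hev : ∀ r ∈ ψ.source, (fun r => c.coord (S.p r)) =ᶠ[𝓝 r] fun r => (ψ r : ℂ) := by
    intro r hr
    rw [hψ] at hr
    filter_upwards [hV.mem_nhds hr] with r' hr' using (hψc r' hr').symm
  refine ⟨.plane ψ, ⟨ψ, rfl, fun r hr d hd hrd => ?_⟩, by
    change q ∈ ψ.source
    rw [hψ]; exact ⟨hqU, hq⟩, fun r hr => ?_⟩
  · have hr' : S.p r ∈ c.source := by rw [hψ] at hr; exact hr.2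
    exact ⟨(rel_p hS hd hc hrd hr').congr (EventuallyEq.refl _ _) (hev r hr),
      (rel_p hS hc hd hr' hrd).congr (hev r hr) (EventuallyEq.refl _ _)⟩
  · have hr : r ∈ ψ.source := hr
    rw [hψ] at hr
    exact ⟨hr.2, hψc r hr⟩

theorem isSmooth_normalization (hS : S.IsSurface) : S.normalization.IsSmooth where
  covers q := by
    obtain ⟨c, hc, hq⟩ := hS.covers (S.p q)
    obtain ⟨d, hd, hqd, -⟩ := exists_normalization_chart hS hc hq
    exact ⟨d, hd, hqd⟩
  coordOn := by
    rintro c ⟨ψ, rfl, -⟩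
    exact ψ.isCoordOn
  rel := by
    rintro _ ⟨ψ, rfl, h⟩ _ ⟨ψ', rfl, h'⟩ q hq hq'
    obtain ⟨d, hd, hqd⟩ := hS.covers (S.p q)
    exact (h q hq d hd hqd).2.trans (h' q hq' d hd hqd).1

theorem mem_normalization_boundary_iff (hS : S.IsSurface) {q : S.Normalization}
    {c : NodalChart κ.model X} (hc : c ∈ S.atlas) (hq : S.p q ∈ c.source) :
    q ∈ S.normalization.boundary ↔ c.coord (S.p q) ∉ interior κ.model := by
  obtain ⟨d, hd, hqd, h⟩ := exists_normalization_chart hS hc hq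
  rw [(isSmooth_normalization hS).mem_boundary_iff hd hqd, (h q hqd).2]

/-- Points over different points are separated below; the two points over a node are separated by
the disjoint sheets of a chart. -/
theorem t2Space_normalization (hS : S.IsSurface) : T2Space S.Normalization := by
  have := hS.t2
  refine ⟨fun q r hne => ?_⟩
  by_cases hpq : S.p q = S.p r
  · have hx : S.p q ∈ S.crossing := by
      by_contra hx
      exact hne (p_inj hpq hx)
    obtain ⟨a, φ, h, hc, hce⟩ := exists_node_chart hx
    have hq : S.IsBranch (S.p q) q.1.2 := q.2
    have hr : S.IsBranch (S.p r) r.1.2 := r.2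
    rw [← hce, isBranch_iff_of_node_chart hc] at hq
    rw [← hpq, ← hce, isBranch_iff_of_node_chart hc] at hr
    have aux : ∀ (s : S.Normalization) (i : Bool), S.p s = φ.center → s.1.2 = branchFilter φ i →
        IsOpen (insert s (S.p ⁻¹' φ.sheet i)) := fun s i h1 h2 => by
      refine isOpen_insert_preimage (φ.isOpen_sheet i) (le_principal_iff.2 ?_)
      rw [h2, h1]
      exact self_mem_nhdsWithin
    have hdis : ∀ i j, Disjoint (φ.sheet i) (φ.sheet j) →
        Disjoint (insert q (S.p ⁻¹' φ.sheet i)) (insert r (S.p ⁻¹' φ.sheet j)) := by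
      intro i j hd
      refine disjoint_left.2 ?_
      rintro s (rfl | hs) (h' | hs')
      · exact hne h'
      · exact OpenPartialHomeomorph.center_notMem_sheet h j (hce ▸ hs')
      · subst h'
        exact OpenPartialHomeomorph.center_notMem_sheet h i (hce ▸ hpq ▸ hs)
      · exact disjoint_left.1 hd hs hs'
    have hne2 : q.1.2 ≠ r.1.2 := fun he => hne (Subtype.ext (Prod.ext hpq he))
    rcases hq with hq | hq <;> rcases hr with hr | hr
    · exact (hne2 (hq.trans hr.symm)).elim
    · exact ⟨_, _, aux q _ hce.symm hq, aux r _ (hpq ▸ hce.symm) hr, mem_insert _ _,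
        mem_insert _ _, hdis _ _ φ.disjoint_sheet⟩
    · exact ⟨_, _, aux q _ hce.symm hq, aux r _ (hpq ▸ hce.symm) hr, mem_insert _ _,
        mem_insert _ _, hdis _ _ φ.disjoint_sheet.symm⟩
    · exact (hne2 (hq.trans hr.symm)).elim
  · obtain ⟨U, V, hU, hV, hqU, hrV, hd⟩ := t2_separation hpq
    exact ⟨_, _, hU.preimage S.continuous_p, hV.preimage S.continuous_p, hqU, hrV,
      hd.preimage _⟩

end NodalSurfaceData
end

noncomputable section

/-! ### Foldings, orientations and the coordinates of a double cover. -/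

namespace NodalSurfaceData

variable {Y Z : Type u} [TopologicalSpace Y] [TopologicalSpace Z]
  {R : NodalSurfaceData .riemann Y} {K : NodalSurfaceData .klein Z} {f : Y → Z} {y : Y}

/-- `ζ` is analytically equivalent to the coordinates of the Riemann surface near `y`. -/
def IsAnalyticCoord (R : NodalSurfaceData .riemann Y) (ζ : Y → ℂ) (y : Y) : Prop :=
  ∀ d ∈ R.atlas, y ∈ d.source → AnalyticRel d.coord ζ y ∧ AnalyticRel ζ d.coord y

theorem IsSmooth.isAnalyticCoord (hR : R.IsSmooth) {ζ : Y → ℂ} {d : NodalChart _ Y}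
    (hd : d ∈ R.atlas) (hy : y ∈ d.source) (h : AnalyticRel d.coord ζ y)
    (h' : AnalyticRel ζ d.coord y) : R.IsAnalyticCoord ζ y := fun e he hye =>
  ⟨AnalyticRel.trans (hR.rel e he d hd y hye hy) h,
    AnalyticRel.trans h' (hR.rel d hd e he y hy hye)⟩

theorem IsSmooth.isAnalyticCoord_chart (hR : R.IsSmooth) {d : NodalChart _ Y}
    (hd : d ∈ R.atlas) (hy : y ∈ d.source) : R.IsAnalyticCoord d.coord y :=
  hR.isAnalyticCoord hd hy (AnalyticRel.refl _ _) (AnalyticRel.refl _ _)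

theorem IsAnalyticCoord.isCoordAt {ζ : Y → ℂ} (h : R.IsAnalyticCoord ζ y) (hR : R.IsSmooth) :
    IsCoordAt univ ζ y := by
  obtain ⟨d, hd, hy⟩ := hR.covers y
  exact (hR.coord d hd y hy).of_analyticRel (h d hd hy).1 (h d hd hy).2

theorem IsAnalyticCoord.rel {ζ ξ : Y → ℂ} (h : R.IsAnalyticCoord ζ y)
    (h' : R.IsAnalyticCoord ξ y) (hR : R.IsSmooth) : AnalyticRel ζ ξ y := by
  obtain ⟨d, hd, hy⟩ := hR.covers y
  exact (h d hd hy).2.trans (h' d hd hy).1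

theorem IsAnalyticCoord.congr {ζ ξ : Y → ℂ} (h : R.IsAnalyticCoord ζ y) (he : ζ =ᶠ[𝓝 y] ξ) :
    R.IsAnalyticCoord ξ y := fun d hd hy =>
  ⟨(h d hd hy).1.congr (EventuallyEq.refl _ _) he, (h d hd hy).2.congr he (EventuallyEq.refl _ _)⟩

theorem IsAnalyticCoord.trans {ζ ξ : Y → ℂ} (h : R.IsAnalyticCoord ζ y)
    (h1 : AnalyticRel ζ ξ y) (h2 : AnalyticRel ξ ζ y) : R.IsAnalyticCoord ξ y :=
  fun d hd hy => ⟨(h d hd hy).1.trans h1, h2.trans (h d hd hy).2⟩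

theorem IsAnalyticCoord.eventually {ζ : Y → ℂ} (h : R.IsAnalyticCoord ζ y) (hR : R.IsSmooth) :
    ∀ᶠ y' in 𝓝 y, R.IsAnalyticCoord ζ y' := by
  obtain ⟨d, hd, hy⟩ := hR.covers y
  filter_upwards [(h d hd hy).1.eventually (hR.coord d hd y hy).continuousAt,
    (h d hd hy).2.eventually (h.isCoordAt hR).continuousAt, d.isOpen_source.mem_nhds hy]
    with y' h1 h2 h3
  exact hR.isAnalyticCoord hd h3 h1 h2

theorem IsSmooth.im_pos (hK : K.IsSmooth) {c : NodalChart _ Z} (hc : c ∈ K.atlas) {z : Z}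
    (hz : z ∈ c.source) (hb : z ∉ K.boundary) : 0 < (c.coord z).im := by
  rw [hK.mem_boundary_iff hc hz, not_not, SurfaceKind.interior_klein] at hb
  exact hb

theorem IsSmooth.im_eq_zero (hK : K.IsSmooth) {c : NodalChart _ Z} (hc : c ∈ K.atlas) {z : Z}
    (hz : z ∈ c.source) (hb : z ∈ K.boundary) : (c.coord z).im = 0 := by
  rw [hK.mem_boundary_iff hc hz, SurfaceKind.interior_klein] at hb
  exact le_antisymm (not_lt.1 hb) (hK.coord c hc _ hz).mem

/-- The relation is given only on the half plane; since that accumulates at `w`, the identity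
theorem extends it to a full neighbourhood. -/
theorem _root_.AnalyticAt.eventually_left_inverse {G G' : ℂ → ℂ} {w : ℂ} (hG : AnalyticAt ℂ G w)
    (hG' : AnalyticAt ℂ G' (G w)) (hw : w ∈ SurfaceKind.klein.model)
    (h : ∀ᶠ z in 𝓝[SurfaceKind.klein.model] w, G' (G z) = z) : ∀ᶠ z in 𝓝 w, G' (G z) = z := by
  have h1 : AnalyticAt ℂ (fun z => G' (G z)) w := AnalyticAt.comp hG' hG
  refine (AnalyticAt.frequently_eq_iff_eventually_eq h1 analyticAt_id).1 ?_
  have := SurfaceKind.neBot_diff hw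
  refine Frequently.filter_mono (f := 𝓝[SurfaceKind.klein.model \ {w}] w) ?_
    (nhdsWithin_mono _ fun z hz => hz.2)
  exact Eventually.frequently (nhdsWithin_mono _ sdiff_subset h)

theorem _root_.halfPlaneFold_im_eq_zero {z : ℂ} : (halfPlaneFold z).im = 0 ↔ z.im = 0 :=
  abs_eq_zero

theorem _root_.eq_halfPlaneFold {z w : ℂ} (hz : 0 ≤ z.im) (h : z = w ∨ z = conj w) :
    z = halfPlaneFold w := by
  rcases h with rfl | rfl
  · rw [halfPlaneFold_of_nonneg hz]
  · rw [← halfPlaneFold_conj, halfPlaneFold_of_nonneg hz]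

theorem _root_.eventually_halfPlaneFold_eq {ζ : Y → ℂ} (hζ : ContinuousAt ζ y)
    (h : 0 < (ζ y).im) : ∀ᶠ y' in 𝓝 y, halfPlaneFold (ζ y') = ζ y' := by
  have : ∀ᶠ y' in 𝓝 y, 0 < (ζ y').im :=
    (Complex.continuous_im.continuousAt.comp hζ).eventually (lt_mem_nhds h)
  exact this.mono fun y' h' => halfPlaneFold_of_nonneg h'.le

theorem _root_.eventually_halfPlaneFold_eq_conj {ζ : Y → ℂ} (hζ : ContinuousAt ζ y)
    (h : (ζ y).im < 0) : ∀ᶠ y' in 𝓝 y, halfPlaneFold (ζ y') = conj (ζ y') := by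
  have : ∀ᶠ y' in 𝓝 y, (ζ y').im < 0 :=
    (Complex.continuous_im.continuousAt.comp hζ).eventually (gt_mem_nhds h)
  exact this.mono fun y' h' => halfPlaneFold_of_nonpos h'.le

/-- Changes of coordinates of a Klein surface, in terms of the folding. -/
theorem IsSmooth.exists_transition (hK : K.IsSmooth) {c c' : NodalChart _ Z} (hc : c ∈ K.atlas)
    (hc' : c' ∈ K.atlas) {z : Z} (hz : z ∈ c.source) (hz' : z ∈ c'.source) :
    ∃ G G' : ℂ → ℂ, AnalyticAt ℂ G (c'.coord z) ∧ AnalyticAt ℂ G' (G (c'.coord z)) ∧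
      (∀ᶠ w in 𝓝 (c'.coord z), G' (G w) = w) ∧
      (∀ᶠ x in 𝓝 z, c.coord x = halfPlaneFold (G (c'.coord x))) ∧
      ((c'.coord z).im = 0 → ∀ᶠ w in 𝓝 (c'.coord z), G (conj w) = conj (G w)) := by
  have hcc := hK.coord c hc z hz
  have hcc' := hK.coord c' hc' z hz'
  have hr := hK.rel c' hc' c hc z hz' hz
  have hr' := hK.rel c hc c' hc' z hz hz'
  -- For an antianalytic transition, `G` is its conjugate; the folding does not see the difference,
  -- so both cases are treated together from here on.
  obtain ⟨G, hG, hcG, G', hG', hGG'⟩ : ∃ G : ℂ → ℂ, AnalyticAt ℂ G (c'.coord z) ∧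
      (∀ᶠ x in 𝓝 z, c.coord x = G (c'.coord x) ∨ c.coord x = conj (G (c'.coord x))) ∧
      ∃ G' : ℂ → ℂ, AnalyticAt ℂ G' (G (c'.coord z)) ∧
        ∀ᶠ x in 𝓝 z, c'.coord x = G' (G (c'.coord x)) := by
    rcases hr with h | h
    · obtain ⟨G', hG', h2⟩ := h.symm_of_rel hcc' hr'
      obtain ⟨G, hG, h1⟩ := h
      refine ⟨G, hG, h1.mono fun x hx => Or.inl hx, G', h1.self_of_nhds ▸ hG', ?_⟩
      filter_upwards [h1, h2] with x h1 h2
      rw [← h1, h2]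
    · have h3 := h.symm_of_rel hcc' hr'
      obtain ⟨G, hG, h1⟩ := h
      obtain ⟨G', hG', h2⟩ := antianalyticRel_iff.1 h3
      have h1' : ∀ᶠ x in 𝓝 z, conj (c.coord x) = G (c'.coord x) :=
        h1.mono fun x hx => by rw [hx, Complex.conj_conj]
      refine ⟨G, hG, h1.mono fun x hx => Or.inr hx, fun w => conj (G' (conj w)), ?_, ?_⟩
      · apply AnalyticAt.conj_conj'
        rw [← h1'.self_of_nhds, Complex.conj_conj]
        exact hG'
      · filter_upwards [h1', h2] with x h1 h2
        rw [← h1, Complex.conj_conj, ← h2, Complex.conj_conj]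
  have hfold : ∀ᶠ x in 𝓝 z, c.coord x = halfPlaneFold (G (c'.coord x)) := by
    filter_upwards [hcG, hcc.eventually] with x h1 h2
    exact eq_halfPlaneFold h2.mem h1
  refine ⟨G, G', hG, hG', ?_, hfold, fun him => ?_⟩
  · refine hG.eventually_left_inverse hG' hcc'.mem ?_
    rw [← hcc'.map_nhds]
    exact hGG'.mono fun x hx => hx.symm
  -- The transition sends boundary points to boundary points, so `G` is real on the axis.
  · refine hG.eventually_conj him ?_
    rw [← hcc'.map_nhds]
    change ∀ᶠ x in 𝓝 z, _
    filter_upwards [hfold, c.isOpen_source.mem_nhds hz, c'.isOpen_source.mem_nhds hz']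
      with x h1 h2 h3 h4
    rw [← halfPlaneFold_im_eq_zero, ← h1]
    by_contra h5
    have h6 : c.coord x ∈ interior SurfaceKind.klein.model := by
      rw [SurfaceKind.interior_klein]
      exact lt_of_le_of_ne (hK.coord c hc x h2).mem (Ne.symm h5)
    have h7 := (hK.rel c hc c' hc' x h2 h3).mem_interior (hK.coord c hc x h2)
      (hK.coord c' hc' x h3) h6
    rw [SurfaceKind.interior_klein] at h7
    exact (show 0 < (c'.coord x).im from h7).ne' h4

/-- A fold in one chart is a fold in every chart. -/
theorem exists_fold_coord (hR : R.IsSmooth) (hK : K.IsSmooth) (hf : ContinuousAt f y)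
    (h : IsUnbranchedAt R K f y) {c : NodalChart _ Z} (hc : c ∈ K.atlas) (hy : f y ∈ c.source) :
    ∃ ζ, R.IsAnalyticCoord ζ y ∧ ∀ᶠ y' in 𝓝 y, c.coord (f y') = halfPlaneFold (ζ y') := by
  obtain ⟨d, hd, c', hc', hyd, hyc', F, hF, hF0, hfold⟩ := h
  obtain ⟨G, G', hG, hG', hGG', hcG, hreal⟩ := hK.exists_transition hc hc' hy hyc'
  have hdc := (hR.coord d hd y hyd).continuousAt
  set ζ₀ : Y → ℂ := fun y' => F (d.coord y') with hζ₀
  have hdζ : AnalyticRel d.coord ζ₀ y := ⟨F, hF, Eventually.of_forall fun _ => rfl⟩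
  have hζd : AnalyticRel ζ₀ d.coord y :=
    analyticRel_symm_of_deriv_ne_zero hF hF0 hdc (Eventually.of_forall fun _ => rfl)
  have hco : R.IsAnalyticCoord ζ₀ y := hR.isAnalyticCoord hd hyd hdζ hζd
  have hζc : ContinuousAt ζ₀ y := (hco.isCoordAt hR).continuousAt
  have hcf : ∀ᶠ y' in 𝓝 y, c.coord (f y') = halfPlaneFold (G (halfPlaneFold (ζ₀ y'))) := by
    filter_upwards [hf.eventually hcG, hfold] with y' h1 h2
    rw [h1, h2]
  have hw : c'.coord (f y) = halfPlaneFold (ζ₀ y) := hfold.self_of_nhds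
  -- composing with `G` is a change of coordinates
  have hcomp : ∀ η : Y → ℂ, ContinuousAt η y → η y = c'.coord (f y) →
      AnalyticRel η (fun y' => G (η y')) y ∧ AnalyticRel (fun y' => G (η y')) η y := by
    intro η hη he
    refine ⟨⟨G, by rwa [he], Eventually.of_forall fun _ => rfl⟩, G', ?_, ?_⟩
    · simpa [he] using hG'
    · have h1 : Tendsto η (𝓝 y) (𝓝 (c'.coord (f y))) := by rw [← he]; exact hη
      exact (h1.eventually hGG').mono fun y' h => h.symm
  -- Below the axis the folding is conjugation, and `G` has to be conjugated on both sides. Above it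
  -- the folding disappears. On the axis `G` commutes with conjugation, hence passes through the
  -- folding.
  rcases lt_or_ge (ζ₀ y).im 0 with hneg | hnn
  · have he : conj (ζ₀ y) = c'.coord (f y) := by rw [hw, halfPlaneFold_of_nonpos hneg.le]
    obtain ⟨h1, h2⟩ := hcomp (fun y' => conj (ζ₀ y'))
      (Complex.continuous_conj.continuousAt.comp hζc) he
    refine ⟨fun y' => conj (G (conj (ζ₀ y'))), hco.trans ?_ ?_, ?_⟩
    · simpa using h1.conj_conj
    · simpa using h2.conj_conj
    · filter_upwards [hcf, eventually_halfPlaneFold_eq_conj hζc hneg] with y' h1 h2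
      rw [h1, h2, halfPlaneFold_conj]
  · have he : ζ₀ y = c'.coord (f y) := by rw [hw, halfPlaneFold_of_nonneg hnn]
    obtain ⟨h1, h2⟩ := hcomp ζ₀ hζc he
    refine ⟨fun y' => G (ζ₀ y'), hco.trans h1 h2, ?_⟩
    rcases hnn.lt_or_eq with hpos | h0
    · filter_upwards [hcf, eventually_halfPlaneFold_eq hζc hpos] with y' h1 h2
      rw [h1, h2]
    · have h3 := hreal (by rw [← he]; exact h0.symm)
      have h4 : Tendsto ζ₀ (𝓝 y) (𝓝 (c'.coord (f y))) := by rw [← he]; exact hζc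
      filter_upwards [hcf, h4.eventually h3] with y' h5 h6
      rw [h5]
      rcases halfPlaneFold_eq_or (ζ₀ y') with h7 | h7
      · rw [h7]
      · rw [h7, h6, halfPlaneFold_conj]

/-- The chart `c` is positively oriented at `y`. -/
def IsPos (R : NodalSurfaceData .riemann Y) (f : Y → Z) (c : NodalChart SurfaceKind.klein.model Z)
    (y : Y) : Prop :=
  ∃ d ∈ R.atlas, y ∈ d.source ∧ AnalyticRel d.coord (fun y' => c.coord (f y')) y

open Classical in
/-- The coordinate on the covering surface whose folding is the coordinate `c`. -/
def doubleCoord (R : NodalSurfaceData .riemann Y) (f : Y → Z)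
    (c : NodalChart SurfaceKind.klein.model Z) (y : Y) : ℂ :=
  if R.IsPos f c y then c.coord (f y) else conj (c.coord (f y))

theorem doubleCoord_of_isPos {c : NodalChart SurfaceKind.klein.model Z} (h : R.IsPos f c y) :
    R.doubleCoord f c y = c.coord (f y) := if_pos h

theorem doubleCoord_of_not_isPos {c : NodalChart SurfaceKind.klein.model Z}
    (h : ¬ R.IsPos f c y) : R.doubleCoord f c y = conj (c.coord (f y)) := if_neg h

theorem halfPlaneFold_doubleCoord (hK : K.IsSmooth) {c : NodalChart SurfaceKind.klein.model Z}
    (hc : c ∈ K.atlas) (hy : f y ∈ c.source) :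
    halfPlaneFold (R.doubleCoord f c y) = c.coord (f y) := by
  have h0 : 0 ≤ (c.coord (f y)).im := (hK.coord c hc _ hy).mem
  by_cases h : R.IsPos f c y
  · rw [doubleCoord_of_isPos h, halfPlaneFold_of_nonneg h0]
  · rw [doubleCoord_of_not_isPos h, halfPlaneFold_conj, halfPlaneFold_of_nonneg h0]

/-- The pointwise definition by orientation recovers any analytic coordinate that folds to `c`. Off
the axis the sign of the imaginary part decides the orientation; on the axis both formulas give the
same real value. Hence `doubleCoord` is itself analytic. -/
theorem doubleCoord_eventuallyEq (hR : R.IsSmooth) {c : NodalChart SurfaceKind.klein.model Z}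
    {ζ : Y → ℂ} (hζ : R.IsAnalyticCoord ζ y)
    (h : ∀ᶠ y' in 𝓝 y, c.coord (f y') = halfPlaneFold (ζ y')) :
    R.doubleCoord f c =ᶠ[𝓝 y] ζ := by
  filter_upwards [hζ.eventually hR, h.eventually_nhds] with y' h1 h2
  have hco := h1.isCoordAt hR
  obtain ⟨d, hd, hy⟩ := hR.covers y'
  rcases lt_trichotomy (ζ y').im 0 with him | him | him
  · have h3 := eventually_halfPlaneFold_eq_conj hco.continuousAt him
    have h4 : (fun z => c.coord (f z)) =ᶠ[𝓝 y'] fun z => conj (ζ z) := by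
      filter_upwards [h2, h3] with z h5 h6
      rw [h5, h6]
    have hn : ¬ R.IsPos f c y' := by
      rintro ⟨d, hd, hy, hr⟩
      have h5 := hr.congr (EventuallyEq.refl _ _) h4
      exact IsCoordAt.not_antianalyticRel_self (κ := .riemann) hco
        ((h1 d hd hy).2.trans_anti (antianalyticRel_iff.2 h5))
    rw [doubleCoord_of_not_isPos hn, show c.coord (f y') = conj (ζ y') from h4.self_of_nhds,
      Complex.conj_conj]
  · have h3 : c.coord (f y') = ζ y' := by
      rw [h2.self_of_nhds, halfPlaneFold_of_nonneg him.ge]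
    by_cases hp : R.IsPos f c y'
    · rw [doubleCoord_of_isPos hp, h3]
    · rw [doubleCoord_of_not_isPos hp, h3, Complex.conj_eq_iff_im.2 him]
  · have h3 := eventually_halfPlaneFold_eq hco.continuousAt him
    have h4 : (fun z => c.coord (f z)) =ᶠ[𝓝 y'] ζ := by
      filter_upwards [h2, h3] with z h5 h6
      rw [h5, h6]
    have hp : R.IsPos f c y' :=
      ⟨d, hd, hy, (h1 d hd hy).1.congr (EventuallyEq.refl _ _) h4.symm⟩
    rw [doubleCoord_of_isPos hp]
    exact h4.self_of_nhds

/-- `f` is an unbranched double cover of a smooth Klein surface by a smooth Riemann surface. -/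
structure IsFolding (R : NodalSurfaceData .riemann Y) (K : NodalSurfaceData .klein Z)
    (f : Y → Z) : Prop where
  smooth : R.IsSmooth
  smooth_base : K.IsSmooth
  cover : IsUnbranchedDoubleCover R K f

namespace IsFolding

variable {c c' : NodalChart SurfaceKind.klein.model Z}

theorem isAnalyticCoord (h : IsFolding R K f) (hc : c ∈ K.atlas) (hy : f y ∈ c.source) :
    R.IsAnalyticCoord (R.doubleCoord f c) y := by
  obtain ⟨ζ, hζ, hev⟩ := exists_fold_coord h.smooth h.smooth_base h.cover.continuous.continuousAt
    (h.cover.unbranched y) hc hy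
  exact hζ.congr (doubleCoord_eventuallyEq h.smooth hζ hev).symm

theorem isCoordAt (h : IsFolding R K f) (hc : c ∈ K.atlas) (hy : f y ∈ c.source) :
    IsCoordAt univ (R.doubleCoord f c) y :=
  (h.isAnalyticCoord hc hy).isCoordAt h.smooth

theorem eventually_mem (h : IsFolding R K f) (hy : f y ∈ c.source) :
    ∀ᶠ y' in 𝓝 y, f y' ∈ c.source :=
  h.cover.continuous.continuousAt.eventually (c.isOpen_source.mem_nhds hy)

theorem eventuallyEq_of_isPos (h : IsFolding R K f) (hc : c ∈ K.atlas) (hy : f y ∈ c.source)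
    (hb : f y ∉ K.boundary) (hp : R.IsPos f c y) : (fun y' => c.coord (f y')) =ᶠ[𝓝 y] R.doubleCoord f c := by
  have h1 : 0 < (R.doubleCoord f c y).im := by
    rw [doubleCoord_of_isPos hp]; exact h.smooth_base.im_pos hc hy hb
  filter_upwards [eventually_halfPlaneFold_eq (h.isCoordAt hc hy).continuousAt h1,
    h.eventually_mem hy] with y' h2 h3
  rw [← h2, halfPlaneFold_doubleCoord h.smooth_base hc h3]

theorem eventuallyEq_of_not_isPos (h : IsFolding R K f) (hc : c ∈ K.atlas) (hy : f y ∈ c.source)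
    (hb : f y ∉ K.boundary) (hp : ¬ R.IsPos f c y) :
    (fun y' => c.coord (f y')) =ᶠ[𝓝 y] fun y' => conj (R.doubleCoord f c y') := by
  have h1 : (R.doubleCoord f c y).im < 0 := by
    rw [doubleCoord_of_not_isPos hp]
    simpa using h.smooth_base.im_pos hc hy hb
  filter_upwards [eventually_halfPlaneFold_eq_conj (h.isCoordAt hc hy).continuousAt h1,
    h.eventually_mem hy] with y' h2 h3
  rw [← h2, halfPlaneFold_doubleCoord h.smooth_base hc h3]

theorem analyticRel_of_isPos (h : IsFolding R K f) {d : NodalChart _ Y} (hd : d ∈ R.atlas)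
    (hyd : y ∈ d.source) (hc : c ∈ K.atlas) (hy : f y ∈ c.source) (hb : f y ∉ K.boundary)
    (hp : R.IsPos f c y) :
    AnalyticRel d.coord (fun y' => c.coord (f y')) y :=
  (h.isAnalyticCoord hc hy d hd hyd).1.congr (EventuallyEq.refl _ _)
    (h.eventuallyEq_of_isPos hc hy hb hp).symm

theorem antianalyticRel_of_not_isPos (h : IsFolding R K f) {d : NodalChart _ Y} (hd : d ∈ R.atlas)
    (hyd : y ∈ d.source) (hc : c ∈ K.atlas) (hy : f y ∈ c.source) (hb : f y ∉ K.boundary)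
    (hp : ¬ R.IsPos f c y) : AntianalyticRel d.coord (fun y' => c.coord (f y')) y :=
  (antianalyticRel_conj_iff.2 (h.isAnalyticCoord hc hy d hd hyd).1).congr (EventuallyEq.refl _ _)
    (h.eventuallyEq_of_not_isPos hc hy hb hp).symm

theorem not_isPos_of_antianalyticRel (h : IsFolding R K f) {d : NodalChart _ Y} (hd : d ∈ R.atlas)
    (hyd : y ∈ d.source) (hc : c ∈ K.atlas) (hy : f y ∈ c.source) (hb : f y ∉ K.boundary)
    (ha : AntianalyticRel d.coord (fun y' => c.coord (f y')) y) : ¬ R.IsPos f c y := by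
  intro hp
  have h1 := h.analyticRel_of_isPos hd hyd hc hy hb hp
  have h2 : AnalyticRel (fun y' => c.coord (f y')) d.coord y :=
    (h.isAnalyticCoord hc hy d hd hyd).2.congr (h.eventuallyEq_of_isPos hc hy hb hp).symm
      (EventuallyEq.refl _ _)
  exact (h.smooth.coord d hd y hyd).not_analytic_and_antianalytic (Or.inl h2) h1 ha

/-- Antianalytic maps over the base reverse the orientation. -/
theorem isPos_antianalytic (h : IsFolding R K f) {τ : Y → Y} (hτ : ContinuousAt τ y)
    (hfτ : ∀ᶠ y' in 𝓝 y, f (τ y') = f y') {d d' : NodalChart _ Y} (hd : d ∈ R.atlas)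
    (hyd : y ∈ d.source) (hd' : d' ∈ R.atlas) (hyd' : τ y ∈ d'.source)
    (ha : AntianalyticRel d.coord (fun y' => d'.coord (τ y')) y) (hc : c ∈ K.atlas)
    (hy : f y ∈ c.source) (hb : f y ∉ K.boundary) : R.IsPos f c (τ y) ↔ ¬ R.IsPos f c y := by
  have e : f (τ y) = f y := hfτ.self_of_nhds
  have hcong : (fun y' => c.coord (f (τ y'))) =ᶠ[𝓝 y] fun y' => c.coord (f y') :=
    hfτ.mono fun y' h' => by simp only [h']
  constructor
  · intro hp
    have h1 := (h.analyticRel_of_isPos hd' hyd' hc (e ▸ hy) (e ▸ hb) hp).comp hτ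
    exact h.not_isPos_of_antianalyticRel hd hyd hc hy hb
      ((ha.trans h1).congr (EventuallyEq.refl _ _) hcong)
  · intro hp
    by_contra hp'
    have h1 := (h.antianalyticRel_of_not_isPos hd' hyd' hc (e ▸ hy) (e ▸ hb) hp').comp hτ
    exact hp ⟨d, hd, hyd, (ha.trans_anti h1).congr (EventuallyEq.refl _ _) hcong⟩

/-- Orientations behave like signs: passing to another chart multiplies by the sign of the
transition, positive when it is analytic. -/
theorem isPos_iff_of_analyticRel (h : IsFolding R K f) (hc : c ∈ K.atlas) (hc' : c' ∈ K.atlas)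
    (hy : f y ∈ c.source) (hy' : f y ∈ c'.source) (hb : f y ∉ K.boundary) :
    R.IsPos f c' y ↔ (R.IsPos f c y ↔ AnalyticRel c.coord c'.coord (f y)) := by
  have hcont := h.cover.continuous.continuousAt (x := y)
  obtain ⟨d, hd, hyd⟩ := h.smooth.covers y
  have hrel := h.smooth_base.rel c hc c' hc' _ hy hy'
  have hrel' := h.smooth_base.rel c' hc' c hc _ hy' hy
  have hco := h.smooth_base.coord c hc _ hy
  by_cases ha : AnalyticRel c.coord c'.coord (f y)
  · have ha' := ha.symm_of_rel hco hrel'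
    simp only [ha, iff_true]
    constructor
    · rintro ⟨d, hd, hyd, hr⟩
      exact ⟨d, hd, hyd, hr.trans (ha'.comp hcont)⟩
    · rintro ⟨d, hd, hyd, hr⟩
      exact ⟨d, hd, hyd, hr.trans (ha.comp hcont)⟩
  · have hb' : AntianalyticRel c.coord c'.coord (f y) := Or.resolve_left hrel ha
    simp only [ha, iff_false]
    constructor
    · intro hp hp'
      exact h.not_isPos_of_antianalyticRel hd hyd hc' hy' hb
        ((h.analyticRel_of_isPos hd hyd hc hy hb hp').trans_anti (hb'.comp hcont)) hp
    · intro hp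
      exact ⟨d, hd, hyd,
        (h.antianalyticRel_of_not_isPos hd hyd hc hy hb hp).trans_anti (hb'.comp hcont)⟩

theorem isPos_iff_im_pos (hK : K.IsSmooth) (hc : c ∈ K.atlas) (hy : f y ∈ c.source)
    (hb : f y ∉ K.boundary) : R.IsPos f c y ↔ 0 < (R.doubleCoord f c y).im := by
  have h0 := hK.im_pos hc hy hb
  by_cases hp : R.IsPos f c y
  · simp [hp, doubleCoord_of_isPos hp, h0]
  · simp [hp, doubleCoord_of_not_isPos hp, h0.le]

end IsFolding

/-- The two points over an interior point have opposite orientations. -/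
structure IsOrientedDouble (R : NodalSurfaceData .riemann Y) (K : NodalSurfaceData .klein Z)
    (f : Y → Z) : Prop extends IsFolding R K f where
  injOn : ∀ c ∈ K.atlas, InjOn (R.doubleCoord f c) (f ⁻¹' c.source)

theorem _root_.Set.encard_eq_two_unique {α : Type*} {s : Set α} (hs : s.encard = 2) {a b c : α}
    (ha : a ∈ s) (hb : b ∈ s) (hc : c ∈ s) (hab : a ≠ b) (hac : a ≠ c) : b = c := by
  obtain ⟨x, y, hxy, rfl⟩ := encard_eq_two.1 hs
  simp only [mem_insert_iff, mem_singleton_iff] at ha hb hc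
  rcases ha with rfl | rfl <;> rcases hb with rfl | rfl <;> rcases hc with rfl | rfl <;>
    simp_all

theorem _root_.Set.encard_eq_one_unique {α : Type*} {s : Set α} (hs : s.encard = 1) {a b : α}
    (ha : a ∈ s) (hb : b ∈ s) : a = b := by
  obtain ⟨x, rfl⟩ := encard_eq_one.1 hs
  rw [mem_singleton_iff] at ha hb
  rw [ha, hb]

/-- A change of chart alters the orientation at both points of a fibre in the same way, so
opposition in one chart suffices. In any chart the two values of `doubleCoord` then lie on different
sides of the axis. -/
theorem IsFolding.isOrientedDouble (h : IsFolding R K f)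
    (hopp : ∀ y y', f y = f y' → f y ∉ K.boundary → y ≠ y' →
      ∃ c ∈ K.atlas, f y ∈ c.source ∧ (R.IsPos f c y' ↔ ¬ R.IsPos f c y)) :
    IsOrientedDouble R K f where
  toIsFolding := h
  injOn c hc y hy y' hy' he := by
    have hff : f y = f y' := by
      refine (h.smooth_base.coordOn c hc).injOn hy hy' ?_
      rw [← halfPlaneFold_doubleCoord (R := R) h.smooth_base hc hy, he,
        halfPlaneFold_doubleCoord h.smooth_base hc hy']
    by_cases hb : f y ∈ K.boundary
    · exact encard_eq_one_unique (h.cover.boundary_fiber _ hb) rfl hff.symm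
    · by_contra hne
      obtain ⟨c', hc', hyc', hp⟩ := hopp y y' hff hb hne
      have h1 := IsFolding.isPos_iff_im_pos (R := R) h.smooth_base hc hy hb
      have h2 := IsFolding.isPos_iff_im_pos (R := R) h.smooth_base hc hy' (hff ▸ hb)
      rw [← he, ← h1] at h2
      have h3 := h.isPos_iff_of_analyticRel hc hc' hy hyc' hb
      have h4 := h.isPos_iff_of_analyticRel hc hc' hy' (hff ▸ hyc') (hff ▸ hb)
      rw [← hff, h2] at h4
      rw [h4, ← h3] at hp
      tauto

end NodalSurfaceData
end

noncomputable section

/-! ### Uniqueness of the oriented double of a surface without nodes. -/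

namespace NodalSurfaceData

theorem boundary_riemann {Y : Type u} [TopologicalSpace Y] (R : NodalSurfaceData .riemann Y) :
    R.boundary = ∅ := by
  refine eq_empty_of_forall_notMem ?_
  rintro y ⟨c, -, -, h⟩
  simp [SurfaceKind.interior_riemann] at h

theorem boundaryNodes_riemann {Y : Type u} [TopologicalSpace Y]
    (R : NodalSurfaceData .riemann Y) : R.boundaryNodes = ∅ := by
  refine eq_empty_of_forall_notMem ?_
  rintro y ⟨a, φ, h, -, h', -⟩
  simp [SurfaceKind.interior_riemann] at h'

section Comparison

variable {Y Y₁ Y₂ Z : Type u} [TopologicalSpace Y] [TopologicalSpace Y₁] [TopologicalSpace Y₂]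
  [TopologicalSpace Z] {R : NodalSurfaceData .riemann Y} {R₁ : NodalSurfaceData .riemann Y₁}
  {R₂ : NodalSurfaceData .riemann Y₂} {K : NodalSurfaceData .klein Z} {f : Y → Z} {f₁ : Y₁ → Z}
  {f₂ : Y₂ → Z} {c c' : NodalChart SurfaceKind.klein.model Z}

theorem IsFolding.surjective (h : IsFolding R K f) : Function.Surjective f := by
  intro z
  by_cases hb : z ∈ K.boundary
  · obtain ⟨y, hy⟩ := encard_eq_one.1 (h.cover.boundary_fiber z hb)
    exact ⟨y, (hy ▸ mem_singleton y : y ∈ f ⁻¹' {z})⟩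
  · obtain ⟨y, y', -, hy⟩ := encard_eq_two.1 (h.cover.interior_fiber z hb)
    exact ⟨y, (hy ▸ mem_insert y _ : y ∈ f ⁻¹' {z})⟩

theorem doubleCoord_eq_or (R : NodalSurfaceData .riemann Y) (f : Y → Z)
    (c : NodalChart SurfaceKind.klein.model Z) (y : Y) :
    R.doubleCoord f c y = c.coord (f y) ∨ R.doubleCoord f c y = conj (c.coord (f y)) := by
  by_cases h : R.IsPos f c y
  exacts [Or.inl (doubleCoord_of_isPos h), Or.inr (doubleCoord_of_not_isPos h)]

/-- Over an interior point the two different values of `doubleCoord` exhaust the two numbers folding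
to the value of `c`; over a boundary point that number is real and unique. -/
theorem IsOrientedDouble.exists_point (h : IsOrientedDouble R K f) (hc : c ∈ K.atlas) {z : Z}
    (hz : z ∈ c.source) {v : ℂ} (hv : halfPlaneFold v = c.coord z) :
    ∃ y, f y = z ∧ R.doubleCoord f c y = v := by
  have hv' : v = c.coord z ∨ v = conj (c.coord z) := by
    rw [← hv]
    rcases halfPlaneFold_eq_or v with h | h
    · exact Or.inl h.symm
    · right; rw [h, Complex.conj_conj]
  by_cases hb : z ∈ K.boundary
  · obtain ⟨y, rfl⟩ := h.surjective z
    have h0 := h.smooth_base.im_eq_zero hc hz hb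
    have h1 := Complex.conj_eq_iff_im.2 h0
    refine ⟨y, rfl, ?_⟩
    rcases doubleCoord_eq_or R f c y with h2 | h2 <;> rcases hv' with h3 | h3 <;>
      simp [h2, h3, h1]
  · obtain ⟨y, y', hne, hy⟩ := encard_eq_two.1 (h.cover.interior_fiber z hb)
    have e : f y = z := (hy ▸ mem_insert y _ : y ∈ f ⁻¹' {z})
    have e' : f y' = z := (hy ▸ mem_insert_of_mem _ rfl : y' ∈ f ⁻¹' {z})
    have hne' : R.doubleCoord f c y ≠ R.doubleCoord f c y' := fun he =>
      hne (h.injOn c hc (by rwa [mem_preimage, e]) (by rwa [mem_preimage, e']) he)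
    have h1 := doubleCoord_eq_or R f c y
    have h2 := doubleCoord_eq_or R f c y'
    rw [e] at h1
    rw [e'] at h2
    by_cases h3 : R.doubleCoord f c y = v
    · exact ⟨y, e, h3⟩
    · refine ⟨y', e', ?_⟩
      rcases h1 with h1 | h1 <;> rcases h2 with h2 | h2 <;> rcases hv' with h4 | h4 <;>
        simp_all

/-- Agreement of orientations at points of two doubles does not depend on the chart, because the
same transition sign occurs on both sides. So matching points by their coordinate is well defined.
-/
theorem IsFolding.doubleCoord_change (h₁ : IsFolding R₁ K f₁) (h₂ : IsFolding R₂ K f₂)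
    {y₁ : Y₁} {y₂ : Y₂} (hf : f₁ y₁ = f₂ y₂) (hc : c ∈ K.atlas) (hc' : c' ∈ K.atlas)
    (hy : f₁ y₁ ∈ c.source) (hy' : f₁ y₁ ∈ c'.source)
    (he : R₁.doubleCoord f₁ c y₁ = R₂.doubleCoord f₂ c y₂) :
    R₁.doubleCoord f₁ c' y₁ = R₂.doubleCoord f₂ c' y₂ := by
  by_cases hb : f₁ y₁ ∈ K.boundary
  · have h1 := Complex.conj_eq_iff_im.2 (h₁.smooth_base.im_eq_zero hc' hy' hb)
    have e1 := doubleCoord_eq_or R₁ f₁ c' y₁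
    have e2 := doubleCoord_eq_or R₂ f₂ c' y₂
    rw [← hf] at e2
    rw [h1, or_self] at e1 e2
    rw [e1, e2]
  · have p1 := IsFolding.isPos_iff_im_pos (R := R₁) h₁.smooth_base hc hy hb
    have p2 := IsFolding.isPos_iff_im_pos (R := R₂) h₂.smooth_base hc (hf ▸ hy) (hf ▸ hb)
    have q1 := h₁.isPos_iff_of_analyticRel hc hc' hy hy' hb
    have q2 := h₂.isPos_iff_of_analyticRel hc hc' (hf ▸ hy) (hf ▸ hy') (hf ▸ hb)
    rw [p2, ← he, ← p1, ← hf, ← q1] at q2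
    by_cases hp : R₁.IsPos f₁ c' y₁
    · rw [doubleCoord_of_isPos hp, doubleCoord_of_isPos (q2.2 hp), hf]
    · rw [doubleCoord_of_not_isPos hp, doubleCoord_of_not_isPos (fun h => hp (q2.1 h)), hf]

theorem IsOrientedDouble.exists_match (h₁ : IsOrientedDouble R₁ K f₁)
    (h₂ : IsOrientedDouble R₂ K f₂) (y₁ : Y₁) : ∃ y₂, f₂ y₂ = f₁ y₁ ∧
      ∀ c ∈ K.atlas, f₁ y₁ ∈ c.source → R₂.doubleCoord f₂ c y₂ = R₁.doubleCoord f₁ c y₁ := by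
  obtain ⟨c, hc, hy⟩ := h₁.smooth_base.covers (f₁ y₁)
  obtain ⟨y₂, h3, h4⟩ :=
    h₂.exists_point hc hy (halfPlaneFold_doubleCoord (R := R₁) h₁.smooth_base hc hy)
  refine ⟨y₂, h3, fun c' hc' hy' => ?_⟩
  exact h₂.toIsFolding.doubleCoord_change h₁.toIsFolding h3 hc hc' (h3 ▸ hy) (h3 ▸ hy') h4

/-- Read in the coordinates `doubleCoord`, the map is the identity. -/
theorem IsOrientedDouble.continuous_of_match (h₁ : IsOrientedDouble R₁ K f₁)
    (h₂ : IsOrientedDouble R₂ K f₂) {h : Y₁ → Y₂} (hf : ∀ y, f₂ (h y) = f₁ y)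
    (hd : ∀ y, ∀ c ∈ K.atlas, f₁ y ∈ c.source →
      R₂.doubleCoord f₂ c (h y) = R₁.doubleCoord f₁ c y) : Continuous h := by
  refine continuous_iff_continuousAt.2 fun y => ?_
  obtain ⟨c, hc, hy⟩ := h₁.smooth_base.covers (f₁ y)
  have hy2 : f₂ (h y) ∈ c.source := by rwa [hf]
  have hco := h₂.isCoordAt hc hy2
  obtain ⟨j, hjx, hj1, hj2, hj3⟩ := hco.exists_inverse
  have hjt : Tendsto j (𝓝 (R₂.doubleCoord f₂ c (h y))) (𝓝 (h y)) := by
    have := hj3.self_of_nhdsWithin (mem_univ _)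
    rw [nhdsWithin_univ, hjx] at this
    exact this.le
  rw [nhdsWithin_univ] at hj2
  have hc1 : Tendsto (R₁.doubleCoord f₁ c) (𝓝 y) (𝓝 (R₂.doubleCoord f₂ c (h y))) := by
    rw [hd y c hc hy]
    exact (h₁.isCoordAt hc hy).continuousAt
  refine (hjt.comp hc1).congr' ?_
  filter_upwards [hc1.eventually hj2, h₁.eventually_mem hy,
    (hjt.comp hc1).eventually (h₂.eventually_mem hy2)] with y' e1 e2 e3
  refine h₂.injOn c hc e3 (by rwa [mem_preimage, hf]) ?_
  rw [hd y' c hc e2]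
  exact e1

/-- Two oriented doubles of a Klein surface are isomorphic. -/
theorem IsOrientedDouble.exists_homeomorph (h₁ : IsOrientedDouble R₁ K f₁)
    (h₂ : IsOrientedDouble R₂ K f₂) : ∃ h : Y₁ ≃ₜ Y₂, (∀ y, f₂ (h y) = f₁ y) ∧
      ∀ y, ∀ c ∈ K.atlas, f₁ y ∈ c.source →
        R₂.doubleCoord f₂ c (h y) = R₁.doubleCoord f₁ c y := by
  choose h hf hd using h₁.exists_match h₂
  choose k kf kd using h₂.exists_match h₁
  -- Both points lie over the same point and have the same `doubleCoord`, which is injective on an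
  -- oriented double.
  have hk : ∀ y, k (h y) = y := fun y => by
    obtain ⟨c, hc, hy⟩ := h₁.smooth_base.covers (f₁ y)
    refine h₁.injOn c hc (by rwa [mem_preimage, kf, hf]) hy ?_
    rw [kd _ c hc (by rwa [hf]), hd _ c hc hy]
  have kh : ∀ y, h (k y) = y := fun y => by
    obtain ⟨c, hc, hy⟩ := h₂.smooth_base.covers (f₂ y)
    refine h₂.injOn c hc (by rwa [mem_preimage, hf, kf]) hy ?_
    rw [hd _ c hc (by rwa [kf]), kd _ c hc hy]
  exact ⟨⟨⟨h, k, hk, kh⟩, h₁.continuous_of_match h₂ hf hd, h₂.continuous_of_match h₁ kf kd⟩,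
    hf, hd⟩

theorem IsOrientedDouble.isAnalyticCoord_comp (h₁ : IsOrientedDouble R₁ K f₁)
    (h₂ : IsOrientedDouble R₂ K f₂) {h : Y₁ → Y₂} (hcont : Continuous h)
    (hf : ∀ y, f₂ (h y) = f₁ y)
    (hd : ∀ y, ∀ c ∈ K.atlas, f₁ y ∈ c.source →
      R₂.doubleCoord f₂ c (h y) = R₁.doubleCoord f₁ c y) {y : Y₁} {ζ : Y₂ → ℂ}
    (hζ : R₂.IsAnalyticCoord ζ (h y)) : R₁.IsAnalyticCoord (fun y => ζ (h y)) y := by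
  obtain ⟨c, hc, hy⟩ := h₁.smooth_base.covers (f₁ y)
  have hy2 : f₂ (h y) ∈ c.source := by rwa [hf]
  have h3 := h₂.isAnalyticCoord hc hy2
  have he : (fun y' => R₂.doubleCoord f₂ c (h y')) =ᶠ[𝓝 y] R₁.doubleCoord f₁ c :=
    (h₁.eventually_mem hy).mono fun y' hy' => hd y' c hc hy'
  refine (h₁.isAnalyticCoord hc hy).trans ?_ ?_
  · exact ((h3.rel hζ h₂.smooth).comp hcont.continuousAt).congr he (EventuallyEq.refl _ _)
  · exact ((hζ.rel h3 h₂.smooth).comp hcont.continuousAt).congr (EventuallyEq.refl _ _) he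

/-- Points over the same point at which a chart has the same orientation agree. -/
theorem IsOrientedDouble.eq_of_isPos (h : IsOrientedDouble R K f) (hc : c ∈ K.atlas) {y y' : Y}
    (hf : f y = f y') (hy : f y ∈ c.source) (hp : R.IsPos f c y ↔ R.IsPos f c y') : y = y' := by
  refine h.injOn c hc hy (show f y' ∈ c.source from hf ▸ hy) ?_
  by_cases h1 : R.IsPos f c y
  · rw [doubleCoord_of_isPos h1, doubleCoord_of_isPos (hp.1 h1), hf]
  · rw [doubleCoord_of_not_isPos h1, doubleCoord_of_not_isPos (fun h => h1 (hp.2 h)), hf]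

end Comparison

end NodalSurfaceData

namespace DoubleData

open NodalSurfaceData

variable {Z : Type u} [TopologicalSpace Z] {K : NodalSurfaceData .klein Z} {W : DoubleData K}

namespace IsSmoothComplexDouble

theorem isFolding (hW : W.IsSmoothComplexDouble) (hK : K.IsSmooth) :
    IsFolding W.surface K W.π :=
  ⟨hW.symmetric.1.isSmooth_of_nodes_eq_empty hW.nodes_empty, hK, hW.cover⟩

theorem isPos_σ (hW : W.IsSmoothComplexDouble) (hK : K.IsSmooth) {y : W.Y}
    {c : NodalChart SurfaceKind.klein.model Z} (hc : c ∈ K.atlas) (hy : W.π y ∈ c.source)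
    (hb : W.π y ∉ K.boundary) :
    W.surface.IsPos W.π c (W.σ y) ↔ ¬ W.surface.IsPos W.π c y := by
  obtain ⟨d, hd, d', hd', hyd, hyd', ha⟩ := hW.symmetric.2.1.2 y (by simp [hW.nodes_empty])
  exact (hW.isFolding hK).isPos_antianalytic hW.symmetric.2.1.1.continuous.continuousAt
    (Eventually.of_forall hW.comp) hd hyd hd' hyd' ha hc hy hb

/-- The involution reverses orientation, which a fixed point over the interior could not allow. -/
theorem σ_ne (hW : W.IsSmoothComplexDouble) (hK : K.IsSmooth) {y : W.Y}
    (hb : W.π y ∉ K.boundary) : W.σ y ≠ y := by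
  intro he
  obtain ⟨c, hc, hy⟩ := hK.covers (W.π y)
  have := hW.isPos_σ hK hc hy hb
  rw [he] at this
  tauto

theorem eq_σ_of_ne (hW : W.IsSmoothComplexDouble) (hK : K.IsSmooth) {y y' : W.Y}
    (hπ : W.π y = W.π y') (hb : W.π y ∉ K.boundary) (hne : y ≠ y') : y' = W.σ y :=
  encard_eq_two_unique (hW.cover.interior_fiber _ hb) (a := y) rfl hπ.symm (hW.comp y) hne
    (hW.σ_ne hK hb).symm

/-- The fibre over an interior point is an orbit of the involution, and the involution reverses
orientation. -/
theorem isOrientedDouble (hW : W.IsSmoothComplexDouble) (hK : K.IsSmooth) :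
    IsOrientedDouble W.surface K W.π := by
  refine (hW.isFolding hK).isOrientedDouble fun y y' hπ hb hne => ?_
  obtain ⟨c, hc, hy⟩ := hK.covers (W.π y)
  refine ⟨c, hc, hy, ?_⟩
  rw [hW.eq_σ_of_ne hK hπ hb hne]
  exact hW.isPos_σ hK hc hy hb

end IsSmoothComplexDouble

end DoubleData
end

noncomputable section

/-! ### Existence of the double: the surface of oriented points. -/

namespace NodalSurfaceData

variable {Z : Type u} [TopologicalSpace Z] {K : NodalSurfaceData .klein Z}

theorem IsSmooth.analyticRel_iff_not_antianalyticRel (hK : K.IsSmooth) {c c' : NodalChart _ Z}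
    (hc : c ∈ K.atlas) (hc' : c' ∈ K.atlas) {z : Z} (hz : z ∈ c.source) (hz' : z ∈ c'.source) :
    AnalyticRel c.coord c'.coord z ↔ ¬ AntianalyticRel c.coord c'.coord z :=
  ⟨fun h => (hK.coord c hc z hz).not_analytic_and_antianalytic (hK.rel c' hc' c hc z hz' hz) h,
    fun h => (hK.rel c hc c' hc' z hz hz').resolve_right h⟩

/-- Signs of transitions multiply, analytic being positive and antianalytic negative. -/
theorem IsSmooth.analyticRel_iff (hK : K.IsSmooth) {c₁ c₂ c₃ : NodalChart _ Z}
    (h₁ : c₁ ∈ K.atlas) (h₂ : c₂ ∈ K.atlas) (h₃ : c₃ ∈ K.atlas) {z : Z} (hz₁ : z ∈ c₁.source)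
    (hz₂ : z ∈ c₂.source) (hz₃ : z ∈ c₃.source) :
    AnalyticRel c₁.coord c₃.coord z ↔
      (AnalyticRel c₁.coord c₂.coord z ↔ AnalyticRel c₂.coord c₃.coord z) := by
  have e12 := hK.analyticRel_iff_not_antianalyticRel h₁ h₂ hz₁ hz₂
  have e23 := hK.analyticRel_iff_not_antianalyticRel h₂ h₃ hz₂ hz₃
  have e13 := hK.analyticRel_iff_not_antianalyticRel h₁ h₃ hz₁ hz₃
  by_cases a : AnalyticRel c₁.coord c₂.coord z <;> by_cases b : AnalyticRel c₂.coord c₃.coord z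
  · simp [a, b, a.trans b]
  · have : AntianalyticRel c₁.coord c₃.coord z := a.trans_anti (by tauto)
    tauto
  · have : AntianalyticRel c₁.coord c₃.coord z := AntianalyticRel.trans (by tauto) b
    tauto
  · have : AnalyticRel c₁.coord c₃.coord z :=
      AntianalyticRel.trans_anti (s := c₂.coord) (by tauto) (by tauto)
    tauto

/-- The points of the double: a point of the Klein surface with an orientation, the two
orientations being identified at boundary points. -/
@[ext]
structure OrientedPoint (K : NodalSurfaceData .klein Z) : Type u where
  pt : Z
  pos : Bool
  pos_of_mem : pt ∈ K.boundary → pos = true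

namespace OrientedPoint

/-- Change of orientation. -/
def flip (y : OrientedPoint K) : OrientedPoint K :=
  open Classical in
  if h : y.pt ∈ K.boundary then y else ⟨y.pt, !y.pos, fun h' => (h h').elim⟩

theorem pt_flip (y : OrientedPoint K) : y.flip.pt = y.pt := by
  unfold flip
  split_ifs <;> rfl

theorem flip_of_mem {y : OrientedPoint K} (h : y.pt ∈ K.boundary) : y.flip = y := dif_pos h

theorem pos_flip {y : OrientedPoint K} (h : y.pt ∉ K.boundary) : y.flip.pos = !y.pos := by
  unfold flip
  rw [dif_neg h]

theorem flip_flip (y : OrientedPoint K) : y.flip.flip = y := by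
  by_cases h : y.pt ∈ K.boundary
  · rw [flip_of_mem (h := (pt_flip y).symm ▸ h), flip_of_mem h]
  · refine OrientedPoint.ext (by rw [pt_flip, pt_flip]) ?_
    rw [pos_flip (by rwa [pt_flip]), pos_flip h, Bool.not_not]

variable (hK : K.IsSmooth)

/-- A chosen chart at every point. -/
def refChart (z : Z) : NodalChart SurfaceKind.klein.model Z := (hK.covers z).choose

theorem refChart_mem (z : Z) : refChart hK z ∈ K.atlas := (hK.covers z).choose_spec.1

theorem mem_refChart (z : Z) : z ∈ (refChart hK z).source := (hK.covers z).choose_spec.2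

/-- The chart `c` is positive for the given orientation. -/
def IsPositive (c : NodalChart SurfaceKind.klein.model Z) (y : OrientedPoint K) : Prop :=
  AnalyticRel (refChart hK y.pt).coord c.coord y.pt ↔ y.pos = true

open Classical in
/-- The coordinate on the double that folds to the coordinate `c`. -/
def coord (c : NodalChart SurfaceKind.klein.model Z) (y : OrientedPoint K) : ℂ :=
  if IsPositive hK c y then c.coord y.pt else conj (c.coord y.pt)

variable {hK} {c c' : NodalChart SurfaceKind.klein.model Z} {y y' : OrientedPoint K}

theorem coord_of_pos (h : IsPositive hK c y) : coord hK c y = c.coord y.pt := if_pos h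

theorem coord_of_neg (h : ¬ IsPositive hK c y) : coord hK c y = conj (c.coord y.pt) := if_neg h

theorem isPositive_iff (hc : c ∈ K.atlas) (hc' : c' ∈ K.atlas) (hy : y.pt ∈ c.source)
    (hy' : y.pt ∈ c'.source) :
    IsPositive hK c' y ↔ (IsPositive hK c y ↔ AnalyticRel c.coord c'.coord y.pt) := by
  unfold IsPositive
  rw [hK.analyticRel_iff (refChart_mem hK _) hc hc' (mem_refChart hK _) hy hy']
  tauto

theorem halfPlaneFold_coord (hc : c ∈ K.atlas) (hy : y.pt ∈ c.source) :
    halfPlaneFold (coord hK c y) = c.coord y.pt := by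
  have h0 : 0 ≤ (c.coord y.pt).im := (hK.coord c hc _ hy).mem
  by_cases h : IsPositive hK c y
  · rw [coord_of_pos h, halfPlaneFold_of_nonneg h0]
  · rw [coord_of_neg h, halfPlaneFold_conj, halfPlaneFold_of_nonneg h0]

theorem isPositive_flip (h : y.pt ∉ K.boundary) :
    IsPositive hK c y.flip ↔ ¬ IsPositive hK c y := by
  unfold IsPositive
  rw [pt_flip, pos_flip h]
  cases y.pos <;> simp

theorem coord_flip (hc : c ∈ K.atlas) (hy : y.pt ∈ c.source) :
    coord hK c y.flip = conj (coord hK c y) := by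
  by_cases hb : y.pt ∈ K.boundary
  · rw [flip_of_mem hb]
    have h1 := Complex.conj_eq_iff_im.2 (hK.im_eq_zero hc hy hb)
    by_cases h : IsPositive hK c y
    · rw [coord_of_pos h, h1]
    · rw [coord_of_neg h, h1, h1]
  · by_cases h : IsPositive hK c y
    · rw [coord_of_pos h, coord_of_neg (fun h' => (isPositive_flip hb).1 h' h), pt_flip]
    · rw [coord_of_neg h, coord_of_pos ((isPositive_flip hb).2 h), pt_flip, Complex.conj_conj]

/-- The folded value determines the point below. The sign of the imaginary part determines the
orientation in the interior, and on the boundary the orientation is fixed by convention. -/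
theorem injOn_coord (hc : c ∈ K.atlas) : InjOn (coord hK c) (pt ⁻¹' c.source) := by
  intro y hy y' hy' he
  have hpt : y.pt = y'.pt := by
    refine (hK.coordOn c hc).injOn hy hy' ?_
    rw [← halfPlaneFold_coord (hK := hK) hc hy, he, halfPlaneFold_coord hc hy']
  refine OrientedPoint.ext hpt ?_
  by_cases hb : y.pt ∈ K.boundary
  · rw [y.pos_of_mem hb, y'.pos_of_mem (show y'.pt ∈ K.boundary from hpt ▸ hb)]
  · have h0 := hK.im_pos hc hy hb
    have h0' := hK.im_pos hc hy' (hpt ▸ hb)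
    have hp : IsPositive hK c y ↔ IsPositive hK c y' := by
      by_cases h : IsPositive hK c y <;> by_cases h' : IsPositive hK c y'
      · simp [h, h']
      · rw [coord_of_pos h, coord_of_neg h'] at he
        have := congrArg Complex.im he
        rw [Complex.conj_im] at this
        linarith
      · rw [coord_of_neg h, coord_of_pos h'] at he
        have := congrArg Complex.im he
        rw [Complex.conj_im] at this
        linarith
      · simp [h, h']
    unfold IsPositive at hp
    rw [← hpt] at hp
    rw [Bool.eq_iff_iff]
    tauto

theorem exists_coord_eq (hc : c ∈ K.atlas) {z : Z} (hz : z ∈ c.source) {v : ℂ}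
    (hv : halfPlaneFold v = c.coord z) : ∃ y : OrientedPoint K, y.pt = z ∧ coord hK c y = v := by
  obtain ⟨y, rfl⟩ : ∃ y : OrientedPoint K, y.pt = z := ⟨⟨z, true, fun _ => rfl⟩, rfl⟩
  have key : coord hK c y = v ∨ conj (coord hK c y) = v := by
    rw [← halfPlaneFold_coord (hK := hK) hc hz] at hv
    rcases halfPlaneFold_eq_or v with h1 | h1 <;>
      rcases halfPlaneFold_eq_or (coord hK c y) with h2 | h2 <;> rw [h1, h2] at hv
    · exact Or.inl hv.symm
    · exact Or.inr hv.symm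
    · exact Or.inr (by rw [← hv, Complex.conj_conj])
    · exact Or.inl (star_injective hv).symm
  rcases key with h | h
  · exact ⟨y, rfl, h⟩
  · exact ⟨y.flip, pt_flip y, by rw [coord_flip hc hz, h]⟩

/-- The openness statement needed before there is a topology on the double: values near that of `y`
are attained, and only over points near `y.pt`. Both follow from continuity of the folding and the
chart property of `c` below. -/
theorem eventually_pt (hc : c ∈ K.atlas) (hy : y.pt ∈ c.source) {P : Z → Prop}
    (hP : ∀ᶠ z in 𝓝 y.pt, P z) : ∀ᶠ v in 𝓝 (coord hK c y),
      (∃ y' : OrientedPoint K, y'.pt ∈ c.source ∧ coord hK c y' = v) ∧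
      ∀ y' : OrientedPoint K, y'.pt ∈ c.source → coord hK c y' = v → P y'.pt := by
  have h1 : c.coord '' {z | z ∈ c.source ∧ P z} ∈ 𝓝[SurfaceKind.klein.model] (c.coord y.pt) := by
    rw [← (hK.coord c hc _ hy).map_nhds]
    exact image_mem_map (inter_mem (c.isOpen_source.mem_nhds hy) hP)
  have h2 : Tendsto halfPlaneFold (𝓝 (coord hK c y))
      (𝓝[SurfaceKind.klein.model] (c.coord y.pt)) := by
    refine tendsto_nhdsWithin_iff.2 ⟨?_, Eventually.of_forall halfPlaneFold_im_nonneg⟩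
    rw [← halfPlaneFold_coord (hK := hK) hc hy]
    exact continuous_halfPlaneFold.continuousAt
  filter_upwards [h2.eventually h1] with v hv
  obtain ⟨z, ⟨hz, hPz⟩, hzv⟩ := hv
  refine ⟨?_, fun y' hy' he => ?_⟩
  · obtain ⟨y', rfl, hy'⟩ := exists_coord_eq (hK := hK) hc hz hzv.symm
    exact ⟨y', hz, hy'⟩
  · have : y'.pt = z := by
      refine (hK.coordOn c hc).injOn hy' hz ?_
      rw [hzv, ← he, halfPlaneFold_coord hc hy']
    rwa [this]

open Classical in
/-- The changes of coordinates on the double are analytic. -/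
theorem exists_transition (hc : c ∈ K.atlas) (hc' : c' ∈ K.atlas) (hy : y.pt ∈ c.source)
    (hy' : y.pt ∈ c'.source) : ∃ F : ℂ → ℂ, AnalyticAt ℂ F (coord hK c y) ∧
      coord hK c' y = F (coord hK c y) ∧
      ∀ᶠ v in 𝓝 (coord hK c y), ∀ y' : OrientedPoint K, y'.pt ∈ c.source → coord hK c y' = v →
        y'.pt ∈ c'.source ∧ coord hK c' y' = F v := by
  have hcc := hK.coord c hc _ hy
  -- On positively oriented points the transition is `G`, on the others its reflection. For real
  -- values the two are the same germ, because `G` is real on the axis.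
  obtain ⟨G, hG, hGz, hev⟩ : ∃ G : ℂ → ℂ, AnalyticAt ℂ G (c.coord y.pt) ∧
      ((c.coord y.pt).im = 0 → ∀ᶠ w in 𝓝 (c.coord y.pt), G (conj w) = conj (G w)) ∧
      ∀ᶠ z in 𝓝 y.pt, z ∈ c'.source ∧ ∀ y' : OrientedPoint K, y'.pt = z → y'.pt ∈ c.source →
        coord hK c' y' = if IsPositive hK c y' then G (coord hK c y')
          else conj (G (conj (coord hK c y'))) := by
    have hreal : ∀ G : ℂ → ℂ, AnalyticAt ℂ G (c.coord y.pt) →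
        (∀ᶠ z in 𝓝 y.pt, c'.coord z = G (c.coord z) ∨ c'.coord z = conj (G (c.coord z))) →
        (c.coord y.pt).im = 0 → ∀ᶠ w in 𝓝 (c.coord y.pt), G (conj w) = conj (G w) := by
      intro G hG hev him
      refine hG.eventually_conj him ?_
      rw [← hcc.map_nhds]
      change ∀ᶠ z in 𝓝 y.pt, _
      filter_upwards [hev, c.isOpen_source.mem_nhds hy, c'.isOpen_source.mem_nhds hy']
        with z h1 h2 h3 h4
      have hb : z ∈ K.boundary := by
        rw [hK.mem_boundary_iff hc h2, SurfaceKind.interior_klein]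
        exact fun h => (show 0 < (c.coord z).im from h).ne' h4
      have h5 := hK.im_eq_zero hc' h3 hb
      rcases h1 with h1 | h1
      · rwa [← h1]
      · rw [h1] at h5
        simpa using h5
    by_cases ha : AnalyticRel c.coord c'.coord y.pt
    · obtain ⟨G, hG, h1⟩ := id ha
      refine ⟨G, hG, hreal G hG (h1.mono fun z hz => Or.inl hz), ?_⟩
      filter_upwards [h1, ha.eventually hcc.continuousAt, c'.isOpen_source.mem_nhds hy']
        with z h1 h2 h3
      refine ⟨h3, ?_⟩
      rintro y' rfl hy'
      have hp := isPositive_iff (hK := hK) hc hc' hy' h3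
      simp only [h2, iff_true] at hp
      by_cases h : IsPositive hK c y'
      · rw [if_pos h, coord_of_pos h, coord_of_pos (hp.2 h), h1]
      · rw [if_neg h, coord_of_neg h, coord_of_neg (fun h' => h (hp.1 h')), h1,
          Complex.conj_conj]
    · have ha' : AntianalyticRel c.coord c'.coord y.pt :=
        (hK.rel c hc c' hc' _ hy hy').resolve_left ha
      obtain ⟨G, hG, h1⟩ := id ha'
      refine ⟨G, hG, hreal G hG (h1.mono fun z hz => Or.inr hz), ?_⟩
      filter_upwards [h1, ha'.eventually hcc.continuousAt, c'.isOpen_source.mem_nhds hy']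
        with z h1 h2 h3
      refine ⟨h3, ?_⟩
      rintro y' rfl hy'
      have hp := isPositive_iff (hK := hK) hc hc' hy' h3
      have h2' : ¬ AnalyticRel c.coord c'.coord y'.pt := fun h =>
        (hK.analyticRel_iff_not_antianalyticRel hc hc' hy' h3).1 h h2
      simp only [h2', iff_false] at hp
      by_cases h : IsPositive hK c y'
      · rw [if_pos h, coord_of_pos h, coord_of_neg (fun h' => hp.1 h' h), h1, Complex.conj_conj]
      · rw [if_neg h, coord_of_neg h, coord_of_pos (hp.2 h), h1, Complex.conj_conj]
  -- the sign of the imaginary part determines which of the two formulas applies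
  have hsign : ∀ y' : OrientedPoint K, y'.pt ∈ c.source →
      (0 < (coord hK c y').im → IsPositive hK c y') ∧
      ((coord hK c y').im < 0 → ¬ IsPositive hK c y') := by
    intro y' hy'
    have h0 : 0 ≤ (c.coord y'.pt).im := (hK.coord c hc _ hy').mem
    constructor
    · intro h
      by_contra h'
      rw [coord_of_neg h', Complex.conj_im] at h
      linarith
    · intro h h'
      rw [coord_of_pos h'] at h
      linarith
  have hfin : ∀ F : ℂ → ℂ, AnalyticAt ℂ F (coord hK c y) →
      (∀ᶠ v in 𝓝 (coord hK c y), ∀ y' : OrientedPoint K, y'.pt ∈ c.source → coord hK c y' = v →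
        (if IsPositive hK c y' then G v else conj (G (conj v))) = F v) →
      ∃ F : ℂ → ℂ, AnalyticAt ℂ F (coord hK c y) ∧ coord hK c' y = F (coord hK c y) ∧
        ∀ᶠ v in 𝓝 (coord hK c y), ∀ y' : OrientedPoint K, y'.pt ∈ c.source →
          coord hK c y' = v → y'.pt ∈ c'.source ∧ coord hK c' y' = F v := by
    intro F hF h
    have h1 : ∀ᶠ v in 𝓝 (coord hK c y), ∀ y' : OrientedPoint K, y'.pt ∈ c.source →
        coord hK c y' = v → y'.pt ∈ c'.source ∧ coord hK c' y' = F v := by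
      filter_upwards [h, eventually_pt (hK := hK) hc hy hev] with v h1 h2 y' hy' he
      obtain ⟨h3, h4⟩ := h2.2 y' hy' he
      refine ⟨h3, ?_⟩
      rw [h4 y' rfl hy', he, h1 y' hy' he]
    exact ⟨F, hF, (h1.self_of_nhds y hy rfl).2, h1⟩
  have him : Continuous Complex.im := Complex.continuous_im
  rcases lt_trichotomy (coord hK c y).im 0 with h0 | h0 | h0
  · have hneg := (hsign y hy).2 h0
    refine hfin (fun w => conj (G (conj w))) (AnalyticAt.conj_conj' ?_) ?_
    · rw [coord_of_neg hneg, Complex.conj_conj]; exact hG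
    · filter_upwards [him.continuousAt.eventually (gt_mem_nhds h0)] with v hv y' hy' he
      rw [if_neg ((hsign y' hy').2 (by rw [he]; exact hv))]
  · have hfix : coord hK c y = c.coord y.pt := by
      rw [← halfPlaneFold_coord (hK := hK) hc hy, halfPlaneFold_of_nonneg h0.ge]
    refine hfin G (hfix ▸ hG) ?_
    rw [hfix] at h0 ⊢
    filter_upwards [hGz h0] with v hv y' hy' he
    split_ifs
    · rfl
    · rw [hv, Complex.conj_conj]
  · have hpos := (hsign y hy).1 h0
    refine hfin G ?_ ?_
    · rw [coord_of_pos hpos]; exact hG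
    · filter_upwards [him.continuousAt.eventually (lt_mem_nhds h0)] with v hv y' hy' he
      rw [if_pos ((hsign y' hy').1 (by rw [he]; exact hv))]

variable (hK) in
/-- The topology for which the functions `coord` are coordinates. -/
@[reducible]
def topology : TopologicalSpace (OrientedPoint K) where
  IsOpen O := ∀ y ∈ O, ∀ c ∈ K.atlas, y.pt ∈ c.source → ∀ᶠ v in 𝓝 (coord hK c y),
    ∀ y' : OrientedPoint K, y'.pt ∈ c.source → coord hK c y' = v → y' ∈ O
  isOpen_univ := fun _ _ _ _ _ => Eventually.of_forall fun _ _ _ _ => trivial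
  isOpen_inter := fun _ _ hs ht y hy c hc hyc => by
    filter_upwards [hs y hy.1 c hc hyc, ht y hy.2 c hc hyc] with v h1 h2 y' h h'
    exact ⟨h1 y' h h', h2 y' h h'⟩
  isOpen_sUnion := fun _ hs y hy c hc hyc => by
    obtain ⟨t, ht, hyt⟩ := hy
    filter_upwards [hs t ht y hyt c hc hyc] with v h1 y' h h'
    exact ⟨t, ht, h1 y' h h'⟩

variable (hK) in
theorem continuous_pt : @Continuous _ _ (topology hK) _ (pt (K := K)) := by
  let := topology hK
  refine continuous_def.2 fun U hU y hy c hc hyc => ?_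
  filter_upwards [eventually_pt (hK := hK) hc hyc (hU.mem_nhds hy)] with v hv y' h h'
  exact hv.2 y' h h'

/-- Injectivity is already known; the two halves of the filter equality are continuity, which rests
on the analytic transitions, and openness, which rests on `eventually_pt`. -/
theorem isCoordOn_coord (hc : c ∈ K.atlas) :
    letI := topology hK
    IsCoordOn univ (coord hK c) (pt ⁻¹' c.source) := by
  let := topology hK
  refine ⟨c.isOpen_source.preimage (continuous_pt hK), injOn_coord hc, fun y hy => ?_⟩
  rw [nhdsWithin_univ]
  apply le_antisymm
  · intro V hV
    obtain ⟨V', hV'V, hV'o, hyV'⟩ := mem_nhds_iff.1 hV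
    -- Openness has to be tested in every chart `c₁`; the transition `F` pulls the condition on `c`
    -- back to `c₁`.
    have ho : IsOpen {y' : OrientedPoint K | y'.pt ∈ c.source ∧ coord hK c y' ∈ V'} := by
      intro y₁ hy₁ c₁ hc₁ hyc₁
      obtain ⟨F, hF, hFy, hev⟩ := exists_transition (hK := hK) hc₁ hc hyc₁ hy₁.1
      have hFV : ∀ᶠ v in 𝓝 (coord hK c₁ y₁), F v ∈ V' :=
        hF.continuousAt.eventually (hV'o.mem_nhds (hFy ▸ hy₁.2))
      filter_upwards [hev, hFV] with v h1 h2 y' h3 h4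
      obtain ⟨h5, h6⟩ := h1 y' h3 h4
      exact ⟨h5, by rwa [h6]⟩
    exact mem_map.2 (mem_of_superset (ho.mem_nhds ⟨hy, hyV'⟩) fun y' hy' => hV'V hy'.2)
  · intro V hV
    obtain ⟨O, hOV, hO, hyO⟩ := mem_nhds_iff.1 (mem_map.1 hV)
    filter_upwards [hO y hyO c hc hy,
      eventually_pt (hK := hK) hc hy (P := fun _ => True) (Eventually.of_forall fun _ => trivial)]
      with v h1 h2
    obtain ⟨⟨y', h3, h4⟩, -⟩ := h2
    rw [← h4]
    exact hOV (h1 y' h3 h4)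

theorem analyticRel_coord (hc : c ∈ K.atlas) (hc' : c' ∈ K.atlas) (hy : y.pt ∈ c.source)
    (hy' : y.pt ∈ c'.source) :
    letI := topology hK
    AnalyticRel (coord hK c) (coord hK c') y := by
  let := topology hK
  obtain ⟨F, hF, -, hev⟩ := exists_transition (hK := hK) hc hc' hy hy'
  refine ⟨F, hF, ?_⟩
  have hco := (isCoordOn_coord (hK := hK) hc)
  filter_upwards [(hco.isCoordAt hy).continuousAt.eventually hev, hco.isOpen.mem_nhds hy]
    with y' h1 h2
  exact (h1 y' h2 rfl).2

variable (hK) in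
/-- The analytic structure of the double. -/
def surface : @NodalSurfaceData .riemann (OrientedPoint K) (topology hK) :=
  letI := topology hK
  { atlas := {d | (∃ ψ, d = .plane ψ) ∧ ∀ y ∈ d.source, ∀ c ∈ K.atlas, y.pt ∈ c.source →
      AnalyticRel (coord hK c) d.coord y ∧ AnalyticRel d.coord (coord hK c) y}
    distinguished := ∅ }

variable (hK) in
theorem nodes_surface : @nodes _ _ (topology hK) (surface hK) = ∅ := by
  let := topology hK
  refine eq_empty_of_forall_notMem ?_
  rintro y ((⟨a, φ, h, ⟨⟨ψ, hψ⟩, -⟩, -⟩ | h) | ⟨a, φ, h, ⟨⟨ψ, hψ⟩, -⟩, -⟩)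
  · cases hψ
  · exact h
  · cases hψ

theorem exists_chart (hc : c ∈ K.atlas) (hy : y.pt ∈ c.source) :
    letI := topology hK
    ∃ d ∈ (surface hK).atlas, y ∈ d.source ∧ ∀ y' ∈ d.source,
      y'.pt ∈ c.source ∧ d.coord y' = coord hK c y' := by
  let := topology hK
  have hco := isCoordOn_coord (hK := hK) hc
  obtain ⟨ψ, hψ, hψc⟩ := IsCoordOn.exists_chart (H := SurfaceKind.riemann.model) hco hy
  refine ⟨.plane ψ, ⟨⟨ψ, rfl⟩, fun y₁ hy₁ c₁ hc₁ hyc₁ => ?_⟩, ?_, fun y' hy' => ?_⟩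
  · have hy₁ : y₁ ∈ ψ.source := hy₁
    rw [hψ] at hy₁
    have he : coord hK c =ᶠ[𝓝 y₁] (NodalChart.plane ψ).coord := by
      filter_upwards [hco.isOpen.mem_nhds hy₁] with y' h' using (hψc y' h').symm
    exact ⟨(analyticRel_coord hc₁ hc hyc₁ hy₁).congr (EventuallyEq.refl _ _) he,
      (analyticRel_coord hc hc₁ hy₁ hyc₁).congr he (EventuallyEq.refl _ _)⟩
  · change y ∈ ψ.source
    rw [hψ]; exact hy
  · have hy' : y' ∈ ψ.source := hy'
    rw [hψ] at hy'
    exact ⟨hy', hψc y' hy'⟩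

variable (hK) in
theorem isSurface [T2Space Z] : @IsSurface _ _ (topology hK) (surface hK) := by
  let := topology hK
  constructor
  · refine ⟨fun y y' hne => ?_⟩
    by_cases hpt : y.pt = y'.pt
    · obtain ⟨c, hc, hy⟩ := hK.covers y.pt
      have hy' : y'.pt ∈ c.source := hpt ▸ hy
      have hco := isCoordOn_coord (hK := hK) hc
      have hne' : coord hK c y ≠ coord hK c y' := fun he => hne (hco.injOn hy hy' he)
      obtain ⟨U, V, hU, hV, hyU, hyV, hd⟩ := t2_separation hne'
      have hcon : ContinuousOn (coord hK c) (pt ⁻¹' c.source) := fun y hy =>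
        (hco.isCoordAt hy).continuousAt.continuousWithinAt
      exact ⟨_, _, hcon.isOpen_inter_preimage hco.isOpen hU,
        hcon.isOpen_inter_preimage hco.isOpen hV, ⟨hy, hyU⟩, ⟨hy', hyV⟩,
        disjoint_left.2 fun z h1 h2 => disjoint_left.1 hd h1.2 h2.2⟩
    · obtain ⟨U, V, hU, hV, hyU, hyV, hd⟩ := t2_separation hpt
      exact ⟨_, _, hU.preimage (continuous_pt hK), hV.preimage (continuous_pt hK), hyU, hyV,
        hd.preimage _⟩
  · intro y
    obtain ⟨c, hc, hy⟩ := hK.covers y.pt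
    obtain ⟨d, hd, hyd, -⟩ := exists_chart (hK := hK) hc hy
    exact ⟨d, hd, hyd⟩
  · intro d hd d' hd' y hy _
    obtain ⟨c, hc, hyc⟩ := hK.covers y.pt
    have h1 := hd.2 y hy.1 c hc hyc
    have h2 := hd'.2 y hy.2 c hc hyc
    exact ⟨h1.2.trans h2.1, h2.2.trans h1.1⟩
  · intro d hd
    refine ⟨?_, fun y hy c hc hyc => ?_⟩
    · cases d with
      | plane ψ => exact ⟨ψ, rfl⟩
      | node a φ h =>
        -- The centre of a chart at a node would have an ordinary coordinate, which is impossible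
        -- topologically; so maximality only concerns plane charts.
        obtain ⟨c, hc, hyc⟩ := hK.covers φ.center.pt
        exact (OpenPartialHomeomorph.not_isCoordAt_center h .riemann _
          ((isCoordOn_coord (hK := hK) hc).isCoordAt hyc)).elim
    · obtain ⟨d', hd', hyd', he⟩ := exists_chart (hK := hK) hc hyc
      have h1 := hd d' hd' y ⟨hy, hyd'⟩ (by rw [nodes_surface]; exact notMem_empty y)
      have he' : d'.coord =ᶠ[𝓝 y] coord hK c :=
        mem_of_superset (d'.isOpen_source.mem_nhds hyd') fun y' hy' => (he y' hy').2
      exact ⟨AnalyticRel.congr h1.2 he' (EventuallyEq.refl _ _),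
        AnalyticRel.congr h1.1 (EventuallyEq.refl _ _) he'⟩
  · exact isClosed_empty
  · exact inferInstanceAs (DiscreteTopology (∅ : Set (OrientedPoint K)))
  · intro y hy; exact hy.elim
  · intro _; rfl

variable (hK) in
theorem continuous_flip : @Continuous _ _ (topology hK) (topology hK) (flip (K := K)) := by
  let := topology hK
  refine continuous_def.2 fun O hO y hy c hc hyc => ?_
  have h1 := hO y.flip hy c hc (by rwa [pt_flip])
  rw [coord_flip hc hyc] at h1
  have h2 := (Complex.continuous_conj.tendsto (coord hK c y)).eventually h1
  filter_upwards [h2] with v hv y' hy' he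
  exact hv y'.flip (by rwa [pt_flip]) (by rw [coord_flip hc hy', he])

variable (hK) in
/-- The complex double of a Klein surface without nodes. -/
def double : DoubleData K :=
  letI := topology hK
  { Y := OrientedPoint K
    surface := surface hK
    π := pt
    σ := flip }

variable (hK) in
-- In the coordinates `coord` the projection is the folding and the change of orientation is complex
-- conjugation.
theorem isSmoothComplexDouble_double [T2Space Z] : (double hK).IsSmoothComplexDouble := by
  let := topology hK
  refine ⟨⟨isSurface hK, ⟨⟨continuous_flip hK, ?_, ?_, ?_, ?_⟩, ?_⟩, flip_flip⟩, nodes_surface hK,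
    ⟨continuous_pt hK, ?_, ?_, ?_⟩, pt_flip⟩
  · intro y hy
    have : y.flip ∈ (surface hK).nodes := Or.inl (Or.inl hy)
    rw [nodes_surface] at this
    exact this.elim
  · intro y hy; exact hy.elim
  · change flip ⁻¹' (surface hK).boundaryNodes ⊆ _
    rw [boundaryNodes_riemann]
    exact fun y hy => hy.elim
  · change flip '' (surface hK).boundary ⊆ _
    rw [boundary_riemann, image_empty]
    exact empty_subset _
  · intro y _
    change OrientedPoint K at y
    obtain ⟨c, hc, hyc⟩ := hK.covers y.pt
    obtain ⟨d, hd, hyd, he⟩ := exists_chart (hK := hK) hc hyc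
    obtain ⟨d', hd', hyd', he'⟩ := exists_chart (hK := hK) (y := y.flip) hc (by rwa [pt_flip])
    refine ⟨d, hd, d', hd', hyd, hyd', ?_⟩
    have h1 : d.coord =ᶠ[𝓝 y] coord hK c :=
      mem_of_superset (d.isOpen_source.mem_nhds hyd) fun y' hy' => (he y' hy').2
    refine ⟨id, analyticAt_id, ?_⟩
    filter_upwards [h1, (continuous_flip hK).continuousAt.eventually
      (d'.isOpen_source.mem_nhds hyd'), d.isOpen_source.mem_nhds hyd] with y' h2 h3 h4
    change d'.coord y'.flip = conj (d.coord y')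
    rw [(he' _ h3).2, h2, coord_flip hc (he y' h4).1]
  · intro y
    change OrientedPoint K at y
    obtain ⟨c, hc, hyc⟩ := hK.covers y.pt
    obtain ⟨d, hd, hyd, he⟩ := exists_chart (hK := hK) hc hyc
    refine ⟨d, hd, c, hc, hyd, hyc, id, analyticAt_id, by simp, ?_⟩
    filter_upwards [d.isOpen_source.mem_nhds hyd] with y' hy'
    obtain ⟨h1, h2⟩ := he y' hy'
    change c.coord y'.pt = halfPlaneFold (d.coord y')
    rw [h2, halfPlaneFold_coord hc h1]
  · intro z hz
    refine encard_eq_two.2 ⟨(⟨z, true, fun _ => rfl⟩ : OrientedPoint K),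
      (⟨z, false, fun h => (hz h).elim⟩ : OrientedPoint K), ?_, ?_⟩
    · intro h
      have := congrArg (fun y : OrientedPoint K => y.pos) h
      simp at this
    · ext y
      change OrientedPoint K at y
      constructor
      · intro hy
        have hy : y.pt = z := hy
        rcases hb : y.pos with _ | _
        · exact Or.inr (OrientedPoint.ext hy hb)
        · exact Or.inl (OrientedPoint.ext hy hb)
      · rintro (rfl | rfl) <;> rfl
  · intro z hz
    refine encard_eq_one.2 ⟨(⟨z, true, fun _ => rfl⟩ : OrientedPoint K), ?_⟩
    ext y
    change OrientedPoint K at y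
    constructor
    · intro hy
      have hy : y.pt = z := hy
      exact OrientedPoint.ext hy (y.pos_of_mem (show y.pt ∈ K.boundary from hy ▸ hz))
    · rintro rfl; rfl

end OrientedPoint

theorem exists_isSmoothComplexDouble {X : Type u} [TopologicalSpace X]
    {S : NodalSurfaceData .klein X} (hS : S.IsSurface) :
    ∃ T : DoubleData S.normalization, T.IsSmoothComplexDouble :=
  haveI := t2Space_normalization hS
  ⟨_, OrientedPoint.isSmoothComplexDouble_double (isSmooth_normalization hS)⟩

end NodalSurfaceData
end

noncomputable section

/-! ### Gluing points of a Riemann surface in pairs. -/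

namespace NodalSurfaceData

/-- The analytic structure on a quotient of a Riemann surface. -/
def glueSurface {Z : Type u} [TopologicalSpace Z] (A : NodalSurfaceData .riemann Z)
    (r : Setoid Z) : NodalSurfaceData .riemann (Quotient r) where
  atlas := {c | ∀ w : Z, Quotient.mk r w ∈ c.source → ∀ d ∈ A.atlas, w ∈ d.source →
    AnalyticRel d.coord (fun y => c.coord (Quotient.mk r y)) w ∧
    AnalyticRel (fun y => c.coord (Quotient.mk r y)) d.coord w}
  distinguished := ∅

/-- Identifications of the points of a closed discrete set in pairs. -/
structure IsPairing {Z : Type u} [TopologicalSpace Z] (A : NodalSurfaceData .riemann Z)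
    (r : Setoid Z) (E : Set Z) : Prop where
  smooth : A.IsSmooth
  t2 : T2Space Z
  isolated : ∀ w, ∀ᶠ w' in 𝓝[≠] w, w' ∉ E
  eq_of_notMem : ∀ a b, r a b → a ∉ E → a = b
  partner : ∀ a ∈ E, ∃ b, b ≠ a ∧ r a b ∧ ∀ c, r a c → c = a ∨ c = b

variable {Z : Type u} [TopologicalSpace Z] {A : NodalSurfaceData .riemann Z} {r : Setoid Z}
  {E : Set Z}

namespace IsPairing

theorem partner_mem (h : IsPairing A r E) {a b : Z} (hb : b ≠ a) (hab : r a b) : b ∈ E := by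
  by_contra hbE
  exact hb (h.eq_of_notMem b a (r.symm hab) hbE)

theorem isClosed_of_subset (h : IsPairing A r E) {D : Set Z} (hD : D ⊆ E) : IsClosed D := by
  refine isOpen_compl_iff.1 (isOpen_iff_mem_nhds.2 fun w hw => ?_)
  filter_upwards [eventually_nhdsWithin_iff.1 (h.isolated w)] with w' hw' hD'
  by_cases he : w' = w
  · exact hw (he ▸ hD')
  · exact hw' he (hD hD')

/-- The quotient map need not be open at identified points, but a set is a neighbourhood of a class
as soon as its preimage is one at every member, since other identified points can be removed. -/
theorem mem_nhds_mk (h : IsPairing A r E) {w : Z} {V : Set (Quotient r)} :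
    V ∈ 𝓝 (Quotient.mk r w) ↔ ∀ w', r w w' → Quotient.mk r ⁻¹' V ∈ 𝓝 w' := by
  constructor
  · intro hV w' hw'
    have : Quotient.mk r w' = Quotient.mk r w := Quotient.sound (r.symm hw')
    have hcont : Continuous (Quotient.mk r) := continuous_quotient_mk'
    exact hcont.continuousAt.preimage_mem_nhds (by rwa [this])
  · intro hV
    -- Discarding all of `E` outside the class of `w` makes the open set saturated; what is
    -- discarded is closed because `E` has no accumulation points.
    set O := interior (Quotient.mk r ⁻¹' V) \ (E \ {w' | r w w'}) with hO
    have hOo : IsOpen O := isOpen_interior.sdiff (h.isClosed_of_subset sdiff_subset)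
    have hsat : ∀ a b, a ∈ O → r a b → b ∈ O := by
      intro a b ha hab
      by_cases haE : a ∈ E
      · have hwa : r w a := by
          by_contra hn
          exact ha.2 ⟨haE, hn⟩
        have hwb : r w b := r.trans hwa hab
        exact ⟨mem_interior_iff_mem_nhds.2 (hV b hwb), fun hb => hb.2 hwb⟩
      · rwa [← h.eq_of_notMem a b hab haE]
    have hpre : Quotient.mk r ⁻¹' (Quotient.mk r '' O) = O := by
      ext b
      constructor
      · rintro ⟨a, ha, hab⟩
        exact hsat a b ha (Quotient.exact hab)
      · exact fun hb => ⟨b, hb, rfl⟩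
    have hopen : IsOpen (Quotient.mk r '' O) := isOpen_coinduced.2 (hpre.symm ▸ hOo)
    refine mem_of_superset (hopen.mem_nhds ⟨w, ⟨mem_interior_iff_mem_nhds.2 (hV w (r.refl w)),
      fun hw => hw.2 (r.refl w)⟩, rfl⟩) ?_
    rintro _ ⟨a, ha, rfl⟩
    exact (interior_subset ha.1 : a ∈ Quotient.mk r ⁻¹' V)

theorem nhds_mk_of_notMem (h : IsPairing A r E) {w : Z} (hw : w ∉ E) :
    𝓝 (Quotient.mk r w) = map (Quotient.mk r) (𝓝 w) := by
  ext V
  rw [h.mem_nhds_mk, mem_map]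
  exact ⟨fun hV => hV w (r.refl w), fun hV w' hw' => h.eq_of_notMem w w' hw' hw ▸ hV⟩

theorem nhds_mk_of_pair (h : IsPairing A r E) {a b : Z} (hab : r a b)
    (hc : ∀ c, r a c → c = a ∨ c = b) :
    𝓝 (Quotient.mk r a) = map (Quotient.mk r) (𝓝 a) ⊔ map (Quotient.mk r) (𝓝 b) := by
  ext V
  rw [h.mem_nhds_mk, mem_sup, mem_map, mem_map]
  refine ⟨fun hV => ⟨hV a (r.refl a), hV b hab⟩, fun hV w' hw' => ?_⟩
  rcases hc w' hw' with rfl | rfl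
  exacts [hV.1, hV.2]

theorem exists_injOn (h : IsPairing A r E) (w : Z) :
    ∃ U, IsOpen U ∧ w ∈ U ∧ InjOn (Quotient.mk r) U ∧ ∀ w' ∈ U, w' ∈ E → w' = w := by
  have hU : ∀ w' ∈ (E \ {w})ᶜ, w' ∈ E → w' = w := fun w' hw' hE => by
    by_contra hne
    exact hw' ⟨hE, hne⟩
  refine ⟨(E \ {w})ᶜ, (h.isClosed_of_subset sdiff_subset).isOpen_compl, fun hw => hw.2 rfl, ?_, hU⟩
  intro a ha b hb hab
  by_contra hne
  have hab' : r a b := Quotient.exact hab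
  have h1 := hU a ha (h.partner_mem hne (r.symm hab'))
  have h2 := hU b hb (h.partner_mem (Ne.symm hne) hab')
  exact hne (h1.trans h2.symm)

theorem eventually_mk_ne (h : IsPairing A r E) (w : Z) :
    ∀ᶠ w' in 𝓝[≠] w, Quotient.mk r w' ≠ Quotient.mk r w := by
  obtain ⟨U, hU, hw, hinj, -⟩ := h.exists_injOn w
  filter_upwards [nhdsWithin_le_nhds (hU.mem_nhds hw), self_mem_nhdsWithin] with w' h1 h2 h3
  exact h2 (hinj h1 hw h3)

theorem exists_nhds_mk (h : IsPairing A r E) (w : Z) :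
    ∃ w', r w w' ∧
      𝓝 (Quotient.mk r w) = map (Quotient.mk r) (𝓝 w) ⊔ map (Quotient.mk r) (𝓝 w') := by
  by_cases hw : w ∈ E
  · obtain ⟨b, -, hab, hc⟩ := h.partner w hw
    exact ⟨b, hab, h.nhds_mk_of_pair hab hc⟩
  · exact ⟨w, r.refl w, by rw [sup_idem, h.nhds_mk_of_notMem hw]⟩

/-- Small disjoint neighbourhoods meet `E` at most in their centres, so their images can meet only
if the centres are identified. Neighbourhoods of a class are suprema of at most two such images. -/
theorem t2Space (h : IsPairing A r E) : T2Space (Quotient r) := by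
  have := h.t2
  have key : ∀ w w', ¬ r w w' →
      Disjoint (map (Quotient.mk r) (𝓝 w)) (map (Quotient.mk r) (𝓝 w')) := by
    intro w w' hne
    obtain ⟨U, V, hU, hV, hwU, hwV, hd⟩ := t2_separation (x := w) (y := w')
      fun he => hne (he ▸ r.refl w)
    obtain ⟨U', hU', hwU', -, hEU⟩ := h.exists_injOn w
    obtain ⟨V', hV', hwV', -, hEV⟩ := h.exists_injOn w'
    refine Filter.disjoint_iff.2 ⟨_, image_mem_map ((hU.inter hU').mem_nhds ⟨hwU, hwU'⟩), _,
      image_mem_map ((hV.inter hV').mem_nhds ⟨hwV, hwV'⟩), disjoint_left.2 ?_⟩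
    rintro _ ⟨a, ha, rfl⟩ ⟨b, hb, hab⟩
    have hba : r b a := Quotient.exact hab
    have hne' : b ≠ a := fun he => disjoint_left.1 hd ha.1 (he ▸ hb.1)
    have h1 := hEU a ha.2 (h.partner_mem hne'.symm hba)
    have h2 := hEV b hb.2 (h.partner_mem hne' (r.symm hba))
    exact hne (h1 ▸ h2 ▸ r.symm hba)
  refine t2Space_iff_disjoint_nhds.2 fun x x' hne => ?_
  obtain ⟨w, rfl⟩ := Quotient.exists_rep x
  obtain ⟨w', rfl⟩ := Quotient.exists_rep x'
  obtain ⟨v, hv, e⟩ := h.exists_nhds_mk w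
  obtain ⟨v', hv', e'⟩ := h.exists_nhds_mk w'
  have hn : ¬ r w w' := fun hr => hne (Quotient.sound hr)
  rw [e, e']
  simp only [disjoint_sup_left, disjoint_sup_right]
  refine ⟨⟨key _ _ hn, key _ _ fun hr => hn (r.trans hv hr)⟩,
    key _ _ fun hr => hn (r.trans hr (r.symm hv')),
    key _ _ fun hr => hn (r.trans hv (r.trans hr (r.symm hv')))⟩

theorem mk_mem_image_iff (h : IsPairing A r E) {U : Set Z} (hU : ∀ w ∈ U, w ∉ E) {w : Z} :
    Quotient.mk r w ∈ Quotient.mk r '' U ↔ w ∈ U := by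
  refine ⟨?_, fun hw => ⟨w, hw, rfl⟩⟩
  rintro ⟨a, ha, hab⟩
  rwa [← h.eq_of_notMem a w (Quotient.exact hab) (hU a ha)]

/-- Charts of the quotient away from the nodes. -/
theorem exists_plane_chart (h : IsPairing A r E) {w : Z} (hw : w ∉ E)
    {d : NodalChart _ Z} (hd : d ∈ A.atlas) (hwd : w ∈ d.source) :
    ∃ φ, NodalChart.plane φ ∈ (glueSurface A r).atlas ∧ Quotient.mk r w ∈ φ.source := by
  set U := d.source \ E with hU
  have hUE : ∀ w ∈ U, w ∉ E := fun w hw => hw.2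
  have hUo : IsOpen U := d.isOpen_source.sdiff (h.isClosed_of_subset subset_rfl)
  -- Off `E` classes are singletons, so the chosen representative inverts the quotient map there.
  have hout : ∀ w' ∈ U, (Quotient.mk r w').out = w' := fun w' hw' =>
    (h.eq_of_notMem w' _ (r.symm (Quotient.mk_out w')) hw'.2).symm
  have hco : IsCoordOn univ (fun x : Quotient r => d.coord x.out) (Quotient.mk r '' U) := by
    refine ⟨?_, ?_, ?_⟩
    · refine isOpen_iff_mem_nhds.2 ?_
      rintro _ ⟨w', hw', rfl⟩
      rw [h.nhds_mk_of_notMem hw'.2]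
      exact image_mem_map (hUo.mem_nhds hw')
    · rintro _ ⟨a, ha, rfl⟩ _ ⟨b, hb, rfl⟩ he
      simp only [hout a ha, hout b hb] at he
      rw [(h.smooth.coordOn d hd).injOn ha.1 hb.1 he]
    · rintro _ ⟨w', hw', rfl⟩
      have e := (h.smooth.coord d hd w' hw'.1).map_nhds
      change _ = 𝓝[SurfaceKind.riemann.model] _
      rw [h.nhds_mk_of_notMem hw'.2, map_map, hout w' hw', ← e]
      refine map_congr (mem_of_superset (hUo.mem_nhds hw') fun w'' hw'' => ?_)
      simp [hout w'' hw'']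
  obtain ⟨φ, hφ, hφc⟩ := IsCoordOn.exists_chart (H := SurfaceKind.riemann.model) hco
    (mem_image_of_mem _ ⟨hwd, hw⟩)
  refine ⟨φ, fun w' hw' e he hwe => ?_, hφ ▸ mem_image_of_mem _ ⟨hwd, hw⟩⟩
  have hw' : Quotient.mk r w' ∈ φ.source := hw'
  rw [hφ, h.mk_mem_image_iff hUE] at hw'
  have hev : d.coord =ᶠ[𝓝 w'] fun y => (NodalChart.plane φ).coord (Quotient.mk r y) := by
    filter_upwards [hUo.mem_nhds hw'] with y hy
    change _ = (φ (Quotient.mk r y) : ℂ)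
    rw [hφc _ (mem_image_of_mem _ hy), hout y hy]
  exact ⟨AnalyticRel.congr (h.smooth.rel e he d hd w' hwe hw'.1) (EventuallyEq.refl _ _) hev,
    AnalyticRel.congr (h.smooth.rel d hd e he w' hw'.1 hwe) hev (EventuallyEq.refl _ _)⟩

/-- The origin of the model of Riemann surfaces. -/
def _root_.SurfaceKind.origin : SurfaceKind.riemann.model := ⟨0, trivial⟩

/-- A coordinate centred at `a`. -/
def centered (s : Z → ℂ) (a : Z) (w : Z) : SurfaceKind.riemann.model := ⟨s w - s a, trivial⟩

theorem map_centered {s : Z → ℂ} {a w : Z} (hs : IsCoordAt univ s w) :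
    map (centered s a) (𝓝 w) = 𝓝 (centered s a w) := by
  apply map_injective Subtype.val_injective
  rw [map_map, map_nhds_subtype_val]
  have h1 : Subtype.val ∘ centered s a = (fun z => z - s a) ∘ s := rfl
  rw [h1, ← map_map, hs.map_nhds]
  change map _ (𝓝[univ] _) = 𝓝[univ] _
  rw [nhdsWithin_univ, nhdsWithin_univ]
  exact (Homeomorph.subRight (s a)).map_nhds_eq (s w)

theorem _root_.Wedge.map_emb_nhds {H : Set ℂ} {a z : H} (hz : z ≠ a) (i : Bool) :
    map (Wedge.emb a i) (𝓝 z) = 𝓝 (Wedge.emb a i z) := by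
  rw [(Wedge.isEmbedding_emb i).map_nhds_eq, nhdsWithin_eq_nhds.2]
  refine mem_of_superset ((Wedge.isOpen_sheet i).mem_nhds (x := Wedge.emb a i z) ?_)
    (Wedge.range_emb i ▸ sdiff_subset)
  rw [Wedge.sheet_eq]
  exact fun h => hz (by rw [← h, Wedge.proj_emb])

theorem _root_.Wedge.map_emb_nhds_sup {H : Set ℂ} (a : H) :
    map (Wedge.emb a true) (𝓝 a) ⊔ map (Wedge.emb a false) (𝓝 a) = 𝓝 (Wedge.node a) := by
  rw [(Wedge.isEmbedding_emb true).map_nhds_eq, (Wedge.isEmbedding_emb false).map_nhds_eq,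
    Wedge.emb_self, Wedge.emb_self, ← nhdsWithin_union, Wedge.range_emb, Wedge.range_emb]
  have : Wedge.branch a true ∪ Wedge.branch a false = univ :=
    eq_univ_of_forall Wedge.mem_branch
  rw [this, nhdsWithin_univ]

/-- Charts of the quotient at the nodes. -/
theorem exists_node_chart (h : IsPairing A r E) {a : Z} (ha : a ∈ E) :
    ∃ φ hφ, NodalChart.node SurfaceKind.origin φ hφ ∈ (glueSurface A r).atlas ∧
      φ.center = Quotient.mk r a := by
  classical
  have := h.t2
  obtain ⟨b, hba, hab, hc⟩ := h.partner a ha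
  have hb : b ∈ E := h.partner_mem hba hab
  obtain ⟨d, hd, had⟩ := h.smooth.covers a
  obtain ⟨e, he, hbe⟩ := h.smooth.covers b
  obtain ⟨U₀, V₀, hU₀, hV₀, haU₀, hbV₀, hdis₀⟩ := t2_separation hba.symm
  obtain ⟨U₁, hU₁, haU₁, hU₁i, hU₁E⟩ := h.exists_injOn a
  obtain ⟨V₁, hV₁, hbV₁, hV₁i, hV₁E⟩ := h.exists_injOn b
  set U := U₀ ∩ U₁ ∩ d.source with hU
  set V := V₀ ∩ V₁ ∩ e.source with hV
  have hUo : IsOpen U := (hU₀.inter hU₁).inter d.isOpen_source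
  have hVo : IsOpen V := (hV₀.inter hV₁).inter e.isOpen_source
  have haU : a ∈ U := ⟨⟨haU₀, haU₁⟩, had⟩
  have hbV : b ∈ V := ⟨⟨hbV₀, hbV₁⟩, hbe⟩
  have hdis : ∀ w, w ∈ U → w ∉ V := fun w h1 h2 => disjoint_left.1 hdis₀ h1.1.1 h2.1.1
  have hUE : ∀ w ∈ U, w ∈ E → w = a := fun w hw => hU₁E w hw.1.2
  have hVE : ∀ w ∈ V, w ∈ E → w = b := fun w hw => hV₁E w hw.1.2
  have hds : ∀ w ∈ U, w ∈ d.source := fun w hw => hw.2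
  have hes : ∀ w ∈ V, w ∈ e.source := fun w hw => hw.2
  let o := SurfaceKind.origin
  have hca : centered d.coord a a = o := Subtype.ext (sub_self _)
  have hcb : centered e.coord b b = o := Subtype.ext (sub_self _)
  have hcd : ∀ w ∈ U, centered d.coord a w = o → w = a := fun w hw hwo => by
    refine (h.smooth.coordOn d hd).injOn (hds w hw) had (sub_eq_zero.1 ?_)
    exact congrArg Subtype.val hwo
  have hce : ∀ w ∈ V, centered e.coord b w = o → w = b := fun w hw hwo => by
    refine (h.smooth.coordOn e he).injOn (hes w hw) hbe (sub_eq_zero.1 ?_)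
    exact congrArg Subtype.val hwo
  -- A disc around each of the two points goes to its own branch. The default value is the node, so
  -- that every point of `E` is sent to the node and `f` respects all identifications at once.
  let f : Z → Wedge SurfaceKind.riemann.model o := fun w =>
    if w ∈ U then Wedge.emb o true (centered d.coord a w)
    else if w ∈ V then Wedge.emb o false (centered e.coord b w) else Wedge.node o
  have fU : ∀ w ∈ U, f w = Wedge.emb o true (centered d.coord a w) := fun w hw => if_pos hw
  have fV : ∀ w ∈ V, f w = Wedge.emb o false (centered e.coord b w) := fun w hw => by
    simp only [f, if_neg (fun h' => hdis w h' hw), if_pos hw]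
  have fE : ∀ w ∈ E, f w = Wedge.node o := by
    intro w hw
    by_cases h1 : w ∈ U
    · rw [fU w h1, hUE w h1 hw, hca, Wedge.emb_self]
    · by_cases h2 : w ∈ V
      · rw [fV w h2, hVE w h2 hw, hcb, Wedge.emb_self]
      · simp only [f, if_neg h1, if_neg h2]
  have hresp : ∀ w w', r w w' → f w = f w' := by
    intro w w' hww
    by_cases he : w = w'
    · rw [he]
    · rw [fE w (h.partner_mem he (r.symm hww)), fE w' (h.partner_mem (Ne.symm he) hww)]
  let F : Quotient r → Wedge SurfaceKind.riemann.model o := Quotient.lift f hresp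
  have hFa : F (Quotient.mk r a) = Wedge.node o := fE a ha
  have hsat : ∀ w w', r w w' → w ∈ U ∪ V → w' ∈ U ∪ V := by
    intro w w' hww hw
    by_cases hwE : w ∈ E
    · have hw' : w' = a ∨ w' = b := by
        rcases hw with h1 | h1
        · exact hc w' (hUE w h1 hwE ▸ hww)
        · exact hc w' (r.trans hab (hVE w h1 hwE ▸ hww))
      rcases hw' with rfl | rfl
      exacts [Or.inl haU, Or.inr hbV]
    · rwa [← h.eq_of_notMem w w' hww hwE]
  have hpre : Quotient.mk r ⁻¹' (Quotient.mk r '' (U ∪ V)) = U ∪ V := by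
    ext w
    refine ⟨?_, fun hw => ⟨w, hw, rfl⟩⟩
    rintro ⟨w', hw', hww⟩
    exact hsat w' w (Quotient.exact hww) hw'
  have hopen : IsOpen (Quotient.mk r '' (U ∪ V)) :=
    isOpen_coinduced.2 (hpre.symm ▸ hUo.union hVo)
  have hmapU : ∀ w ∈ U, map F (map (Quotient.mk r) (𝓝 w)) =
      map (Wedge.emb o true) (𝓝 (centered d.coord a w)) := by
    intro w hw
    rw [map_map, ← map_centered (h.smooth.coord d hd w (hds w hw)), map_map]
    exact map_congr (mem_of_superset (hUo.mem_nhds hw) fU)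
  have hmapV : ∀ w ∈ V, map F (map (Quotient.mk r) (𝓝 w)) =
      map (Wedge.emb o false) (𝓝 (centered e.coord b w)) := by
    intro w hw
    rw [map_map, ← map_centered (h.smooth.coord e he w (hes w hw)), map_map]
    exact map_congr (mem_of_superset (hVo.mem_nhds hw) fV)
  have hna : map F (𝓝 (Quotient.mk r a)) = 𝓝 (F (Quotient.mk r a)) := by
    rw [h.nhds_mk_of_pair hab hc, Filter.map_sup, hmapU a haU, hmapV b hbV, hca, hcb, hFa,
      Wedge.map_emb_nhds_sup]
  have hne : Nonempty (Quotient r) := ⟨Quotient.mk r a⟩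
  obtain ⟨φ, hφs, hφ⟩ := exists_openPartialHomeomorph F hopen (by
      -- Points of different discs have images on different branches, which share only the node; so
      -- both are centres.
      have hmix : ∀ w ∈ U, ∀ w' ∈ V, f w = f w' → Quotient.mk r w = Quotient.mk r w' := by
        intro w hw w' hw' he'
        rw [fU w hw, fV w' hw'] at he'
        have h1 : Wedge.emb o true (centered d.coord a w) = Wedge.node o := by
          by_contra hn
          refine disjoint_left.1 Wedge.disjoint_sheet ⟨Wedge.range_emb (a := o) true ▸ ⟨_, rfl⟩, hn⟩
            ⟨?_, hn⟩
          rw [he']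
          exact Wedge.range_emb (a := o) false ▸ ⟨_, rfl⟩
        rw [h1] at he'
        rw [hcd w hw (Wedge.emb_eq_node.1 h1), hce w' hw' (Wedge.emb_eq_node.1 he'.symm)]
        exact Quotient.sound hab
      rintro _ ⟨w, hw | hw, rfl⟩ _ ⟨w', hw' | hw', rfl⟩ (he' : f w = f w')
      · rw [fU w hw, fU w' hw'] at he'
        have := congrArg Subtype.val ((Wedge.isEmbedding_emb true).injective he')
        rw [(h.smooth.coordOn d hd).injOn (hds w hw) (hds w' hw') (sub_left_injective this)]
      · exact hmix w hw w' hw' he'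
      · exact (hmix w' hw' w hw he'.symm).symm
      · rw [fV w hw, fV w' hw'] at he'
        have := congrArg Subtype.val ((Wedge.isEmbedding_emb false).injective he')
        rw [(h.smooth.coordOn e he).injOn (hes w hw) (hes w' hw') (sub_left_injective this)]) (by
      rintro _ ⟨w, hw | hw, rfl⟩
      · by_cases hwE : w ∈ E
        · rw [hUE w hw hwE]; exact hna
        · rw [h.nhds_mk_of_notMem hwE, hmapU w hw]
          change _ = 𝓝 (f w)
          rw [fU w hw, Wedge.map_emb_nhds]
          exact fun he' => hwE (hcd w hw he' ▸ ha)
      · by_cases hwE : w ∈ E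
        · have : Quotient.mk r w = Quotient.mk r a :=
            Quotient.sound (r.symm (hVE w hw hwE ▸ hab))
          rw [this]; exact hna
        · rw [h.nhds_mk_of_notMem hwE, hmapV w hw]
          change _ = 𝓝 (f w)
          rw [fV w hw, Wedge.map_emb_nhds]
          exact fun he' => hwE (hce w hw he' ▸ hb))
  have haφ : Quotient.mk r a ∈ φ.source := hφs ▸ mem_image_of_mem _ (Or.inl haU)
  have hφa : φ (Quotient.mk r a) = Wedge.node o := (hφ _).trans hFa
  refine ⟨φ, hφa ▸ φ.map_source haφ, ?_, ?_⟩
  · intro w hw k hk hwk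
    have hw' : w ∈ U ∪ V := by
      have hw : Quotient.mk r w ∈ φ.source := hw
      rw [hφs] at hw
      exact hpre ▸ hw
    -- Pulled back to either disc, the wedge coordinate is a chart of the original surface up to a
    -- translation.
    have aux : ∀ {l : NodalChart SurfaceKind.riemann.model Z} {a' : Z} {D : Set Z} {i : Bool},
        l ∈ A.atlas → IsOpen D → w ∈ D → w ∈ l.source →
        (∀ w' ∈ D, f w' = Wedge.emb o i (centered l.coord a' w')) →
        AnalyticRel k.coord (fun y => (φ (Quotient.mk r y)).coord) w ∧
        AnalyticRel (fun y => (φ (Quotient.mk r y)).coord) k.coord w := by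
      intro l a' D i hl hD hwD hwl hf
      have hev : ∀ᶠ y in 𝓝 w, (φ (Quotient.mk r y)).coord = l.coord y - l.coord a' := by
        filter_upwards [hD.mem_nhds hwD] with y hy
        rw [hφ]
        change (f y).coord = _
        rw [hf y hy, Wedge.coord_emb]
        rfl
      constructor
      · refine AnalyticRel.trans (h.smooth.rel k hk l hl w hwk hwl) ?_
        exact ⟨fun z => z - l.coord a', by fun_prop, hev⟩
      · refine AnalyticRel.trans ?_ (h.smooth.rel l hl k hk w hwl hwk)
        exact ⟨fun z => z + l.coord a', by fun_prop, hev.mono fun y hy => by simp only [hy]; ring⟩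
    rcases hw' with hw' | hw'
    · exact aux hd hUo hw' (hds w hw') fU
    · exact aux he hVo hw' (hes w hw') fV
  · rw [OpenPartialHomeomorph.center, ← hφa, φ.left_inv haφ]

/-- Off `E` there is a plane chart, which topologically rules out a node; at `E` the constructed
chart is centred. -/
theorem mem_crossing_glue (h : IsPairing A r E) {w : Z} :
    Quotient.mk r w ∈ (glueSurface A r).crossing ↔ w ∈ E := by
  constructor
  · intro hw
    by_contra hwE
    obtain ⟨d, hd, hwd⟩ := h.smooth.covers w
    obtain ⟨φ, -, hφ⟩ := h.exists_plane_chart hwE hd hwd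
    exact not_isCoordAt_of_mem_crossing hw .riemann _ (φ.isCoordOn.isCoordAt hφ)
  · intro hw
    obtain ⟨φ, hφ, h1, h2⟩ := h.exists_node_chart hw
    exact mem_crossing.2 ⟨_, h1, _, φ, hφ, rfl, h2⟩

theorem nodes_glue (A : NodalSurfaceData .riemann Z) (r : Setoid Z) :
    (glueSurface A r).nodes = (glueSurface A r).crossing := by
  unfold nodes crossing inessentialNodes
  rw [show (glueSurface A r).distinguished = ∅ from rfl, union_empty]

theorem conicNodes_glue (A : NodalSurfaceData .riemann Z) (r : Setoid Z) :
    (glueSurface A r).conicNodes = (glueSurface A r).crossing := by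
  rw [crossing, boundaryNodes_riemann, union_empty]

theorem isGermConnected_map_mk (h : IsPairing A r E) (w : Z) :
    IsGermConnected (map (Quotient.mk r) (𝓝[≠] w)) := by
  obtain ⟨d, hd, hwd⟩ := h.smooth.covers w
  exact (h.smooth.coord d hd w hwd).isGermConnected.map
    (Eventually.of_forall fun _ => continuous_quotient_mk'.continuousAt)

theorem nhdsNE_mk_of_pair (h : IsPairing A r E) {a b : Z} (hab : r a b)
    (hc : ∀ c, r a c → c = a ∨ c = b) : 𝓝[≠] (Quotient.mk r a) =
      map (Quotient.mk r) (𝓝[≠] a) ⊔ map (Quotient.mk r) (𝓝[≠] b) := by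
  have key : ∀ w, Quotient.mk r w = Quotient.mk r a →
      map (Quotient.mk r) (𝓝 w) ⊓ 𝓟 {Quotient.mk r a}ᶜ = map (Quotient.mk r) (𝓝[≠] w) := by
    intro w hw
    ext V
    rw [mem_inf_principal, mem_map, mem_map, mem_nhdsWithin_iff_eventually, ← eventually_mem_set]
    have hne := eventually_nhdsWithin_iff.1 (h.eventually_mk_ne w)
    constructor
    · intro hV
      filter_upwards [hV, hne] with w' h1 h2 h3
      exact h1 (hw ▸ h2 h3)
    · intro hV
      filter_upwards [hV] with w' h1 h2
      exact h1 fun he => h2 (by rw [mem_singleton_iff, ← hw, mem_singleton_iff.1 he])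
  rw [nhdsWithin, h.nhds_mk_of_pair hab hc, inf_sup_right, key a rfl,
    key b (Quotient.sound (r.symm hab))]

end IsPairing

end NodalSurfaceData
end

noncomputable section

/-! ### The quotient as a surface with nodes, and its normalization. -/

namespace NodalSurfaceData

variable {Z : Type u} [TopologicalSpace Z] {A : NodalSurfaceData .riemann Z} {r : Setoid Z}
  {E : Set Z}

theorem branchFilter_eq {κ : SurfaceKind} {X : Type*} [TopologicalSpace X] {a : κ.model}
    (φ : OpenPartialHomeomorph X (Wedge κ.model a)) (i : Bool) :
    branchFilter φ i = pure φ.center ⊔ 𝓝[φ.sheet i] φ.center := nhdsWithin_insert _ _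

namespace IsPairing

theorem map_mk_nhds (w : Z) : map (Quotient.mk r) (𝓝 w) =
    pure (Quotient.mk r w) ⊔ map (Quotient.mk r) (𝓝[≠] w) := by
  rw [← pure_sup_nhdsNE, Filter.map_sup, map_pure]

/-- The two branches at a node of the quotient come from the two points over it. -/
theorem branchFilter_eq_map (h : IsPairing A r E) {a b : Z} (hab : r a b)
    (hc : ∀ c, r a c → c = a ∨ c = b) {o : SurfaceKind.riemann.model}
    {φ : OpenPartialHomeomorph (Quotient r) (Wedge SurfaceKind.riemann.model o)}
    (hφ : Wedge.node o ∈ φ.target) (hφa : φ.center = Quotient.mk r a) :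
    ∃ i, map (Quotient.mk r) (𝓝 a) = branchFilter φ i ∧
      map (Quotient.mk r) (𝓝 b) = branchFilter φ (!i) := by
  have e := h.nhdsNE_mk_of_pair hab hc
  have hba : Quotient.mk r b = Quotient.mk r a := Quotient.sound (r.symm hab)
  rw [← hφa, OpenPartialHomeomorph.nhdsNE_center hφ] at e
  have := OpenPartialHomeomorph.neBot_sheet hφ true
  have := OpenPartialHomeomorph.neBot_sheet hφ false
  -- The images of the two punctured discs and the two sheets of the chart both decompose the
  -- punctured neighbourhood of the node into connected germs.
  rcases IsGermConnected.decomposition_unique (h.isGermConnected_map_mk a)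
    (h.isGermConnected_map_mk b) (φ.isOpen_sheet true) (φ.isOpen_sheet false) φ.disjoint_sheet
    self_mem_nhdsWithin self_mem_nhdsWithin e.symm with ⟨h1, h2⟩ | ⟨h1, h2⟩
  · refine ⟨true, ?_, ?_⟩
    · rw [map_mk_nhds, h1, branchFilter_eq, hφa]
    · rw [map_mk_nhds, h2, hba, Bool.not_true, branchFilter_eq, hφa]
  · refine ⟨false, ?_, ?_⟩
    · rw [map_mk_nhds, h1, branchFilter_eq, hφa]
    · rw [map_mk_nhds, h2, hba, Bool.not_false, branchFilter_eq, hφa]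

theorem isCoordAt_comp_mk_of_notMem (h : IsPairing A r E) {w : Z} (hw : w ∉ E)
    {c : NodalChart SurfaceKind.riemann.model (Quotient r)} (hc : Quotient.mk r w ∈ c.source) :
    IsCoordAt univ (fun y => c.coord (Quotient.mk r y)) w := by
  have hx : Quotient.mk r w ∉ (glueSurface A r).crossing := fun hx => hw (h.mem_crossing_glue.1 hx)
  have hco : IsCoordAt SurfaceKind.riemann.model c.coord (Quotient.mk r w) := by
    refine (NodalChart.isCenter_or_isCoordAt hc).resolve_left fun hcen => ?_
    obtain ⟨d, hd, hwd⟩ := h.smooth.covers w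
    obtain ⟨φ, -, hφ⟩ := h.exists_plane_chart hw hd hwd
    exact hcen.not_isCoordAt .riemann _ (φ.isCoordOn.isCoordAt hφ)
  obtain ⟨U, hwU, hU⟩ := hco
  have hcont : Continuous (Quotient.mk r) := continuous_quotient_mk'
  have hE : IsOpen Eᶜ := (h.isClosed_of_subset subset_rfl).isOpen_compl
  refine ⟨Quotient.mk r ⁻¹' U ∩ Eᶜ, ⟨hwU, hw⟩, (hU.isOpen.preimage hcont).inter hE, ?_, ?_⟩
  · intro a ha b hb hab
    exact h.eq_of_notMem a b (Quotient.exact (hU.injOn ha.1 hb.1 hab)) ha.2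
  · intro a ha
    change _ = 𝓝[SurfaceKind.riemann.model] _
    rw [← hU.map_nhds _ ha.1, h.nhds_mk_of_notMem ha.2, map_map]
    rfl

/-- The chart need not belong to the atlas: at a node it is necessarily centred, and one of its
branches is the image of a disc around `w`. This generality is what maximality of the atlas
requires. -/
theorem isCoordAt_comp_mk (h : IsPairing A r E) {w : Z}
    {c : NodalChart SurfaceKind.riemann.model (Quotient r)} (hc : Quotient.mk r w ∈ c.source) :
    IsCoordAt univ (fun y => c.coord (Quotient.mk r y)) w := by
  by_cases hw : w ∈ E
  swap
  · exact h.isCoordAt_comp_mk_of_notMem hw hc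
  have hcont : Continuous (Quotient.mk r) := continuous_quotient_mk'
  obtain ⟨o, φ, hφ, rfl, hφw⟩ := isCenter_of_mem_crossing (h.mem_crossing_glue.2 hw) hc
  obtain ⟨b, -, hab, hcb⟩ := h.partner w hw
  obtain ⟨i, hi, -⟩ := h.branchFilter_eq_map hab hcb hφ hφw
  obtain ⟨U, hU, hwU, hUi, hUE⟩ := h.exists_injOn w
  have hmem : Quotient.mk r ⁻¹' (insert φ.center (φ.sheet i)) ∈ 𝓝 w := by
    rw [← mem_map, hi]
    exact self_mem_nhdsWithin
  refine ⟨interior (Quotient.mk r ⁻¹' (insert φ.center (φ.sheet i))) ∩ U,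
    ⟨mem_interior_iff_mem_nhds.2 hmem, hwU⟩, isOpen_interior.inter hU, ?_, ?_⟩
  · intro a ha b' hb' he
    have ha' := interior_subset ha.1
    have hb'' := interior_subset hb'.1
    rw [← OpenPartialHomeomorph.branch_eq_insert hφ] at ha' hb''
    exact hUi ha.2 hb'.2 (φ.injOn ha'.1 hb''.1 (Wedge.injOn_coord i ha'.2 hb''.2 he))
  · intro a ha
    by_cases haw : a = w
    · subst haw
      change map (fun y => (φ (Quotient.mk r y)).coord) (𝓝 a) =
        𝓝[SurfaceKind.riemann.model] (φ (Quotient.mk r a)).coord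
      rw [← hφw, OpenPartialHomeomorph.apply_center hφ, Wedge.coord_node,
        ← OpenPartialHomeomorph.map_coord_branch hφ i]
      change _ = map _ (branchFilter φ i)
      rw [← hi, map_map]
      rfl
    · refine (h.isCoordAt_comp_mk_of_notMem (fun haE => haw (hUE a ha.2 haE)) ?_).map_nhds
      have ha' := interior_subset ha.1
      rw [← OpenPartialHomeomorph.branch_eq_insert hφ] at ha'
      exact ha'.1

theorem isSurface_glue (h : IsPairing A r E) : (glueSurface A r).IsSurface where
  t2 := h.t2Space
  covers x := by
    obtain ⟨w, rfl⟩ := Quotient.exists_rep x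
    by_cases hw : w ∈ E
    · obtain ⟨φ, hφ, h1, h2⟩ := h.exists_node_chart hw
      exact ⟨_, h1, h2 ▸ OpenPartialHomeomorph.center_mem hφ⟩
    · obtain ⟨d, hd, hwd⟩ := h.smooth.covers w
      obtain ⟨φ, h1, h2⟩ := h.exists_plane_chart hw hd hwd
      exact ⟨_, h1, h2⟩
  compatible := by
    have key : ∀ c ∈ (glueSurface A r).atlas, ∀ c' ∈ (glueSurface A r).atlas,
        ∀ x ∈ c.source ∩ c'.source, x ∉ (glueSurface A r).nodes →
          AnalyticRel c.coord c'.coord x := by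
      intro c hc c' hc' x hx hn
      obtain ⟨w, rfl⟩ := Quotient.exists_rep x
      rw [nodes_glue, h.mem_crossing_glue] at hn
      obtain ⟨d, hd, hwd⟩ := h.smooth.covers w
      obtain ⟨F, hF, hev⟩ := (hc w hx.1 d hd hwd).2.trans (hc' w hx.2 d hd hwd).1
      refine ⟨F, hF, ?_⟩
      rw [h.nhds_mk_of_notMem hn]
      exact hev
    exact fun c hc c' hc' x hx hn => ⟨key c hc c' hc' x hx hn, key c' hc' c hc x hx.symm hn⟩
  maximal := by
    intro c hc w hw d hd hwd
    have hcont : Continuous (Quotient.mk r) := continuous_quotient_mk'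
    have hcs : ∀ᶠ y in 𝓝 w, Quotient.mk r y ∈ c.source :=
      hcont.continuousAt.preimage_mem_nhds (c.isOpen_source.mem_nhds hw)
    -- A compatible chart is controlled only off the nodes, whereas the atlas asks for analyticity
    -- at every point upstairs. Removable singularities fill in the isolated points of `E`.
    have key : ∀ᶠ y in 𝓝[≠] w, AnalyticRel d.coord (fun y => c.coord (Quotient.mk r y)) y ∧
        AnalyticRel (fun y => c.coord (Quotient.mk r y)) d.coord y := by
      filter_upwards [h.isolated w, nhdsWithin_le_nhds hcs,
        nhdsWithin_le_nhds (d.isOpen_source.mem_nhds hwd)] with y hyE hyc hyd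
      obtain ⟨φ, h1, h2⟩ := h.exists_plane_chart hyE hd hyd
      have hn : Quotient.mk r y ∉ (glueSurface A r).nodes := by
        rw [nodes_glue, h.mem_crossing_glue]; exact hyE
      have hcc := hc _ h1 _ ⟨hyc, h2⟩ hn
      have h3 := h1 y h2 d hd hyd
      exact ⟨h3.1.trans (AnalyticRel.comp hcc.2 hcont.continuousAt),
        (AnalyticRel.comp hcc.1 hcont.continuousAt).trans h3.2⟩
    have hs := h.smooth.coord d hd w hwd
    have ht : IsCoordAt SurfaceKind.riemann.model _ w := h.isCoordAt_comp_mk hw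
    exact ⟨SurfaceKind.Rel.of_punctured (κ := .riemann) hs ht key,
      SurfaceKind.Rel.of_punctured (κ := .riemann) ht hs (key.mono fun _ h => h.symm)⟩
  distinguished_closed := isClosed_empty
  distinguished_discrete := inferInstanceAs (DiscreteTopology (∅ : Set (Quotient r)))
  distinguished_interior := fun x hx => hx.elim
  distinguished_riemann := fun _ => rfl

theorem isBranch_glue (h : IsPairing A r E) (w : Z) :
    (glueSurface A r).IsBranch (Quotient.mk r w) (map (Quotient.mk r) (𝓝 w)) := by
  by_cases hw : w ∈ E
  · obtain ⟨φ, hφ, h1, h2⟩ := h.exists_node_chart hw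
    obtain ⟨b, -, hab, hcb⟩ := h.partner w hw
    obtain ⟨i, hi, -⟩ := h.branchFilter_eq_map hab hcb hφ h2
    rw [hi, ← h2]
    exact isBranch_branchFilter h1 i
  · rw [isBranch_of_notMem_crossing fun hx => hw (h.mem_crossing_glue.1 hx)]
    exact (h.nhds_mk_of_notMem hw).symm

/-- The point of the normalization of the quotient given by a point of the original surface. -/
def toNormalization (h : IsPairing A r E) (w : Z) : (glueSurface A r).Normalization :=
  ⟨(Quotient.mk r w, map (Quotient.mk r) (𝓝 w)), h.isBranch_glue w⟩

/-- The two points of a pair give the two different branches at the node, and a node has no others.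
-/
theorem bijective_toNormalization (h : IsPairing A r E) :
    Function.Bijective h.toNormalization := by
  constructor
  · intro a b hab
    by_contra hne
    have h1 : r a b := Quotient.exact (congrArg (fun q => q.1.1) hab)
    have h2 : map (Quotient.mk r) (𝓝 a) = map (Quotient.mk r) (𝓝 b) :=
      congrArg (fun q => q.1.2) hab
    have haE : a ∈ E := h.partner_mem hne (r.symm h1)
    obtain ⟨φ, hφ, -, hφa⟩ := h.exists_node_chart haE
    obtain ⟨b', -, hab', hcb⟩ := h.partner a haE
    obtain rfl : b = b' := (hcb b h1).resolve_left (Ne.symm hne)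
    obtain ⟨i, hi, hi'⟩ := h.branchFilter_eq_map hab' hcb hφ hφa
    rw [hi, hi'] at h2
    cases i
    · exact branchFilter_injective hφ h2.symm
    · exact branchFilter_injective hφ h2
  · rintro ⟨⟨x, B⟩, hB⟩
    obtain ⟨w, rfl⟩ := Quotient.exists_rep x
    by_cases hw : w ∈ E
    · obtain ⟨φ, hφ, h1, hφw⟩ := h.exists_node_chart hw
      obtain ⟨b, -, hab, hcb⟩ := h.partner w hw
      obtain ⟨i, hi, hi'⟩ := h.branchFilter_eq_map hab hcb hφ hφw
      have hB' : B = branchFilter φ true ∨ B = branchFilter φ false := by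
        rw [← isBranch_iff_of_node_chart h1, hφw]; exact hB
      have hB'' : B = branchFilter φ i ∨ B = branchFilter φ (!i) := by
        cases i
        exacts [hB'.symm, hB']
      rcases hB'' with rfl | rfl
      · exact ⟨w, Subtype.ext (Prod.ext rfl hi)⟩
      · exact ⟨b, Subtype.ext (Prod.ext (Quotient.sound (r.symm hab)) hi')⟩
    · rw [isBranch_of_notMem_crossing fun hx => hw (h.mem_crossing_glue.1 hx)] at hB
      exact ⟨w, Subtype.ext (Prod.ext rfl ((h.nhds_mk_of_notMem hw).symm.trans hB.symm))⟩

/-- The original surface is the normalization of the quotient. -/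
def homeomorph (h : IsPairing A r E) : Z ≃ₜ (glueSurface A r).Normalization :=
  (Equiv.ofBijective _ h.bijective_toNormalization).toHomeomorph fun O => by
    rw [isOpen_normalization_iff, isOpen_iff_mem_nhds, (h.bijective_toNormalization.2).forall]
    refine forall_congr' fun w => forall_congr' fun hw => ?_
    change _ ↔ ∀ᶠ y in map (Quotient.mk r) (𝓝 w), _
    rw [eventually_map]
    have hne := eventually_nhdsWithin_iff.1 (h.eventually_mk_ne w)
    have hE := eventually_nhdsWithin_iff.1 (h.isolated w)
    constructor
    · intro hO
      filter_upwards [hO, hE] with y hy hyE q hq hyq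
      have hyw : y ≠ w := fun he => hyq (by rw [he]; rfl)
      have : h.toNormalization y = q := by
        refine p_inj (hq.symm ▸ rfl) fun hx => ?_
        exact hyE hyw (h.mem_crossing_glue.1 hx)
      exact this ▸ hy
    · intro hO
      filter_upwards [hO, hne] with y hy hne
      by_cases hyw : y = w
      · rw [hyw]; exact hw
      · exact hy _ rfl (hne hyw)

/-- The original surface and the normalization of the quotient have the same analytic structure. -/
theorem isAnalyticCoord_normalization_iff (h : IsPairing A r E)
    {ζ : (glueSurface A r).Normalization → ℂ} {w : Z} :
    (glueSurface A r).normalization.IsAnalyticCoord ζ (h.homeomorph w) ↔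
      A.IsAnalyticCoord (fun y => ζ (h.homeomorph y)) w := by
  obtain ⟨c, hc, hwc⟩ := h.isSurface_glue.covers (Quotient.mk r w)
  obtain ⟨d, hd, hwd, hdr⟩ :=
    exists_normalization_chart h.isSurface_glue (q := h.homeomorph w) hc hwc
  have hk := h.homeomorph.continuous
  have hk' := h.homeomorph.symm.continuous
  have hev : ∀ᶠ y in 𝓝 w, c.coord (Quotient.mk r y) = d.coord (h.homeomorph y) := by
    filter_upwards [hk.continuousAt.preimage_mem_nhds (d.isOpen_source.mem_nhds hwd)] with y hy
    exact (hdr _ hy).2.symm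
  have hA : A.IsAnalyticCoord (fun y => d.coord (h.homeomorph y)) w :=
    IsAnalyticCoord.congr (fun e he hwe => hc w hwc e he hwe) hev
  have hsm := isSmooth_normalization h.isSurface_glue
  constructor
  · intro hζ
    have := hζ d hd hwd
    exact hA.trans (this.1.comp hk.continuousAt) (this.2.comp hk.continuousAt)
  · intro hζ
    have h1 := hA.rel hζ h.smooth
    have h2 := hζ.rel hA h.smooth
    have e : h.homeomorph.symm (h.homeomorph w) = w := h.homeomorph.symm_apply_apply w
    refine hsm.isAnalyticCoord hd hwd ?_ ?_
    · have := AnalyticRel.comp (f := h.homeomorph.symm) (y := h.homeomorph w) (e.symm ▸ h1)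
        hk'.continuousAt
      simpa using this
    · have := AnalyticRel.comp (f := h.homeomorph.symm) (y := h.homeomorph w) (e.symm ▸ h2)
        hk'.continuousAt
      simpa using this

end IsPairing

/-- Local coordinates in which the map is the folding give unbranchedness. -/
theorem isUnbranchedAt_of_fold {Y X : Type u} [TopologicalSpace Y] [TopologicalSpace X]
    {R : NodalSurfaceData .riemann Y} {K : NodalSurfaceData .klein X} {f : Y → X} {y : Y}
    (hR : R.IsSmooth) {ζ : Y → ℂ} (hζ : R.IsAnalyticCoord ζ y)
    {c : NodalChart SurfaceKind.klein.model X} (hc : c ∈ K.atlas) (hy : f y ∈ c.source)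
    (h : ∀ᶠ y' in 𝓝 y, c.coord (f y') = halfPlaneFold (ζ y')) : IsUnbranchedAt R K f y := by
  obtain ⟨d, hd, hyd⟩ := hR.covers y
  obtain ⟨⟨F, hF, hF'⟩, ⟨G, hG, hG'⟩⟩ := hζ d hd hyd
  refine ⟨d, hd, c, hc, hyd, hy, F, hF, ?_, ?_⟩
  · have hmap := (hR.coord d hd y hyd).map_nhds
    change _ = 𝓝[univ] _ at hmap
    rw [nhdsWithin_univ] at hmap
    have e : ∀ᶠ z in 𝓝 (d.coord y), G (F z) = z := by
      rw [← hmap, eventually_map]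
      filter_upwards [hF', hG'] with y' h1 h2
      rw [← h1, ← h2]
    have hFy : F (d.coord y) = ζ y := hF'.self_of_nhds.symm
    -- The chain rule for `G ∘ F`, which is the identity near the point, forbids the derivative of
    -- `F` to vanish.
    have h1 : HasDerivAt (G ∘ F) (deriv G (F (d.coord y)) * deriv F (d.coord y)) (d.coord y) :=
      HasDerivAt.comp _ (hFy ▸ hG).differentiableAt.hasDerivAt hF.differentiableAt.hasDerivAt
    have h2 : HasDerivAt (G ∘ F) 1 (d.coord y) :=
      (hasDerivAt_id _).congr_of_eventuallyEq e
    intro h0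
    rw [h0, mul_zero] at h1
    exact zero_ne_one (h1.unique h2)
  · filter_upwards [h, hF'] with y' h1 h2
    rw [h1, h2]

end NodalSurfaceData
end

noncomputable section

/-! ### Admissible identifications, the doubles they produce, and their number. -/

namespace NodalSurfaceData

variable {κ : SurfaceKind} {X : Type u} [TopologicalSpace X] {S : NodalSurfaceData κ X}

theorem exists_fiber_of_mem_crossing {x : X} (hx : x ∈ S.crossing) :
    ∃ q₁ q₂ : S.Normalization, q₁ ≠ q₂ ∧ S.p q₁ = x ∧ S.p q₂ = x ∧
      ∀ q, S.p q = x → q = q₁ ∨ q = q₂ := by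
  obtain ⟨a, φ, h, hc, rfl⟩ := exists_node_chart hx
  refine ⟨⟨(φ.center, branchFilter φ true), isBranch_branchFilter hc true⟩,
    ⟨(φ.center, branchFilter φ false), isBranch_branchFilter hc false⟩, ?_, rfl, rfl, ?_⟩
  · exact fun he => branchFilter_injective h (congrArg (fun q => q.1.2) he)
  · rintro ⟨⟨x, B⟩, hB⟩ rfl
    rcases (isBranch_iff_of_node_chart hc).1 hB with rfl | rfl
    exacts [Or.inl rfl, Or.inr rfl]

/-- Fibres of the normalization have at most two points, so the point other than `q` is unique. -/
theorem eq_of_p_eq {q q' q'' : S.Normalization} (h : S.p q' = S.p q) (h' : S.p q'' = S.p q)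
    (hne : q' ≠ q) (hne' : q'' ≠ q) : q' = q'' := by
  by_cases hx : S.p q ∈ S.crossing
  · obtain ⟨q₁, q₂, -, -, -, hq⟩ := exists_fiber_of_mem_crossing hx
    rcases hq q rfl with h1 | h1 <;> rcases hq q' h with h2 | h2 <;>
      rcases hq q'' h' with h3 | h3 <;> simp_all
  · exact (hne (p_inj h (h.symm ▸ hx))).elim

theorem exists_ne_of_mem_crossing {q : S.Normalization} (h : S.p q ∈ S.crossing) :
    ∃ q', q' ≠ q ∧ S.p q' = S.p q := by
  obtain ⟨q₁, q₂, hne, h₁, h₂, hq⟩ := exists_fiber_of_mem_crossing h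
  rcases hq q rfl with h3 | h3
  · exact ⟨q₂, h3 ▸ hne.symm, h₂⟩
  · exact ⟨q₁, h3 ▸ hne, h₁⟩

theorem notMem_boundary_of_mem_conicNodes (hS : S.IsSurface) {q : S.Normalization}
    (h : S.p q ∈ S.conicNodes) : q ∉ S.normalization.boundary := by
  obtain ⟨a, φ, hφ, hc, ha, hx⟩ := h
  have hs : S.p q ∈ (NodalChart.node a φ hφ).source := hx ▸ OpenPartialHomeomorph.center_mem hφ
  rw [mem_normalization_boundary_iff hS hc hs, not_not]
  change (φ (S.p q)).coord ∈ _
  rw [← hx]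
  have := OpenPartialHomeomorph.apply_center hφ
  rw [OpenPartialHomeomorph.center] at this
  rwa [this, Wedge.coord_node]

theorem mem_boundary_of_mem_boundaryNodes (hS : S.IsSurface) {q : S.Normalization}
    (h : S.p q ∈ S.boundaryNodes) : q ∈ S.normalization.boundary := by
  obtain ⟨a, φ, hφ, hc, ha, hx⟩ := h
  have hs : S.p q ∈ (NodalChart.node a φ hφ).source := hx ▸ OpenPartialHomeomorph.center_mem hφ
  rw [mem_normalization_boundary_iff hS hc hs]
  change (φ (S.p q)).coord ∉ _
  rw [← hx]
  have := OpenPartialHomeomorph.apply_center hφ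
  rw [OpenPartialHomeomorph.center] at this
  rwa [this, Wedge.coord_node]

theorem notMem_boundary_of_mem_inessentialNodes (hS : S.IsSurface) {q : S.Normalization}
    (h : S.p q ∈ S.inessentialNodes) : q ∉ S.normalization.boundary := by
  obtain ⟨φ, hc, hx, hi⟩ := hS.distinguished_interior _ h
  rw [mem_normalization_boundary_iff hS hc hx, not_not]
  exact hi

theorem notMem_crossing_of_mem_inessentialNodes (hS : S.IsSurface) {x : X}
    (h : x ∈ S.inessentialNodes) : x ∉ S.crossing :=
  disjoint_left.1 (disjoint_distinguished_crossing hS) h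

theorem mem_nodes_iff {x : X} :
    x ∈ S.nodes ↔ x ∈ S.conicNodes ∨ x ∈ S.inessentialNodes ∪ S.boundaryNodes := by
  rw [nodes, union_assoc]; rfl

theorem notMem_conicNodes (hS : S.IsSurface) {x : X}
    (h : x ∈ S.inessentialNodes ∪ S.boundaryNodes) : x ∉ S.conicNodes := fun hx => by
  rcases h with h | h
  · exact notMem_crossing_of_mem_inessentialNodes hS h (Or.inl hx)
  · exact disjoint_left.1 (disjoint_conic_boundaryNodes hS) hx h

theorem IsFolding.finite_fiber {Y Z : Type u} [TopologicalSpace Y] [TopologicalSpace Z]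
    {R : NodalSurfaceData .riemann Y} {K : NodalSurfaceData .klein Z} {f : Y → Z}
    (h : IsFolding R K f) (z : Z) : (f ⁻¹' {z}).Finite := by
  by_cases hz : z ∈ K.boundary
  · exact finite_of_encard_eq_coe (k := 1) (by rw [h.cover.boundary_fiber z hz]; rfl)
  · exact finite_of_encard_eq_coe (k := 2) (by rw [h.cover.interior_fiber z hz]; rfl)

theorem IsFolding.eventually_ne {Y Z : Type u} [TopologicalSpace Y] [TopologicalSpace Z]
    {R : NodalSurfaceData .riemann Y} {K : NodalSurfaceData .klein Z} {f : Y → Z} [T1Space Y]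
    (h : IsFolding R K f) (y : Y) : ∀ᶠ y' in 𝓝[≠] y, f y' ≠ f y := by
  have hfin : (f ⁻¹' {f y} \ {y}).Finite := (h.finite_fiber (f y)).sdiff
  filter_upwards [nhdsWithin_le_nhds (hfin.isClosed.isOpen_compl.mem_nhds fun hy => hy.2 rfl),
    self_mem_nhdsWithin] with y' h1 h2 h3
  exact h1 ⟨h3, h2⟩

end NodalSurfaceData

namespace DoubleData

open NodalSurfaceData

variable {X : Type u} [TopologicalSpace X] {S : NodalSurfaceData .klein X}
  {T : DoubleData S.normalization} {r : Setoid T.Y}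

theorem IsSmoothComplexDouble.isSmooth {Z : Type u} [TopologicalSpace Z]
    {K : NodalSurfaceData .klein Z} {W : DoubleData K} (hW : W.IsSmoothComplexDouble) :
    W.surface.IsSmooth :=
  hW.symmetric.1.isSmooth_of_nodes_eq_empty hW.nodes_empty

theorem IsSmoothComplexDouble.π_surjective (hS : S.IsSurface) (hT : T.IsSmoothComplexDouble) :
    Function.Surjective T.π :=
  (hT.isFolding (isSmooth_normalization hS)).surjective

/-- The points lying over the nodes. -/
def overNodes (T : DoubleData S.normalization) : Set T.Y := {w | S.p (T.π w) ∈ S.nodes}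

/-- Fibres of the double are finite, so a punctured neighbourhood goes to a punctured neighbourhood,
and the nodes below are isolated. -/
theorem isolated_overNodes (hS : S.IsSurface) (hT : T.IsSmoothComplexDouble) (w : T.Y) :
    ∀ᶠ w' in 𝓝[≠] w, w' ∉ T.overNodes := by
  have := hT.symmetric.1.t2
  have h := hT.isFolding (isSmooth_normalization hS)
  have ht : Tendsto T.π (𝓝[≠] w) (𝓝[≠] T.π w) :=
    tendsto_nhdsWithin_iff.2 ⟨h.cover.continuous.continuousAt.tendsto.mono_left nhdsWithin_le_nhds,
      h.eventually_ne w⟩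
  exact ht.eventually (eventually_p_notMem_nodes hS (T.π w))

/-- The partner of `a` is, over a conic node, the matched point on the other branch, unique by
`conic_inj`; over an inessential node, the conjugate of `a`; over a boundary node, the single point
over the other branch. -/
theorem IsGluing.isPairing (hS : S.IsSurface) (hT : T.IsSmoothComplexDouble) (hr : T.IsGluing r) :
    IsPairing T.surface r T.overNodes where
  smooth := hT.isSmooth
  t2 := hT.symmetric.1.t2
  isolated := isolated_overNodes hS hT
  eq_of_notMem a b hab ha := hr.off_nodes a b ha hab
  partner a ha := by
    have hK := isSmooth_normalization hS
    rcases mem_nodes_iff.1 (show S.p (T.π a) ∈ S.nodes from ha) with hc | hi | hb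
    · obtain ⟨b, hb, hab⟩ := hr.conic_match a hc
      refine ⟨b, fun he => hb (by rw [he]), hab, fun c hac => ?_⟩
      by_cases hac' : T.π a = T.π c
      · exact Or.inl (hr.conic_inj a c hc hac hac').symm
      · have h1 := hr.same_image a b hab
        have h2 := hr.same_image a c hac
        refine Or.inr (hr.conic_inj b c (h1 ▸ hc) (r.trans (r.symm hab) hac) ?_).symm
        exact eq_of_p_eq h1.symm h2.symm hb (Ne.symm hac')
    · have hnb := notMem_boundary_of_mem_inessentialNodes hS hi
      refine ⟨T.σ a, hT.σ_ne hK hnb,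
        hr.two_three a _ (by rw [hT.comp]) (Or.inl hi), fun c hac => ?_⟩
      by_cases hca : c = a
      · exact Or.inl hca
      · have h2 := p_inj (hr.same_image a c hac) (notMem_crossing_of_mem_inessentialNodes hS hi)
        exact Or.inr (hT.eq_σ_of_ne hK h2 hnb (Ne.symm hca))
    · have hx : S.p (T.π a) ∈ S.crossing := Or.inr hb
      obtain ⟨q, hq, hpq⟩ := exists_ne_of_mem_crossing hx
      obtain ⟨b, rfl⟩ := hT.π_surjective hS q
      refine ⟨b, fun he => hq (by rw [he]), hr.two_three a b hpq.symm (Or.inr hb),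
        fun c hac => ?_⟩
      have hac' := hr.same_image a c hac
      have hfib : ∀ {z : S.Normalization}, S.p z = S.p (T.π a) → (T.π ⁻¹' {z}).encard = 1 :=
        fun hz => hT.cover.boundary_fiber _ (mem_boundary_of_mem_boundaryNodes hS (hz ▸ hb))
      by_cases hca : T.π c = T.π a
      · exact Or.inl (encard_eq_one_unique (hfib rfl) hca rfl)
      · exact Or.inr (encard_eq_one_unique (hfib hpq) (eq_of_p_eq hac'.symm hpq hca hq) rfl)

theorem IsGluing.not_σ (hS : S.IsSurface) (hT : T.IsSmoothComplexDouble) (hr : T.IsGluing r)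
    {a : T.Y} (ha : S.p (T.π a) ∈ S.conicNodes) : ¬ r a (T.σ a) := fun h =>
  hT.σ_ne (isSmooth_normalization hS) (notMem_boundary_of_mem_conicNodes hS ha)
    (hr.conic_inj a _ ha h (hT.comp a).symm).symm

/-- Two points over different preimages of a conic node are identified, or each of them is
identified with the conjugate of the other one. -/
theorem IsGluing.rel_or_rel_σ (hS : S.IsSurface) (hT : T.IsSmoothComplexDouble)
    (hr : T.IsGluing r) {a b : T.Y} (hp : S.p (T.π a) = S.p (T.π b)) (hne : T.π a ≠ T.π b)
    (ha : S.p (T.π a) ∈ S.conicNodes) : r a b ∨ r a (T.σ b) := by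
  obtain ⟨c, hc, hac⟩ := hr.conic_match a ha
  have hcb : T.π b = T.π c :=
    eq_of_p_eq hp.symm (hr.same_image a c hac).symm (Ne.symm hne) hc
  by_cases h : b = c
  · exact Or.inl (h ▸ hac)
  · right
    rw [← hT.eq_σ_of_ne (isSmooth_normalization hS) hcb
      (notMem_boundary_of_mem_conicNodes hS (hp ▸ ha)) h]
    exact hac

/-- Over a conic node exactly one of the two possible matchings is realised. -/
theorem IsGluing.rel_σ_iff (hS : S.IsSurface) (hT : T.IsSmoothComplexDouble)
    (hr : T.IsGluing r) {a b : T.Y} (hp : S.p (T.π a) = S.p (T.π b)) (hne : T.π a ≠ T.π b)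
    (ha : S.p (T.π a) ∈ S.conicNodes) : r a (T.σ b) ↔ ¬ r a b :=
  ⟨fun h h' => hr.not_σ hS hT (hp ▸ ha) (r.trans (r.symm h') h),
    fun h => (hr.rel_or_rel_σ hS hT hp hne ha).resolve_left h⟩

/-- Both bijections between two conjugate pairs commute with conjugation, so the involution descends
to the quotient. -/
theorem IsGluing.rel_σ (hS : S.IsSurface) (hT : T.IsSmoothComplexDouble)
    (hr : T.IsGluing r) {a b : T.Y} (hab : r a b) : r (T.σ a) (T.σ b) := by
  by_cases he : a = b
  · rw [he]
  have hp := hr.same_image a b hab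
  have ha : S.p (T.π a) ∈ S.nodes := by
    by_contra hn
    exact he (hr.off_nodes a b hn hab)
  rcases mem_nodes_iff.1 ha with hc | hc
  · have hne : T.π a ≠ T.π b := fun h => he (hr.conic_inj a b hc hab h)
    by_contra hn
    have h1 := (hr.rel_or_rel_σ (a := T.σ a) (b := b) hS hT (by rwa [hT.comp]) (by rwa [hT.comp])
      (by rwa [hT.comp])).resolve_right hn
    exact hr.not_σ hS hT hc (r.trans hab (r.symm h1))
  · exact hr.two_three _ _ (by rwa [hT.comp, hT.comp]) (by rwa [hT.comp])

theorem glue_σ_mk (hS : S.IsSurface) (hT : T.IsSmoothComplexDouble) (g : T.Gluing) (w : T.Y) :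
    (T.glue g).σ (Quotient.mk g.1 w) = Quotient.mk g.1 (T.σ w) :=
  Quotient.sound (g.2.rel_σ hS hT (Quotient.mk_out w))

/-- Every class over a point of the surface meets the fibres over all branches there; this is
completeness of the projection. -/
theorem exists_rel_of_p_eq (hS : S.IsSurface) (hT : T.IsSmoothComplexDouble) (hr : T.IsGluing r)
    (w : T.Y) {q : S.Normalization} (hq : S.p q = S.p (T.π w)) : ∃ w', r w w' ∧ T.π w' = q := by
  by_cases he : q = T.π w
  · exact ⟨w, r.refl w, he.symm⟩
  have hx : S.p (T.π w) ∈ S.crossing := by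
    by_contra hn
    exact he (p_inj hq (hq.symm ▸ hn))
  rcases hx with hx | hx
  · obtain ⟨b, hb, hab⟩ := hr.conic_match w hx
    exact ⟨b, hab, eq_of_p_eq (hr.same_image w b hab).symm hq hb he⟩
  · obtain ⟨b, rfl⟩ := hT.π_surjective hS q
    exact ⟨b, hr.two_three w b hq.symm (Or.inr hx), rfl⟩

/-- The double `W` is the quotient of `T` by the identification `r`. -/
structure IsQuotientOf (W : DoubleData S) (T : DoubleData S.normalization) (r : Setoid T.Y)
    (m : T.Y → W.Y) (k : T.Y ≃ₜ W.surface.Normalization) : Prop where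
  isSurface : W.surface.IsSurface
  isQuotientMap : IsQuotientMap m
  apply_eq_iff : ∀ a b, m a = m b ↔ r a b
  mem_conicNodes : ∀ w, m w ∈ W.surface.conicNodes ↔ w ∈ T.overNodes
  nhds_eq : ∀ w ∉ T.overNodes, 𝓝 (m w) = map m (𝓝 w)
  p_apply : ∀ w, W.surface.p (k w) = m w
  isAnalyticCoord_comp : ∀ c ∈ W.surface.atlas, ∀ w, m w ∈ c.source →
    T.surface.IsAnalyticCoord (fun y => c.coord (m y)) w
  isAnalyticCoord_iff : ∀ ζ w, W.surface.normalization.IsAnalyticCoord ζ (k w) ↔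
    T.surface.IsAnalyticCoord (fun y => ζ (k y)) w
  π_apply : ∀ w, W.π (m w) = S.p (T.π w)
  σ_apply : ∀ w, W.σ (m w) = m (T.σ w)

theorem isQuotientOf_glue (hS : S.IsSurface) (hT : T.IsSmoothComplexDouble) (g : T.Gluing) :
    IsQuotientOf (T.glue g) T g.1 (Quotient.mk g.1) (g.2.isPairing hS hT).homeomorph where
  isSurface := (g.2.isPairing hS hT).isSurface_glue
  isQuotientMap := isQuotientMap_quotient_mk'
  apply_eq_iff a b := Quotient.eq
  mem_conicNodes w := by
    rw [← (g.2.isPairing hS hT).mem_crossing_glue]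
    exact (IsPairing.conicNodes_glue T.surface g.1) ▸ Iff.rfl
  nhds_eq w hw := (g.2.isPairing hS hT).nhds_mk_of_notMem hw
  p_apply w := rfl
  isAnalyticCoord_comp c hc w hw d hd hwd := hc w hw d hd hwd
  isAnalyticCoord_iff ζ w := (g.2.isPairing hS hT).isAnalyticCoord_normalization_iff
  π_apply w := rfl
  σ_apply := glue_σ_mk hS hT g

theorem _root_.NodalSurfaceData.IsSurface.nodes_riemann {Y : Type u} [TopologicalSpace Y]
    {R : NodalSurfaceData .riemann Y} (hR : R.IsSurface) : R.nodes = R.conicNodes := by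
  rw [nodes, boundaryNodes_riemann, inessentialNodes, hR.distinguished_riemann rfl, union_empty,
    union_empty]

/-- Everything descends from `T`: continuity by the quotient property, local analytic conditions
because `m` is open at points not over nodes, and the conditions on the lifting because the
normalization of `W` is `T`. -/
theorem IsQuotientOf.isComplexDouble {W : DoubleData S} {m : T.Y → W.Y}
    {k : T.Y ≃ₜ W.surface.Normalization} (h : IsQuotientOf W T r m k) (hS : S.IsSurface)
    (hT : T.IsSmoothComplexDouble) (hr : T.IsGluing r) : W.IsComplexDouble := by
  have hK := isSmooth_normalization hS
  have hF := hT.isFolding hK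
  have hσ := h.σ_apply
  have hπ := h.π_apply
  have hsurj := h.isQuotientMap.surjective
  have hconic := h.mem_conicNodes
  have hnodes : ∀ w, m w ∈ W.surface.nodes ↔ w ∈ T.overNodes :=
    fun w => by rw [h.isSurface.nodes_riemann, hconic]
  have hatlas : ∀ w : T.Y, ∃ c ∈ W.surface.atlas, m w ∈ c.source ∧
      T.surface.IsAnalyticCoord (fun y => c.coord (m y)) w := fun w =>
    let ⟨c, hc, hw⟩ := h.isSurface.covers (m w)
    ⟨c, hc, hw, h.isAnalyticCoord_comp c hc w hw⟩
  have hπc : Continuous W.π := by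
    refine h.isQuotientMap.continuous_iff.2 ?_
    rw [show W.π ∘ m = S.p ∘ T.π from funext hπ]
    exact (continuous_p S).comp hF.cover.continuous
  have hσc : Continuous W.σ := by
    refine h.isQuotientMap.continuous_iff.2 ?_
    rw [show W.σ ∘ m = m ∘ T.σ from funext hσ]
    exact h.isQuotientMap.continuous.comp hT.symmetric.2.1.1.continuous
  refine ⟨⟨h.isSurface, ⟨⟨hσc, ?_, ?_, ?_, ?_⟩, ?_⟩, ?_⟩, ⟨⟨hπc, ?_, ?_, ?_, ?_⟩, ?_, ?_⟩, ?_, ?_⟩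
  · intro x hx
    obtain ⟨w, rfl⟩ := hsurj x
    rw [mem_preimage, hσ, hconic] at hx
    rw [hconic]
    change S.p (T.π (T.σ w)) ∈ S.nodes at hx
    rwa [hT.comp] at hx
  · rw [inessentialNodes, h.isSurface.distinguished_riemann rfl, preimage_empty]
    exact empty_subset _
  · rw [boundaryNodes_riemann, preimage_empty]
    exact empty_subset _
  · rw [boundary_riemann, image_empty]
  · intro x hx
    obtain ⟨w, rfl⟩ := hsurj x
    rw [hnodes] at hx
    obtain ⟨d, hd, d', hd', hwd, hwd', hanti⟩ :=
      hT.symmetric.2.1.2 w (by rw [hT.nodes_empty]; exact notMem_empty _)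
    obtain ⟨c, hc, hwc, hca⟩ := hatlas w
    obtain ⟨c', hc', hwc', hca'⟩ := hatlas (T.σ w)
    refine ⟨c, hc, c', hc', hwc, (hσ w).symm ▸ hwc', ?_⟩
    obtain ⟨F, hFa, hFe⟩ := ((hca d hd hwd).2.trans_anti hanti).trans
      ((hca' d' hd' hwd').1.comp (f := T.σ) hT.symmetric.2.1.1.continuous.continuousAt)
    refine ⟨F, hFa, ?_⟩
    rw [h.nhds_eq w hx, eventually_map]
    filter_upwards [hFe] with y hy
    rw [hσ, hy]
  · intro x
    obtain ⟨w, rfl⟩ := hsurj x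
    rw [hσ, hσ, hT.symmetric.2.2]
  · intro x hx
    obtain ⟨w, rfl⟩ := hsurj x
    exact (hconic w).2 (Or.inl (Or.inl (hπ w ▸ hx)))
  · intro x hx
    obtain ⟨w, rfl⟩ := hsurj x
    exact Or.inr ((hconic w).2 (Or.inl (Or.inr (hπ w ▸ hx))))
  · intro x hx
    obtain ⟨w, rfl⟩ := hsurj x
    exact Or.inr ((hconic w).2 (Or.inr (hπ w ▸ hx)))
  · rw [boundary_riemann, image_empty]
    exact empty_subset _
  · intro x hx
    obtain ⟨w, rfl⟩ := hsurj x
    rw [hnodes] at hx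
    obtain ⟨c', hc', hwc'⟩ := hS.covers (S.p (T.π w))
    obtain ⟨d, hd, hwd, hdc⟩ := exists_normalization_chart hS hc' hwc'
    obtain ⟨ζ, hζ, hfold⟩ := exists_fold_coord hF.smooth hK hF.cover.continuous.continuousAt
      (hF.cover.unbranched w) hd hwd
    obtain ⟨c, hc, hwc, hca⟩ := hatlas w
    obtain ⟨F, hFa, hFe⟩ := hca.rel hζ hF.smooth
    refine ⟨c, hc, c', hc', hwc, (hπ w).symm ▸ hwc', F, hFa, ?_⟩
    rw [h.nhds_eq w hx, eventually_map]
    filter_upwards [hFe, hfold, hF.eventually_mem hwd] with y h1 h2 h3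
    rw [← h1, ← h2, (hdc _ h3).2, hπ]
  · have hlift : ∀ w, S.p (T.π w) = W.π (W.surface.p (k w)) :=
      fun w => by rw [h.p_apply, hπ]
    have hsm := isSmooth_normalization h.isSurface
    -- The lifting of the projection is the projection of `T` itself, transported by `k`.
    refine ⟨fun q => T.π (k.symm q),
      ⟨hF.cover.continuous.comp k.symm.continuous, fun q => ?_⟩, fun x => ?_, ?_⟩
    · rw [hlift, k.apply_symm_apply]
    · obtain ⟨w, rfl⟩ := hsurj x
      ext q
      constructor
      · rintro ⟨q, hk, rfl⟩
        rw [mem_preimage, mem_singleton_iff, hlift, k.apply_symm_apply]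
        exact congrArg _ hk
      · intro hq
        obtain ⟨w', hw', rfl⟩ := exists_rel_of_p_eq hS hT hr w ((hπ w) ▸ hq)
        refine ⟨k w', ?_, ?_⟩
        · exact (h.p_apply w').trans ((h.apply_eq_iff w' w).2 (r.symm hw'))
        · simp only [k.symm_apply_apply]
    · have hfib : ∀ z, (fun q => T.π (k.symm q)) ⁻¹' {z} =
          k '' (T.π ⁻¹' {z}) := fun z => by
        rw [k.image_eq_preimage_symm]; rfl
      refine ⟨hF.cover.continuous.comp k.symm.continuous, fun q => ?_, ?_, ?_⟩
      · obtain ⟨w, rfl⟩ := k.surjective q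
        obtain ⟨d, hd, hwd⟩ := hK.covers (T.π w)
        obtain ⟨ζ, hζ, hfold⟩ := exists_fold_coord hF.smooth hK hF.cover.continuous.continuousAt
          (hF.cover.unbranched w) hd hwd
        have hw : k.symm (k w) = w := k.symm_apply_apply w
        refine isUnbranchedAt_of_fold (ζ := fun q => ζ (k.symm q)) hsm ?_ hd
          (by rwa [hw]) ?_
        · refine (h.isAnalyticCoord_iff _ w).2 ?_
          simpa only [k.symm_apply_apply] using hζ
        · have := k.symm.continuous.continuousAt (x := k w)
          rw [ContinuousAt, hw] at this
          exact this.eventually hfold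
      · intro z hz
        rw [hfib, k.injective.encard_image, hF.cover.interior_fiber z hz]
      · intro z hz
        rw [hfib, k.injective.encard_image, hF.cover.boundary_fiber z hz]
  · intro x
    obtain ⟨w, rfl⟩ := hsurj x
    rw [hσ, hπ, hπ, hT.comp]
  · ext x
    constructor
    · rintro ⟨y, hy, rfl⟩
      obtain ⟨w, rfl⟩ := hsurj y
      exact hπ w ▸ (hnodes w).1 hy
    · intro hx
      obtain ⟨q, rfl⟩ := p_surjective S x
      obtain ⟨w, rfl⟩ := hT.π_surjective hS q
      exact ⟨m w, (hnodes w).2 hx, hπ w⟩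

theorem isComplexDouble_glue (hS : S.IsSurface) (hT : T.IsSmoothComplexDouble) (g : T.Gluing) :
    (T.glue g).IsComplexDouble :=
  (isQuotientOf_glue hS hT g).isComplexDouble hS hT g.2

/-- The identification of all points over each inessential and each boundary node, and of the
points over each conic node on which the labels `L` agree. -/
def labelSetoid (T : DoubleData S.normalization) (L : T.Y → Prop) : Setoid T.Y where
  r x y := x = y ∨ S.p (T.π x) = S.p (T.π y) ∧
    (S.p (T.π x) ∈ S.inessentialNodes ∪ S.boundaryNodes ∨
      S.p (T.π x) ∈ S.conicNodes ∧ (L x ↔ L y))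
  iseqv :=
    { refl := fun x => Or.inl rfl
      symm := by
        rintro x y (rfl | ⟨h1, h2⟩)
        · exact Or.inl rfl
        · exact Or.inr ⟨h1.symm, h1 ▸ h2.imp id fun h => ⟨h.1, h.2.symm⟩⟩
      trans := by
        rintro x y z (rfl | ⟨h1, h2⟩) (rfl | ⟨h3, h4⟩)
        · exact Or.inl rfl
        · exact Or.inr ⟨h3, h4⟩
        · exact Or.inr ⟨h1, h2⟩
        · refine Or.inr ⟨h1.trans h3, ?_⟩
          rw [← h1] at h4
          tauto }

/-- Conjugation reverses the label over conic nodes, so each of the two points over a branch there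
has its own label, and equality of labels is a bijection between branches. -/
theorem isGluing_labelSetoid (hS : S.IsSurface) (hT : T.IsSmoothComplexDouble) {L : T.Y → Prop}
    (hL : ∀ x, S.p (T.π x) ∈ S.conicNodes → (L (T.σ x) ↔ ¬ L x)) :
    T.IsGluing (T.labelSetoid L) where
  same_image := by
    rintro a b (rfl | h)
    exacts [rfl, h.1]
  off_nodes := by
    rintro a b ha (rfl | ⟨-, h⟩)
    · rfl
    · exact (ha (mem_nodes_iff.2 (h.symm.imp And.left id))).elim
  two_three a b hab h := Or.inr ⟨hab, Or.inl h⟩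
  conic_inj := by
    rintro a b ha (rfl | ⟨-, h⟩) hab
    · rfl
    · by_contra hne
      rcases h with h | ⟨-, h⟩
      · exact notMem_conicNodes hS h ha
      · have := hT.eq_σ_of_ne (isSmooth_normalization hS) hab
          (notMem_boundary_of_mem_conicNodes hS ha) hne
        rw [this, hL a ha] at h
        tauto
  conic_match a ha := by
    obtain ⟨q, hq, hpq⟩ := exists_ne_of_mem_crossing (Or.inl ha)
    obtain ⟨b, rfl⟩ := hT.π_surjective hS q
    by_cases h : L a ↔ L b
    · exact ⟨b, hq, Or.inr ⟨hpq.symm, Or.inr ⟨ha, h⟩⟩⟩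
    · refine ⟨T.σ b, by rwa [hT.comp], Or.inr ⟨by rw [hT.comp, hpq], Or.inr ⟨ha, ?_⟩⟩⟩
      rw [hL b (hpq ▸ ha)]
      tauto

/-- Fix a base point `c` in every fibre of the double and order the branches at each conic node as
`e`, `e'`. A gluing is encoded by the set of conic nodes at which the two base points are
identified. -/
theorem mk_gluing (hS : S.IsSurface) (hT : T.IsSmoothComplexDouble) :
    Cardinal.mk T.Gluing = 2 ^ Cardinal.mk S.conicNodes := by
  have hK := isSmooth_normalization hS
  choose c hc using hT.π_surjective hS
  choose e he using p_surjective S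
  have hex : ∀ z : S.conicNodes, ∃ q, q ≠ e z ∧ S.p q = z := fun z => by
    obtain ⟨q, h1, h2⟩ := exists_ne_of_mem_crossing (q := e z) (Or.inl ((he z).symm ▸ z.2))
    exact ⟨q, h1, h2.trans (he z)⟩
  choose e' hne he' using hex
  have ha : ∀ z : S.conicNodes, S.p (T.π (c (e z))) = z := fun z => by rw [hc, he]
  have hb : ∀ z : S.conicNodes, S.p (T.π (c (e' z))) = z := fun z => by rw [hc, he']
  let Φ : T.Gluing → Set S.conicNodes := fun g => {z | g.1 (c (e z)) (c (e' z))}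
  rw [← Cardinal.mk_set]
  refine Cardinal.mk_congr (Equiv.ofBijective Φ ⟨?_, ?_⟩)
  · have key : ∀ g g' : T.Gluing, Φ g = Φ g' → ∀ x y, g.1 x y → g'.1 x y := by
      intro g g' hgg x y hxy
      by_cases hxe : x = y
      · exact hxe ▸ g'.1.refl x
      have hp := g.2.same_image x y hxy
      have hx : S.p (T.π x) ∈ S.nodes := by
        by_contra hn
        exact hxe (g.2.off_nodes x y hn hxy)
      rcases mem_nodes_iff.1 hx with hx | hx
      swap
      · exact g'.2.two_three x y hp hx
      have hπ : T.π x ≠ T.π y := fun h => hxe (g.2.conic_inj x y hx hxy h)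
      -- The case where `x` lies over the first branch `e`; the other case follows by symmetry.
      have main : ∀ x y, g.1 x y → S.p (T.π x) ∈ S.conicNodes → T.π x = e (S.p (T.π x)) →
          T.π x ≠ T.π y → g'.1 x y := by
        intro x y hxy hx hex hπ
        have hp := g.2.same_image x y hxy
        let z : S.conicNodes := ⟨_, hx⟩
        have hz : g.1 (c (e z)) (c (e' z)) ↔ g'.1 (c (e z)) (c (e' z)) := Set.ext_iff.1 hgg z
        have hyb : T.π (c (e' z)) = T.π y :=
          eq_of_p_eq (q := T.π x) (hb z) hp.symm (by rw [hc, hex]; exact hne z) (Ne.symm hπ)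
        have hxa : T.π (c (e z)) = T.π x := by rw [hc, hex]
        have hnx := notMem_boundary_of_mem_conicNodes hS hx
        have hny : T.π y ∉ S.normalization.boundary :=
          notMem_boundary_of_mem_conicNodes hS (hp ▸ hx)
        have hp' : S.p (T.π (c (e z))) = S.p (T.π (c (e' z))) := (ha z).trans (hb z).symm
        have hn' : T.π (c (e z)) ≠ T.π (c (e' z)) := by rwa [hxa, hyb]
        have hcz : S.p (T.π (c (e z))) ∈ S.conicNodes := (ha z).symm ▸ z.2
        have hσσ := hT.symmetric.2.2
        have h1 := g.2.rel_σ_iff hS hT hp' hn' hcz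
        have h2 := g'.2.rel_σ_iff hS hT hp' hn' hcz
        have swap : ∀ g : T.Gluing, ∀ {u v}, g.1 (T.σ u) v → g.1 u (T.σ v) := fun g u v h => by
          have := g.2.rel_σ hS hT h
          rwa [hσσ] at this
        have swap' : ∀ g : T.Gluing, ∀ {u v}, g.1 u (T.σ v) → g.1 (T.σ u) v := fun g u v h => by
          have := g.2.rel_σ hS hT h
          rwa [hσσ] at this
        -- Each point is a base point or the conjugate of one. Conjugating one of the two negates
        -- the relation, for `g` and `g'` alike, and conjugating both preserves it.
        by_cases hx1 : c (e z) = x <;> by_cases hy1 : c (e' z) = y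
        · rw [← hx1, ← hy1] at hxy ⊢
          exact hz.1 hxy
        · rw [← hx1, hT.eq_σ_of_ne hK hyb (by rwa [hyb]) hy1] at hxy ⊢
          rw [h2, ← hz]
          exact h1.1 hxy
        · rw [hT.eq_σ_of_ne hK hxa (by rwa [hxa]) hx1, ← hy1] at hxy ⊢
          refine swap' g' ?_
          rw [h2, ← hz]
          exact h1.1 (swap g hxy)
        · rw [hT.eq_σ_of_ne hK hxa (by rwa [hxa]) hx1,
            hT.eq_σ_of_ne hK hyb (by rwa [hyb]) hy1] at hxy ⊢
          have := g.2.rel_σ hS hT hxy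
          rw [hσσ, hσσ] at this
          exact g'.2.rel_σ hS hT (hz.1 this)
      by_cases hex : T.π x = e (S.p (T.π x))
      · exact main x y hxy hx hex hπ
      · refine g'.1.symm (main y x (g.1.symm hxy) (hp ▸ hx) ?_ (Ne.symm hπ))
        rw [← hp]
        exact eq_of_p_eq hp.symm (he _) (Ne.symm hπ) (Ne.symm hex)
    intro g g' hgg
    exact Subtype.ext (Setoid.ext fun x y => ⟨key g g' hgg x y, key g' g hgg.symm x y⟩)
  · intro s
    -- The label marks the base point on the first branch everywhere and on the second branch at the
    -- nodes of `s`; on the second branch at the remaining nodes it marks the conjugate. Equal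
    -- labels then identify the base points exactly over `s`.
    let L : T.Y → Prop := fun x => x = c (T.π x) ↔
      (T.π x = e (S.p (T.π x)) ∨ S.p (T.π x) ∈ Subtype.val '' s)
    have hL : ∀ x, S.p (T.π x) ∈ S.conicNodes → (L (T.σ x) ↔ ¬ L x) := by
      intro x hx
      have hnx := notMem_boundary_of_mem_conicNodes hS hx
      have h1 : T.σ x = c (T.π x) ↔ ¬ x = c (T.π x) := by
        constructor
        · intro h h'
          exact hT.σ_ne hK hnx (h.trans h'.symm)
        · intro h
          exact (hT.eq_σ_of_ne hK (hc _).symm hnx h).symm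
      simp only [L, hT.comp, h1]
      tauto
    refine ⟨⟨T.labelSetoid L, isGluing_labelSetoid hS hT hL⟩, ?_⟩
    ext z
    have hLa : L (c (e z)) := by
      simp only [L, hc, he, true_or]
    have hLb : L (c (e' z)) ↔ z ∈ s := by
      simp only [L, hc, he', hne z, false_or, true_iff]
      exact ⟨fun ⟨z', h, h'⟩ => Subtype.ext h' ▸ h, fun h => ⟨z, h, rfl⟩⟩
    have hce : c (e z) ≠ c (e' z) := fun h => hne z (by rw [← hc (e' z), ← h, hc])
    change (c (e z) = c (e' z) ∨ _) ↔ _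
    rw [or_iff_right hce, ha z, hb z, hLb, iff_true_left hLa]
    constructor
    · rintro ⟨-, h | h⟩
      · exact (notMem_conicNodes hS h z.2).elim
      · exact h.2
    · exact fun h => ⟨rfl, Or.inr ⟨z.2, h⟩⟩

end DoubleData
end

noncomputable section

/-! ### Every complex double is a quotient of the double of the normalization. -/

namespace NodalSurfaceData

section Normalization

variable {κ : SurfaceKind} {X : Type u} [TopologicalSpace X] {S : NodalSurfaceData κ X}

theorem nhds_center_eq {a : κ.model} {φ : OpenPartialHomeomorph X (Wedge κ.model a)}
    (h : Wedge.node a ∈ φ.target) :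
    𝓝 φ.center = branchFilter φ true ⊔ branchFilter φ false := by
  rw [← pure_sup_nhdsNE, OpenPartialHomeomorph.nhdsNE_center h, branchFilter_eq, branchFilter_eq,
    sup_sup_sup_comm, sup_idem]

/-- A neighbourhood of a node is a set belonging to both branches, and each branch is the image of
neighbourhoods in the normalization. -/
theorem isQuotientMap_p (hS : S.IsSurface) : IsQuotientMap S.p := by
  refine (isQuotientMap_iff _).2 ⟨isCoinducing_iff.2 fun V =>
    ⟨fun hV => isOpen_iff_mem_nhds.2 fun x hx => ?_, fun hV => hV.preimage (continuous_p S)⟩,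
    p_surjective S⟩
  have key : ∀ q : S.Normalization, S.p q = x → V ∈ q.1.2 := by
    rintro q rfl
    rw [← map_p_nhds hS q, mem_map]
    exact hV.mem_nhds hx
  by_cases hc : x ∈ S.crossing
  · obtain ⟨a, φ, h, hφ, rfl⟩ := exists_node_chart hc
    rw [nhds_center_eq h]
    exact mem_sup.2 ⟨key ⟨(φ.center, branchFilter φ true), isBranch_branchFilter hφ true⟩ rfl,
      key ⟨(φ.center, branchFilter φ false), isBranch_branchFilter hφ false⟩ rfl⟩
  · exact key ⟨(x, 𝓝 x), (isBranch_of_notMem_crossing hc).2 rfl⟩ rfl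

theorem map_p_nhds_of_notMem (hS : S.IsSurface) {q : S.Normalization} (h : S.p q ∉ S.crossing) :
    map S.p (𝓝 q) = 𝓝 (S.p q) := by
  rw [map_p_nhds hS]
  exact (isBranch_of_notMem_crossing h).1 q.2

/-- A map into the normalization is continuous where the map to the surface is continuous and
takes values off the crossings. -/
theorem continuousAt_of_p_comp (hS : S.IsSurface) {Y : Type*} [TopologicalSpace Y]
    {τ : Y → S.Normalization} {y : Y} (h : ContinuousAt (fun y' => S.p (τ y')) y)
    (hc : ∀ᶠ y' in 𝓝 y, S.p (τ y') ∉ S.crossing) : ContinuousAt τ y := by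
  intro V hV
  have h1 : S.p '' V ∈ 𝓝 (S.p (τ y)) := by
    rw [← map_p_nhds_of_notMem hS hc.self_of_nhds]
    exact image_mem_map hV
  change ∀ᶠ y' in 𝓝 y, τ y' ∈ V
  filter_upwards [h.preimage_mem_nhds h1, hc] with y' h2 h3
  obtain ⟨v, hv, he⟩ := h2
  have : v = τ y' := p_inj he (he ▸ h3)
  exact this ▸ hv

end Normalization

theorem isAnalyticCoord_p {Y : Type u} [TopologicalSpace Y] {R : NodalSurfaceData .riemann Y}
    (hR : R.IsSurface) {q : R.Normalization} {c : NodalChart SurfaceKind.riemann.model Y}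
    (hc : c ∈ R.atlas) (hq : R.p q ∈ c.source) :
    R.normalization.IsAnalyticCoord (fun r => c.coord (R.p r)) q := by
  obtain ⟨d, hd, hqd, hdc⟩ := exists_normalization_chart hR hc hq
  refine IsAnalyticCoord.congr ((isSmooth_normalization hR).isAnalyticCoord_chart hd hqd) ?_
  filter_upwards [d.isOpen_source.mem_nhds hqd] with r hr
  exact (hdc r hr).2

theorem IsAnalyticCoord.isPos_iff {Y Z : Type u} [TopologicalSpace Y] [TopologicalSpace Z]
    {R : NodalSurfaceData .riemann Y} (hR : R.IsSmooth) {f : Y → Z}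
    {c : NodalChart SurfaceKind.klein.model Z} {y : Y} {ζ : Y → ℂ} (hζ : R.IsAnalyticCoord ζ y) :
    R.IsPos f c y ↔ AnalyticRel ζ (fun y' => c.coord (f y')) y := by
  constructor
  · rintro ⟨d, hd, hy, h⟩
    exact (hζ d hd hy).2.trans h
  · intro h
    obtain ⟨d, hd, hy⟩ := hR.covers y
    exact ⟨d, hd, hy, (hζ d hd hy).1.trans h⟩

end NodalSurfaceData

namespace DoubleData

open NodalSurfaceData

variable {X : Type u} [TopologicalSpace X] {S : NodalSurfaceData .klein X} {W : DoubleData S}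

namespace IsComplexDouble

/-- All nodes of a Riemann surface are conic. One direction is the condition on the image of the
nodes, the other the conditions on maps. -/
theorem mem_crossing_iff (hW : W.IsComplexDouble) {y : W.Y} :
    y ∈ W.surface.crossing ↔ W.π y ∈ S.nodes := by
  have hn := hW.symmetric.1.nodes_riemann
  have hx : W.surface.crossing = W.surface.conicNodes := by
    rw [crossing, boundaryNodes_riemann, union_empty]
  rw [hx, ← hn]
  constructor
  · intro h
    rw [← hW.nodes_image]
    exact mem_image_of_mem _ h
  · rintro ((h | h) | h)
    · exact Or.inl (Or.inl (hW.cover.1.conic h))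
    · exact (hW.cover.1.inessential h).elim (fun h => Or.inl (Or.inr h)) fun h => Or.inl (Or.inl h)
    · exact (hW.cover.1.boundaryNode h).elim (fun h => Or.inr h) fun h => Or.inl (Or.inl h)

theorem notMem_nodes (hW : W.IsComplexDouble) {y : W.Y} (h : y ∉ W.surface.crossing) :
    y ∉ W.surface.nodes := by
  rw [hW.symmetric.1.nodes_riemann]
  exact fun h' => h (Or.inl h')

theorem σ_mem_crossing_iff (hW : W.IsComplexDouble) {y : W.Y} :
    W.σ y ∈ W.surface.crossing ↔ y ∈ W.surface.crossing := by
  rw [hW.mem_crossing_iff, hW.mem_crossing_iff, hW.comp]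

variable {g : W.surface.Normalization → S.Normalization}

/-- Away from the nodes the points of a fibre of the lifting are exchanged by the involution. -/
theorem exists_conjugate (hW : W.IsComplexDouble) (hS : S.IsSurface)
    (hg : IsLifting W.surface S W.π g)
    (hc : IsUnbranchedDoubleCover W.surface.normalization S.normalization g)
    {q : W.surface.Normalization} (hq : W.surface.p q ∉ W.surface.crossing)
    (hb : g q ∉ S.normalization.boundary) :
    ∃ q', g q' = g q ∧ W.surface.p q' = W.σ (W.surface.p q) ∧
      ∀ c ∈ S.normalization.atlas, g q ∈ c.source →
        (W.surface.normalization.IsPos g c q' ↔ ¬ W.surface.normalization.IsPos g c q) := by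
  have hR := hW.symmetric.1
  have hF : IsFolding W.surface.normalization S.normalization g :=
    ⟨isSmooth_normalization hR, isSmooth_normalization hS, hc⟩
  -- A pointwise lift of the involution with arbitrary choices of branches. Off the crossings there
  -- is no choice, which makes it continuous at `q`.
  choose τ hτ using fun q => p_surjective W.surface (W.σ (W.surface.p q))
  have hpc := continuous_p W.surface
  have hσc := hW.symmetric.2.1.1.continuous
  have hev : ∀ᶠ r in 𝓝 q, W.surface.p r ∉ W.surface.crossing := by
    rw [← nhdsNE_sup_pure, eventually_sup, eventually_pure]
    exact ⟨(eventually_p_notMem_nodes hR q).mono fun r hr h => hr (crossing_subset_nodes h), hq⟩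
  have hτc : ContinuousAt τ q := by
    refine continuousAt_of_p_comp hR ?_ (hev.mono fun r hr => ?_)
    · simp only [hτ]
      exact (hσc.comp hpc).continuousAt
    · rwa [hτ, hW.σ_mem_crossing_iff]
  have hgτ : ∀ᶠ r in 𝓝 q, g (τ r) = g r := hev.mono fun r hr => by
    have h1 : S.p (g (τ r)) = S.p (g r) := by rw [hg.2, hg.2, hτ, hW.comp]
    refine p_inj h1 fun h => hr (hW.mem_crossing_iff.2 ?_)
    rw [h1, hg.2] at h
    exact crossing_subset_nodes h
  obtain ⟨c₁, hc₁, c₂, hc₂, h₁, h₂, hanti⟩ := hW.symmetric.2.1.2 _ (hW.notMem_nodes hq)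
  obtain ⟨d₁, hd₁, hq₁, he₁⟩ := exists_normalization_chart hR hc₁ h₁
  obtain ⟨d₂, hd₂, hq₂, he₂⟩ := exists_normalization_chart hR (q := τ q) hc₂ (by rwa [hτ])
  have ha : AntianalyticRel d₁.coord (fun r => d₂.coord (τ r)) q := by
    refine AntianalyticRel.congr (hanti.comp hpc.continuousAt) ?_ ?_
    · filter_upwards [d₁.isOpen_source.mem_nhds hq₁] with r hr
      exact (he₁ r hr).2.symm
    · filter_upwards [hτc.preimage_mem_nhds (d₂.isOpen_source.mem_nhds hq₂)] with r hr
      rw [(he₂ _ hr).2, hτ]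
  exact ⟨τ q, hgτ.self_of_nhds, hτ q, fun c hcc hqc =>
    hF.isPos_antianalytic hτc hgτ hd₁ hq₁ hd₂ hq₂ ha hcc hqc hb⟩

/-- Off the nodes the involution exchanges the two points of a fibre. Over a node a lift of the
involution would involve a choice of branch, so the claim is obtained by perturbation: two points
with equal orientation would have, arbitrarily near, two points off the nodes with equal orientation
and equal image. -/
theorem isOrientedDouble (hW : W.IsComplexDouble) (hS : S.IsSurface)
    (hg : IsLifting W.surface S W.π g)
    (hc : IsUnbranchedDoubleCover W.surface.normalization S.normalization g) :
    IsOrientedDouble W.surface.normalization S.normalization g := by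
  have hR := hW.symmetric.1
  have hK := isSmooth_normalization hS
  have hF : IsFolding W.surface.normalization S.normalization g :=
    ⟨isSmooth_normalization hR, hK, hc⟩
  have hoff : ∀ q q', g q = g q' → g q ∉ S.normalization.boundary → q ≠ q' →
      W.surface.p q ∉ W.surface.crossing → ∀ c ∈ S.normalization.atlas, g q ∈ c.source →
        (W.surface.normalization.IsPos g c q' ↔ ¬ W.surface.normalization.IsPos g c q) := by
    intro q q' hqq hb hne hx c hcc hqc
    obtain ⟨q'', h1, -, h2⟩ := hW.exists_conjugate hS hg hc hx hb
    have h3 := h2 c hcc hqc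
    have hne' : q ≠ q'' := by
      rintro rfl
      tauto
    have : q' = q'' :=
      encard_eq_two_unique (hc.interior_fiber _ hb) (a := q) rfl hqq.symm h1 hne hne'
    rwa [this]
  refine hF.isOrientedDouble fun q q' hqq hb hne => ?_
  by_cases hx : W.surface.p q ∈ W.surface.crossing
  swap
  · obtain ⟨c, hcc, hqc⟩ := hK.covers (g q)
    exact ⟨c, hcc, hqc, hoff q q' hqq hb hne hx c hcc hqc⟩
  obtain ⟨c, hcc, hqc⟩ := hK.covers (g q)
  refine ⟨c, hcc, hqc, ?_⟩
  by_contra hcon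
  have hpos : W.surface.normalization.IsPos g c q' ↔ W.surface.normalization.IsPos g c q := by
    tauto
  have := t2Space_normalization hR
  obtain ⟨V, V', hV, hV', hqV, hqV', hd⟩ := t2_separation hne
  have hqc' : g q' ∈ c.source := hqq ▸ hqc
  set D := W.surface.normalization.doubleCoord g c with hD
  have hDD : D q = D q' := by
    rw [hD]
    by_cases hp : W.surface.normalization.IsPos g c q
    · rw [doubleCoord_of_isPos hp, doubleCoord_of_isPos (hpos.2 hp), hqq]
    · rw [doubleCoord_of_not_isPos hp, doubleCoord_of_not_isPos (fun h => hp (hpos.1 h)), hqq]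
  have hm := (hF.isCoordAt hcc hqc).map_nhds
  have hm' := (hF.isCoordAt hcc hqc').map_nhds
  rw [nhdsWithin_univ] at hm hm'
  have hbev : ∀ {r}, g r ∈ c.source → (g r ∉ S.normalization.boundary ↔ D r ≠ conj (D r)) := by
    intro r hr
    have hfold := halfPlaneFold_doubleCoord (R := W.surface.normalization) (f := g) hK hcc hr
    have h1 : D r = conj (D r) ↔ (c.coord (g r)).im = 0 := by
      rw [← hfold, halfPlaneFold_im_eq_zero, eq_comm, Complex.conj_eq_iff_im]
    rw [Ne, h1]
    constructor
    · exact fun h => (hK.im_pos hcc hr h).ne'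
    · exact fun h h' => h (hK.im_eq_zero hcc hr h')
  have hU : ∀ᶠ r in 𝓝 q, r ∈ V ∧ g r ∈ c.source ∧ (r ≠ q → W.surface.p r ∉ W.surface.crossing) := by
    filter_upwards [hV.mem_nhds hqV, hF.eventually_mem hqc,
      eventually_nhdsWithin_iff.1 (eventually_p_notMem_nodes hR q)] with r h1 h2 h3
    exact ⟨h1, h2, fun h h' => h3 h (crossing_subset_nodes h')⟩
  have hU' : ∀ᶠ r in 𝓝 q', r ∈ V' ∧ g r ∈ c.source := by
    filter_upwards [hV'.mem_nhds hqV', hF.eventually_mem hqc'] with r h1 h2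
    exact ⟨h1, h2⟩
  have hI : D '' {r | r ∈ V ∧ g r ∈ c.source ∧ (r ≠ q → W.surface.p r ∉ W.surface.crossing)} ∈
      𝓝 (D q) := hm ▸ image_mem_map hU
  have hI' : D '' {r | r ∈ V' ∧ g r ∈ c.source} ∈ 𝓝 (D q) := by
    rw [hDD, ← hm']
    exact image_mem_map hU'
  have hnc : ∀ᶠ v in 𝓝 (D q), v ≠ conj v :=
    (isOpen_ne_fun continuous_id Complex.continuous_conj).mem_nhds ((hbev hqc).1 hb)
  -- `D` is open at both points and takes the same value there, so a nearby value `v` is attained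
  -- near each. It is chosen nonreal, to stay over the interior, and different from `D q`, to move
  -- off the node.
  obtain ⟨v, ⟨⟨⟨r, ⟨hrV, hrc, hrx⟩, hrv⟩, ⟨r', ⟨hrV', hrc'⟩, hrv'⟩⟩, hvc⟩, hvne⟩ :=
    Filter.nonempty_of_mem (f := 𝓝[≠] (D q))
      (inter_mem (nhdsWithin_le_nhds (inter_mem (inter_mem hI hI') hnc)) self_mem_nhdsWithin)
  have hrq : r ≠ q := fun h => hvne (by rw [← hrv, h]; rfl)
  have hgr : g r = g r' := by
    refine (hK.coordOn c hcc).injOn hrc hrc' ?_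
    rw [← halfPlaneFold_doubleCoord (R := W.surface.normalization) hK hcc hrc,
      ← halfPlaneFold_doubleCoord (R := W.surface.normalization) hK hcc hrc']
    exact congrArg _ (hrv.trans hrv'.symm)
  have hrb : g r ∉ S.normalization.boundary := (hbev hrc).2 (by rw [hrv]; exact hvc)
  have hrr : r ≠ r' := fun h => disjoint_left.1 hd hrV (h ▸ hrV')
  have h1 := hoff r r' hgr hrb hrr (hrx hrq) c hcc hrc
  rw [IsFolding.isPos_iff_im_pos hK hcc hrc hrb,
    IsFolding.isPos_iff_im_pos hK hcc hrc' (hgr ▸ hrb)] at h1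
  change 0 < (D r').im ↔ ¬ 0 < (D r).im at h1
  rw [hrv, hrv'] at h1
  tauto

end IsComplexDouble

variable {T : DoubleData S.normalization}

/-- The identification over the base of the normalization of a complex double with the complex
double of the normalization. -/
structure IsComparison (W : DoubleData S) (T : DoubleData S.normalization)
    (g : W.surface.Normalization → S.Normalization) (h : W.surface.Normalization ≃ₜ T.Y) :
    Prop where
  lifting : IsLifting W.surface S W.π g
  complete : IsCompleteLifting W.surface S W.π g
  oriented : IsOrientedDouble W.surface.normalization S.normalization g
  π_apply : ∀ q, T.π (h q) = g q
  doubleCoord_apply : ∀ q, ∀ c ∈ S.normalization.atlas, g q ∈ c.source →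
    T.surface.doubleCoord T.π c (h q) = W.surface.normalization.doubleCoord g c q

/-- The normalization of `W` and `T` are both oriented doubles of the same surface without nodes. -/
theorem IsComplexDouble.exists_isComparison (hW : W.IsComplexDouble) (hS : S.IsSurface)
    (hT : T.IsSmoothComplexDouble) : ∃ g h, IsComparison W T g h := by
  obtain ⟨g, hg, hgc, hu⟩ := hW.cover.2.2
  have h1 := hW.isOrientedDouble hS hg hu
  obtain ⟨h, hh, hd⟩ := h1.exists_homeomorph (hT.isOrientedDouble (isSmooth_normalization hS))
  exact ⟨g, h, hg, hgc, h1, hh, hd⟩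

namespace IsComparison

variable {g : W.surface.Normalization → S.Normalization} {h : W.surface.Normalization ≃ₜ T.Y}

theorem p_π (hg : IsComparison W T g h) (q : W.surface.Normalization) :
    S.p (T.π (h q)) = W.π (W.surface.p q) := by rw [hg.π_apply, hg.lifting.2]

theorem mem_crossing_iff (hg : IsComparison W T g h) (hW : W.IsComplexDouble)
    {q : W.surface.Normalization} :
    W.surface.p q ∈ W.surface.crossing ↔ h q ∈ T.overNodes := by
  rw [hW.mem_crossing_iff, ← hg.p_π]
  rfl

theorem isAnalyticCoord_iff (hg : IsComparison W T g h) (hS : S.IsSurface)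
    (hT : T.IsSmoothComplexDouble) {ζ : W.surface.Normalization → ℂ} {w : T.Y} :
    W.surface.normalization.IsAnalyticCoord ζ (h.symm w) ↔
      T.surface.IsAnalyticCoord (fun y => ζ (h.symm y)) w := by
  have hO := hT.isOrientedDouble (isSmooth_normalization hS)
  have hπ : ∀ w, g (h.symm w) = T.π w := fun w => by rw [← hg.π_apply, h.apply_symm_apply]
  constructor
  · refine hO.isAnalyticCoord_comp hg.oriented h.symm.continuous hπ fun w c hc hwc => ?_
    rw [← hg.doubleCoord_apply _ c hc (by rwa [hπ]), h.apply_symm_apply]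
  · intro hζ
    have := hg.oriented.isAnalyticCoord_comp (y := h.symm w) hO h.continuous hg.π_apply
      hg.doubleCoord_apply (ζ := fun y => ζ (h.symm y)) (by rwa [h.apply_symm_apply])
    simpa only [h.symm_apply_apply] using this

theorem exists_over (hg : IsComparison W T g h) {y : W.Y} {q : S.Normalization}
    (hq : S.p q = W.π y) : ∃ q', W.surface.p q' = y ∧ g q' = q := by
  have : q ∈ g '' (W.surface.p ⁻¹' {y}) := by rw [hg.complete]; exact hq
  obtain ⟨q', h1, h2⟩ := this
  exact ⟨q', h1, h2⟩

/-- The identification of points of `T` given by a complex double of the surface with nodes. -/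
theorem isGluing_ker (hg : IsComparison W T g h) (hS : S.IsSurface)
    (hW : W.IsComplexDouble) : T.IsGluing (Setoid.ker fun w =>
      W.surface.p (h.symm w)) where
  same_image a b hab := by
    have h1 := hg.p_π (h.symm a)
    have h2 := hg.p_π (h.symm b)
    rw [h.apply_symm_apply] at h1 h2
    rw [h1, h2]
    exact congrArg W.π hab
  off_nodes a b ha hab := by
    refine h.symm.injective (p_inj hab fun hx => ha ?_)
    rw [hg.mem_crossing_iff hW, h.apply_symm_apply] at hx
    exact hx
  two_three a b hab ha := by
    change W.surface.p (h.symm a) = W.surface.p (h.symm b)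
    have h1 := hg.p_π (h.symm a)
    have h2 := hg.π_apply (h.symm b)
    have h2' := hg.π_apply (h.symm a)
    rw [h.apply_symm_apply] at h1 h2 h2'
    rcases ha with ha | ha
    · have hx : W.surface.p (h.symm a) ∈ W.surface.crossing := by
        rw [hW.mem_crossing_iff, ← h1]
        exact Or.inl (Or.inr ha)
      -- Over an inessential node `W` has a node; its two branches both lie over the only preimage
      -- `T.π a` and exhaust the fibre there.
      obtain ⟨q, hne, hq⟩ := exists_ne_of_mem_crossing hx
      have hnx := notMem_crossing_of_mem_inessentialNodes hS ha
      have hgq : g q = T.π a := by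
        refine (p_inj ?_ hnx).symm
        rw [hg.lifting.2, hq, h1]
      by_cases hba : h.symm b = h.symm a
      · rw [hba]
      · have hba' : g (h.symm b) = T.π a := by rw [← h2]; exact (p_inj hab hnx).symm
        have : q = h.symm b := encard_eq_two_unique
          (hg.oriented.cover.interior_fiber (T.π a) (notMem_boundary_of_mem_inessentialNodes hS ha))
          h2'.symm hgq hba' hne.symm (Ne.symm hba)
        rw [← this, hq]
    · obtain ⟨q, hq, hgq⟩ := hg.exists_over (q := T.π b) (hab.symm.trans h1)
      have : q = h.symm b := encard_eq_one_unique (hg.oriented.cover.boundary_fiber (T.π b)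
        (mem_boundary_of_mem_boundaryNodes hS (hab ▸ ha))) hgq h2.symm
      rw [← this, hq]
  conic_inj a b ha hab hπ := by
    by_contra hne
    have h1 := hg.p_π (h.symm a)
    have h2 := hg.π_apply (h.symm b)
    have h3 := hg.π_apply (h.symm a)
    rw [h.apply_symm_apply] at h1 h2 h3
    -- By completeness, one branch at the node of `W` lies over the other branch `z` below. If `b`
    -- were a second point on the branch of `a`, it would have to be that one.
    obtain ⟨z, hz, hpz⟩ := exists_ne_of_mem_crossing (Or.inl ha)
    obtain ⟨q, hq, hgq⟩ := hg.exists_over (hpz.trans h1)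
    have : q = h.symm b := by
      refine eq_of_p_eq (q := h.symm a) hq hab.symm ?_ ?_
      · rintro rfl
        exact hz (hgq.symm.trans h3.symm)
      · exact fun he => hne (h.symm.injective he.symm)
    exact hz (by rw [← hgq, this, ← h2, hπ])
  conic_match a ha := by
    have h1 := hg.p_π (h.symm a)
    rw [h.apply_symm_apply] at h1
    obtain ⟨z, hz, hpz⟩ := exists_ne_of_mem_crossing (Or.inl ha)
    obtain ⟨q, hq, hgq⟩ := hg.exists_over (hpz.trans h1)
    refine ⟨h q, by rwa [hg.π_apply, hgq], ?_⟩
    change W.surface.p (h.symm a) = W.surface.p (h.symm (h q))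
    rw [h.symm_apply_apply, hq]

theorem dense_compl_overNodes (hS : S.IsSurface) (hT : T.IsSmoothComplexDouble) :
    Dense (T.overNodes)ᶜ := by
  intro w
  obtain ⟨d, hd, hwd⟩ := hT.isSmooth.covers w
  have := (hT.isSmooth.coord d hd w hwd).neBot_nhdsNE
  refine mem_closure_iff_frequently.2 ?_
  exact ((isolated_overNodes hS hT w).frequently).filter_mono nhdsWithin_le_nhds

/-- By continuity it suffices to compare off the nodes. There both sides are the other point of the
fibre over the interior, and the only point of the fibre over the boundary. -/
theorem σ_apply (hg : IsComparison W T g h) (hS : S.IsSurface)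
    (hT : T.IsSmoothComplexDouble) (hW : W.IsComplexDouble) (w : T.Y) :
    W.σ (W.surface.p (h.symm w)) = W.surface.p (h.symm (T.σ w)) := by
  have := hW.symmetric.1.t2
  have hK := isSmooth_normalization hS
  have hc : Continuous fun w => W.surface.p (h.symm w) :=
    (continuous_p _).comp h.symm.continuous
  refine congrFun (Continuous.ext_on (dense_compl_overNodes hS hT)
    (hW.symmetric.2.1.1.continuous.comp hc) (hc.comp hT.symmetric.2.1.1.continuous)
    fun w hw => ?_) w
  change W.σ (W.surface.p (h.symm w)) = W.surface.p (h.symm (T.σ w))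
  have hx : W.surface.p (h.symm w) ∉ W.surface.crossing := by
    rwa [hg.mem_crossing_iff hW, h.apply_symm_apply]
  have h1 : g (h.symm w) = T.π w := by rw [← hg.π_apply, h.apply_symm_apply]
  have h2 : g (h.symm (T.σ w)) = T.π w := by rw [← hg.π_apply, h.apply_symm_apply, hT.comp]
  by_cases hb : T.π w ∈ S.normalization.boundary
  · obtain ⟨q, hq⟩ := p_surjective W.surface (W.σ (W.surface.p (h.symm w)))
    have hgq : g q = T.π w := by
      have he : S.p (g q) = S.p (T.π w) := by
        rw [hg.lifting.2, hq, hW.comp, ← hg.p_π, h.apply_symm_apply]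
      exact p_inj he fun hx' => hw (crossing_subset_nodes (he ▸ hx'))
    rw [← hq, encard_eq_one_unique (hg.oriented.cover.boundary_fiber _ hb) hgq h2]
  · obtain ⟨q, hgq, hq, hpos⟩ :=
      hW.exists_conjugate hS hg.lifting hg.oriented.cover hx (by rwa [h1])
    obtain ⟨c, hc, hwc⟩ := hK.covers (T.π w)
    have hne : h.symm w ≠ q := by
      rintro rfl
      have := hpos c hc (h1 ▸ hwc)
      tauto
    rw [← hq, encard_eq_two_unique (hg.oriented.cover.interior_fiber _ hb) h1 (hgq.trans h1) h2 hne]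
    exact fun he => hT.σ_ne hK hb (h.symm.injective he.symm)

theorem isQuotientOf (hg : IsComparison W T g h) (hS : S.IsSurface)
    (hT : T.IsSmoothComplexDouble) (hW : W.IsComplexDouble) :
    IsQuotientOf W T (Setoid.ker fun w => W.surface.p (h.symm w))
      (fun w => W.surface.p (h.symm w)) h.symm where
  isSurface := hW.symmetric.1
  isQuotientMap := (isQuotientMap_p hW.symmetric.1).comp h.symm.isQuotientMap
  apply_eq_iff a b := Iff.rfl
  mem_conicNodes w := by
    rw [← h.apply_symm_apply w, ← hg.mem_crossing_iff hW, h.apply_symm_apply, crossing,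
      boundaryNodes_riemann, union_empty]
  nhds_eq w hw := by
    rw [← map_p_nhds_of_notMem hW.symmetric.1, ← h.symm.map_nhds_eq, map_map]
    · rfl
    · rwa [hg.mem_crossing_iff hW, h.apply_symm_apply]
  p_apply w := rfl
  isAnalyticCoord_comp c hc w hw :=
    (hg.isAnalyticCoord_iff hS hT).1 (isAnalyticCoord_p hW.symmetric.1 hc hw)
  isAnalyticCoord_iff ζ w := hg.isAnalyticCoord_iff hS hT
  π_apply w := by rw [← hg.p_π, h.apply_symm_apply]
  σ_apply := hg.σ_apply hS hT hW

end IsComparison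

end DoubleData
end

noncomputable section

/-! ### Isomorphisms of complex doubles. -/

section Morphisms

open NodalSurfaceData

variable {X X' X'' : Type u} [TopologicalSpace X] [TopologicalSpace X'] [TopologicalSpace X'']
  {R : NodalSurfaceData .riemann X} {R' : NodalSurfaceData .riemann X'}
  {R'' : NodalSurfaceData .riemann X''}

theorem IsNodalMap.preimage_nodes {f : X → X'} (hf : IsNodalMap R R' f) :
    f ⁻¹' R'.nodes ⊆ R.nodes := by
  rintro x ((h | h) | h)
  · exact Or.inl (Or.inl (hf.conic h))
  · exact (hf.inessential h).elim (fun h => Or.inl (Or.inr h)) fun h => Or.inl (Or.inl h)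
  · exact (hf.boundaryNode h).elim (fun h => Or.inr h) fun h => Or.inl (Or.inl h)

theorem IsRiemannMorphism.refl (hR : R.IsSurface) : IsRiemannMorphism R R id := by
  refine ⟨⟨⟨continuous_id, subset_rfl, subset_union_left, subset_union_left, ?_⟩, fun x _ => ?_⟩,
    id, ⟨continuous_id, fun _ => rfl⟩, fun x => image_id _⟩
  · rw [image_id]
  · obtain ⟨c, hc, hx⟩ := hR.covers x
    exact ⟨c, hc, c, hc, hx, hx, AnalyticRel.refl _ _⟩

theorem IsRiemannMorphism.trans {f : X → X'} {f' : X' → X''} (hR' : R'.IsSurface)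
    (h : IsRiemannMorphism R R' f) (h' : IsRiemannMorphism R' R'' f') :
    IsRiemannMorphism R R'' (f' ∘ f) := by
  obtain ⟨⟨hn, ha⟩, k, hk, hkc⟩ := h
  obtain ⟨⟨hn', ha'⟩, k', hk', hkc'⟩ := h'
  refine ⟨⟨⟨hn'.continuous.comp hn.continuous, fun x hx => hn.conic (hn'.conic hx), fun x hx => ?_,
    fun x hx => ?_, ?_⟩, fun x hx => ?_⟩, k' ∘ k, ⟨hk'.1.comp hk.1, fun q => ?_⟩, fun x => ?_⟩
  · rcases hn'.inessential hx with h | h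
    · exact hn.inessential h
    · exact Or.inr (hn.conic h)
  · rcases hn'.boundaryNode hx with h | h
    · exact hn.boundaryNode h
    · exact Or.inr (hn.conic h)
  · rw [boundary_riemann, image_empty]
    exact empty_subset _
  · have hx' : f x ∉ R'.nodes := fun h => hx (hn.preimage_nodes h)
    obtain ⟨c, hc, d, hd, hxc, hxd, h1⟩ := ha x hx
    obtain ⟨d', hd', e, he, hxd', hxe, h2⟩ := ha' (f x) hx'
    have h3 : AnalyticRel d.coord d'.coord (f x) := (hR'.compatible d hd d' hd' _ ⟨hxd, hxd'⟩ hx').1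
    exact ⟨c, hc, e, he, hxc, hxe, h1.trans ((h3.trans h2).comp hn.continuous.continuousAt)⟩
  · rw [Function.comp_apply, hk'.2, hk.2]
    rfl
  · rw [image_comp, hkc, hkc']
    rfl

end Morphisms

namespace DoubleData

open NodalSurfaceData

variable {X : Type u} [TopologicalSpace X] {S : NodalSurfaceData .klein X}
  {T : DoubleData S.normalization} {W W' W'' : DoubleData S}

theorem IsIso.refl (hW : W.IsComplexDouble) : IsIso W W (Equiv.refl _) :=
  ⟨IsRiemannMorphism.refl hW.symmetric.1, IsRiemannMorphism.refl hW.symmetric.1, fun _ => rfl,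
    fun _ => rfl⟩

theorem IsIso.symm {f : W.Y ≃ W'.Y} (h : IsIso W W' f) : IsIso W' W f.symm :=
  ⟨h.morphism_symm, h.morphism,
    fun y => by rw [Equiv.symm_apply_eq, h.comm, f.apply_symm_apply],
    fun y => by rw [← h.proj, f.apply_symm_apply]⟩

theorem IsIso.trans {f : W.Y ≃ W'.Y} {f' : W'.Y ≃ W''.Y} (hW' : W'.IsComplexDouble)
    (h : IsIso W W' f) (h' : IsIso W' W'' f') : IsIso W W'' (f.trans f') :=
  ⟨IsRiemannMorphism.trans (f := f) (f' := f') hW'.symmetric.1 h.morphism h'.morphism,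
    IsRiemannMorphism.trans (f := f'.symm) (f' := f.symm) hW'.symmetric.1 h'.morphism_symm
      h.morphism_symm,
    fun y => by rw [Equiv.trans_apply, Equiv.trans_apply, h.comm, h'.comm],
    fun y => by rw [Equiv.trans_apply, h'.proj, h.proj]⟩

namespace IsQuotientOf

variable {r : Setoid T.Y} {m : T.Y → W.Y} {k : T.Y ≃ₜ W.surface.Normalization}
  {m' : T.Y → W'.Y} {k' : T.Y ≃ₜ W'.surface.Normalization}

/-- The map is induced by the identity of `T`, so its lifting is the composition of the two
identifications of the normalizations with `T`; completeness holds because the classes are the same.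
-/
theorem isRiemannMorphism (h : IsQuotientOf W T r m k) (h' : IsQuotientOf W' T r m' k')
    (hT : T.IsSmoothComplexDouble) {f : W.Y → W'.Y} (hf : ∀ w, f (m w) = m' w) :
    IsRiemannMorphism W.surface W'.surface f := by
  have hsurj := h.isQuotientMap.surjective
  refine ⟨⟨⟨?_, fun x hx => ?_, ?_, ?_, ?_⟩, fun x hx => ?_⟩, fun q => k' (k.symm q),
    ⟨k'.continuous.comp k.symm.continuous, fun q => ?_⟩, fun x => ?_⟩
  · refine h.isQuotientMap.continuous_iff.2 ?_
    rw [show f ∘ m = m' from funext hf]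
    exact h'.isQuotientMap.continuous
  · obtain ⟨w, rfl⟩ := hsurj x
    rw [h.mem_conicNodes, ← h'.mem_conicNodes, ← hf]
    exact hx
  · rw [inessentialNodes, h'.isSurface.distinguished_riemann rfl, preimage_empty]
    exact empty_subset _
  · rw [boundaryNodes_riemann, preimage_empty]
    exact empty_subset _
  · rw [boundary_riemann, image_empty]
    exact empty_subset _
  · obtain ⟨w, rfl⟩ := hsurj x
    rw [h.isSurface.nodes_riemann, h.mem_conicNodes] at hx
    obtain ⟨c, hc, hwc⟩ := h.isSurface.covers (m w)
    obtain ⟨c', hc', hwc'⟩ := h'.isSurface.covers (m' w)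
    refine ⟨c, hc, c', hc', hwc, (hf w).symm ▸ hwc', ?_⟩
    obtain ⟨F, hF, hFe⟩ := (h.isAnalyticCoord_comp c hc w hwc).rel
      (h'.isAnalyticCoord_comp c' hc' w hwc') hT.isSmooth
    refine ⟨F, hF, ?_⟩
    rw [h.nhds_eq w hx, eventually_map]
    filter_upwards [hFe] with y hy
    rw [hf, hy]
  · rw [h'.p_apply, ← hf, ← h.p_apply, k.apply_symm_apply]
  · obtain ⟨w, rfl⟩ := hsurj x
    rw [hf]
    ext q
    constructor
    · rintro ⟨q', hq', rfl⟩
      rw [mem_preimage, mem_singleton_iff, h'.p_apply, ← hf, ← h.p_apply,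
        k.apply_symm_apply, hq', hf]
    · intro hq
      obtain ⟨w', rfl⟩ := k'.surjective q
      rw [mem_preimage, mem_singleton_iff, h'.p_apply, h'.apply_eq_iff, ← h.apply_eq_iff] at hq
      exact ⟨k w', (h.p_apply w').trans hq, congrArg k' (k.symm_apply_apply w')⟩

theorem exists_isIso (h : IsQuotientOf W T r m k) (h' : IsQuotientOf W' T r m' k')
    (hT : T.IsSmoothComplexDouble) : ∃ f, IsIso W W' f := by
  choose s hs using h.isQuotientMap.surjective
  choose s' hs' using h'.isQuotientMap.surjective
  have hf : ∀ w, m' (s (m w)) = m' w := fun w => by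
    rw [h'.apply_eq_iff, ← h.apply_eq_iff, hs]
  have hf' : ∀ w, m (s' (m' w)) = m w := fun w => by
    rw [h.apply_eq_iff, ← h'.apply_eq_iff, hs']
  let f : W.Y ≃ W'.Y :=
    { toFun := fun y => m' (s y)
      invFun := fun y => m (s' y)
      left_inv := fun y => (hf' (s y)).trans (hs y)
      right_inv := fun y => (hf (s' y)).trans (hs' y) }
  refine ⟨f, h.isRiemannMorphism h' hT hf, h'.isRiemannMorphism h hT hf', fun y => ?_, fun y => ?_⟩
  · change m' (s (W.σ y)) = W'.σ (m' (s y))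
    rw [h'.σ_apply, ← hf (T.σ (s y)), ← h.σ_apply, hs]
  · change W'.π (m' (s y)) = W.π y
    rw [h'.π_apply, ← h.π_apply, hs]

end IsQuotientOf

/-- An isomorphism onto a quotient of `T` is induced by the comparison map. -/
theorem IsIso.apply_p {g : W.surface.Normalization → S.Normalization}
    {h : W.surface.Normalization ≃ₜ T.Y} {r : Setoid T.Y} {m : T.Y → W'.Y}
    {k : T.Y ≃ₜ W'.surface.Normalization} {f : W.Y ≃ W'.Y} (hS : S.IsSurface)
    (hT : T.IsSmoothComplexDouble) (hW : W.IsComplexDouble) (hg : IsComparison W T g h)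
    (hQ : IsQuotientOf W' T r m k) (hf : IsIso W W' f) (q : W.surface.Normalization) :
    f (W.surface.p q) = m (h q) := by
  have hR := hW.symmetric.1
  have hK := isSmooth_normalization hS
  have hO := hT.isOrientedDouble hK
  have := hT.symmetric.1.t2
  obtain ⟨⟨hn, ha⟩, l, hl, -⟩ := hf.morphism
  -- The lifting of `f`, read as a map to `T`. It is to be compared with `h`, on a dense set, by
  -- fibres and orientation.
  let u : W.surface.Normalization → T.Y := fun q => k.symm (l q)
  have hu : Continuous u := k.symm.continuous.comp hl.1
  have hmu : ∀ q, m (u q) = f (W.surface.p q) := fun q => by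
    rw [← hQ.p_apply, ← hl.2]
    exact congrArg _ (k.apply_symm_apply _)
  have hpu : ∀ q, S.p (T.π (u q)) = S.p (g q) := fun q => by
    rw [← hQ.π_apply, hmu, hf.proj, hg.lifting.2]
  have hdense : Dense (h ⁻¹' (T.overNodes)ᶜ) :=
    (IsComparison.dense_compl_overNodes hS hT).preimage h.isOpenMap
  suffices hkey : EqOn u h (h ⁻¹' (T.overNodes)ᶜ) by
    rw [← hmu, Continuous.ext_on hdense hu h.continuous hkey]
  have hπu : ∀ q, h q ∉ T.overNodes → T.π (u q) = g q := fun q hq => by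
    refine p_inj (hpu q) fun hx => hq ?_
    rw [hpu, ← hg.π_apply] at hx
    exact crossing_subset_nodes hx
  intro q hq
  have hq' : h q ∉ T.overNodes := hq
  have hx : W.surface.p q ∉ W.surface.crossing := by rwa [hg.mem_crossing_iff hW]
  by_cases hb : g q ∈ S.normalization.boundary
  · exact encard_eq_one_unique (hO.cover.boundary_fiber _ hb) (hπu q hq') (hg.π_apply q)
  obtain ⟨c, hc, hqc⟩ := hK.covers (g q)
  refine hO.eq_of_isPos hc ((hπu q hq').trans (hg.π_apply q).symm) (by rwa [hπu q hq']) ?_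
  have h1 : T.surface.IsPos T.π c (h q) ↔ W.surface.normalization.IsPos g c q := by
    rw [IsFolding.isPos_iff_im_pos hK hc (by rwa [hg.π_apply]) (by rwa [hg.π_apply]),
      IsFolding.isPos_iff_im_pos hK hc hqc hb, hg.doubleCoord_apply q c hc hqc]
  rw [h1]
  have hev : ∀ᶠ q' in 𝓝 q, T.π (u q') = g q' := by
    have hcl : IsOpen (T.overNodes)ᶜ := by
      refine isOpen_iff_mem_nhds.2 fun w hw => ?_
      rw [← nhdsNE_sup_pure, mem_sup, mem_pure]
      exact ⟨isolated_overNodes hS hT w, hw⟩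
    filter_upwards [h.continuous.continuousAt.preimage_mem_nhds (hcl.mem_nhds hq)] with q' h
    exact hπu q' h
  obtain ⟨c₁, hc₁, c₂, hc₂, hx₁, hx₂, hrel⟩ := ha _ (hW.notMem_nodes hx)
  have hζ := isAnalyticCoord_p hR hc₁ hx₁
  have hξ := hQ.isAnalyticCoord_comp c₂ hc₂ (u q) (by rwa [hmu])
  -- Since `f` is analytic, `u` is analytic at `q` and preserves orientation. Together with the
  -- equality of projections this leaves `h q` as the only possible value.
  have hrel' : AnalyticRel (fun q' => c₁.coord (W.surface.p q'))
      (fun q' => c₂.coord (m (u q'))) q := by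
    refine AnalyticRel.congr (hrel.comp (continuous_p _).continuousAt) (EventuallyEq.refl _ _) ?_
    exact Eventually.of_forall fun q' => by simp only [hmu]
  have hsm := isSmooth_normalization hR
  have hcg : (fun q' => c.coord (T.π (u q'))) =ᶠ[𝓝 q] fun q' => c.coord (g q') := by
    filter_upwards [hev] with q' h
    rw [h]
  have hqu : T.π (u q) = g q := hev.self_of_nhds
  constructor
  · intro hpos
    rw [hξ.isPos_iff hT.isSmooth] at hpos
    rw [hζ.isPos_iff hsm]
    exact (hrel'.trans (hpos.comp hu.continuousAt)).congr (EventuallyEq.refl _ _) hcg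
  · intro hpos
    by_contra hneg
    obtain ⟨d, hd, hud⟩ := hT.isSmooth.covers (u q)
    have h2 := hO.antianalyticRel_of_not_isPos hd hud hc (by rwa [hqu]) (by rwa [hqu]) hneg
    have h3 := (hrel'.trans_anti (((hξ d hd hud).2.trans_anti h2).comp hu.continuousAt)).congr
      (EventuallyEq.refl _ _) hcg
    obtain ⟨e, he, hqe⟩ := hsm.covers q
    exact hg.oriented.not_isPos_of_antianalyticRel he hqe hc hqc hb
      ((hζ e he hqe).1.trans_anti h3) hpos

/-- Every complex double is obtained by exactly one identification. -/
theorem existsUnique_gluing (hS : S.IsSurface) (hT : T.IsSmoothComplexDouble)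
    (hW : W.IsComplexDouble) : ∃! g : T.Gluing, ∃ f, IsIso W (T.glue g) f := by
  obtain ⟨g, h, hg⟩ := hW.exists_isComparison hS hT
  refine ⟨⟨_, hg.isGluing_ker hS hW⟩,
    (hg.isQuotientOf hS hT hW).exists_isIso (isQuotientOf_glue hS hT _) hT, ?_⟩
  rintro g' ⟨f, hf⟩
  refine Subtype.ext (Setoid.ext fun a b => ?_)
  have hQ := isQuotientOf_glue hS hT g'
  -- An isomorphism is injective and induced by `h`, so two points are identified by `g'` exactly
  -- when they give the same point of `W`; this leaves no freedom for `g'`.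
  rw [← hQ.apply_eq_iff, ← h.apply_symm_apply a, ← h.apply_symm_apply b,
    ← hf.apply_p hS hT hW hg hQ, ← hf.apply_p hS hT hW hg hQ, f.apply_eq_iff_eq,
    h.apply_symm_apply, h.apply_symm_apply]
  rfl

/-- Both isomorphisms are prescribed on the image of the normalization, which is everything. -/
theorem IsIso.unique (hS : S.IsSurface) (hT : T.IsSmoothComplexDouble) (hW : W.IsComplexDouble)
    {g : T.Gluing} {f f' : W.Y ≃ (T.glue g).Y} (hf : IsIso W (T.glue g) f)
    (hf' : IsIso W (T.glue g) f') : f = f' := by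
  obtain ⟨g₀, h, hg⟩ := hW.exists_isComparison hS hT
  have hQ := isQuotientOf_glue hS hT g
  refine Equiv.ext fun y => ?_
  obtain ⟨q, rfl⟩ := p_surjective W.surface y
  rw [hf.apply_p hS hT hW hg hQ, hf'.apply_p hS hT hW hg hQ]

end DoubleData

/-! ### The isomorphism classes of complex doubles. -/

namespace ComplexDouble

variable {X : Type u} [TopologicalSpace X] {S : NodalSurfaceData .klein X}

theorem isomorphic_equivalence : Equivalence (Isomorphic (S := S)) where
  refl W := ⟨_, DoubleData.IsIso.refl W.2⟩
  symm := fun ⟨_, h⟩ => ⟨_, h.symm⟩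
  trans := fun {_ W' _} ⟨_, h⟩ ⟨_, h'⟩ => ⟨_, h.trans W'.2 h'⟩

theorem bijective_mk_glue (hS : S.IsSurface) {T : DoubleData S.normalization}
    (hT : T.IsSmoothComplexDouble) : Function.Bijective fun g : T.Gluing =>
      Quot.mk (Isomorphic (S := S)) ⟨T.glue g, DoubleData.isComplexDouble_glue hS hT g⟩ := by
  constructor
  · intro g g' he
    have h : Isomorphic _ _ := (isomorphic_equivalence.quot_mk_eq_iff _ _).1 he
    exact (DoubleData.existsUnique_gluing hS hT (DoubleData.isComplexDouble_glue hS hT g)).unique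
      ⟨_, DoubleData.IsIso.refl (DoubleData.isComplexDouble_glue hS hT g)⟩ h
  · rintro ⟨W⟩
    obtain ⟨g, hg, -⟩ := DoubleData.existsUnique_gluing hS hT W.2
    exact ⟨g, Quot.sound (isomorphic_equivalence.symm hg)⟩

/-- With one double of the normalization fixed, the classes correspond to its gluings. The lift
appears because the doubles form a type one universe higher than the gluings. -/
theorem mk_quot_isomorphic (hS : S.IsSurface) :
    Cardinal.mk (Quot (Isomorphic (S := S))) =
      Cardinal.lift.{u + 1, u} (2 ^ Cardinal.mk S.conicNodes) := by
  obtain ⟨T, hT⟩ := NodalSurfaceData.exists_isSmoothComplexDouble hS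
  rw [← DoubleData.mk_gluing hS hT, ← Cardinal.lift_id'.{u, u + 1} (Cardinal.mk (Quot _))]
  exact (Cardinal.lift_mk_eq'.2 ⟨Equiv.ofBijective _ (bijective_mk_glue hS hT)⟩).symm

theorem exists_not_isomorphic (hS : S.IsSurface) (h : S.conicNodes.Nonempty) :
    ∃ W W' : ComplexDouble S, ¬ W.Isomorphic W' := by
  by_contra! hcon
  have hsub : Subsingleton (Quot (Isomorphic (S := S))) :=
    ⟨by rintro ⟨W⟩ ⟨W'⟩; exact Quot.sound (hcon W W')⟩
  have h2 := Cardinal.le_one_iff_subsingleton.2 hsub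
  rw [mk_quot_isomorphic hS, Cardinal.lift_le_one_iff] at h2
  have : Nonempty S.conicNodes := h.to_subtype
  have h3 : (1 : Cardinal) < 2 ^ Cardinal.mk S.conicNodes :=
    (Cardinal.one_le_iff_ne_zero.2 (Cardinal.mk_ne_zero _)).trans_lt (Cardinal.cantor _)
  exact absurd h2 (not_le.2 h3)

end ComplexDouble
end

theorem mainTheorem1 {X : Type u} [TopologicalSpace X] (S : NodalSurfaceData SurfaceKind.klein X)
    (hS : S.IsSurface) :
    (∃ T : DoubleData S.normalization, T.IsSmoothComplexDouble) ∧
    (∀ T : DoubleData S.normalization, T.IsSmoothComplexDouble →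
      Cardinal.mk T.Gluing = 2 ^ Cardinal.mk S.conicNodes ∧
      (∀ g : T.Gluing, (T.glue g).IsComplexDouble ∧
        ∀ w : T.Y, (T.glue g).σ (Quotient.mk g.1 w) = Quotient.mk g.1 (T.σ w)) ∧
      (∀ W : DoubleData S, W.IsComplexDouble →
        (∃! g : T.Gluing, ∃ f, DoubleData.IsIso W (T.glue g) f) ∧
        ∀ g : T.Gluing, ∀ f f', DoubleData.IsIso W (T.glue g) f →
          DoubleData.IsIso W (T.glue g) f' → f = f')) ∧
    Equivalence (ComplexDouble.Isomorphic (S := S)) ∧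
    Cardinal.mk (Quot (ComplexDouble.Isomorphic (S := S))) =
      Cardinal.lift.{u + 1, u} (2 ^ Cardinal.mk S.conicNodes) ∧
    (S.conicNodes.Nonempty → ∃ W W' : ComplexDouble S, ¬ W.Isomorphic W') :=
  ⟨NodalSurfaceData.exists_isSmoothComplexDouble hS,
    fun _ hT => ⟨DoubleData.mk_gluing hS hT,
      fun g => ⟨DoubleData.isComplexDouble_glue hS hT g, DoubleData.glue_σ_mk hS hT g⟩,
      fun _ hW => ⟨DoubleData.existsUnique_gluing hS hT hW,
        fun _ _ _ hf hf' => hf.unique hS hT hW hf'⟩⟩,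
    ComplexDouble.isomorphic_equivalence, ComplexDouble.mk_quot_isomorphic hS,
    ComplexDouble.exists_not_isomorphic hS⟩
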